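/- **Setting.** Fix a finite layered state space $S=S_0\sqcup\dots\sqcup S_L$ with nonempty layers, $|S_0|=|S_L|=1$, a finite nonempty action set $A$, and a horizon $T\ge 2$. In round $t=1,\dots,T$ the environment chooses an MDP consisting of a transition $P_t$ (for $(s,a)\in S_k\times A$ a distribution on $S_{k+1}$, $k<L$) and a loss $\ell_t:S_k\times A\to[0,1]$ ($k<L$). The learner chooses a stochastic policy $\pi_t$, a trajectory is generated by executing $\pi_t$ under $P_t$, and the bandit feedback is the trajectory together with the losses along it. Let $\ell_t(\pi)$ be the expected total loss of $\pi$ in the $t$-th MDP. Corruption is measured relative to a ground truth transition $P$: $C^{\mathsf P}_t=\sum_{k<L}\max_{(s,a)\in S_k\times A}\|P_t(\cdot|s,a)-P(\cdot|s,a)\|_1$ and $C^{\mathsf P}_{1:n}=\sum_{t\le n}C^{\mathsf P}_t$. The environment is either *oblivious* (all its choices, including the $w_t$ below, are made before the first round, possibly at random) or *adaptive* (its choices for round $t$ may depend on everything that happened in rounds $1,\dots,t-1$, including the learner's past randomisation). **Corruption-robust algorithm.** An algorithm draws $\pi_t$ from a distribution determined by its record of past policies and feedback. A family of algorithms with input $\theta\ge0$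 is corruption-robust with constants $\beta_1\ge L^2,\ \beta_2\ge L,\ \beta_3\ge1$ if for every $\theta\ge 0$, every environment of the given kind, every ground truth $P$, every random stopping time $t'\le T$ and every fixed policy $\pi$, $$\mathbb E\Big[\sum_{t=1}^{t'}(\ell_t(\pi_t)-\ell_t(\pi))\Big]\le \mathbb E\big[\sqrt{\beta_1t'}+(\beta_2+\beta_3\theta)\mathbb 1\{t'\ge1\}\big]+\Pr[C^{\mathsf P}_{1:t'}>\theta]\,LT .$$ **$\tfrac12$-stable corruption-robust algorithm.** Protocol: in every round $t$ a probability $w_t\in[0,1]$, chosen by the environment, is revealed to the learner before its decision; after its decision it sees the feedback with probability $w_t$ (independently) and nothing otherwise. A learner that is told a number $C\ge0$ is $\tfrac12$-stable corruption-robust with constants $\beta_1'\ge L^2,\ \beta_2'\ge L,\ \beta_3'\ge1$ if, under this protocol, for every $C\ge 0$, every environment of the given kind and every ground truth $P$ with $C^{\mathsf P}_{1:T}\le C$ almost surely, and every fixed policy $\pi$, $$\mathbb E\Big[\sum_{t=1}^{T}(\ell_t(\pi_t)-\ell_t(\pi))\Big]\le \mathbb E\big[\sqrt{\beta_1'\rho_TT}+\beta_2'\rho_T\big]+\beta_3'C,\qquad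 \rho_T=\frac1{\min_{t\le T}w_t}\in[1,\infty].$$ **STABILISE.** Given $C$ and a base algorithm, create instances $\mathsf{ALG}_j$, $j=0,\dots,\lceil\log_2T\rceil$, of the base algorithm with input $\theta_j=2^{-j+1}C+16L\log T$. In round $t$, if $w_t\le 1/T$, play an arbitrary policy and update nothing. Otherwise let $j_t$ be such that $w_t\in(2^{-j_t-1},2^{-j_t}]$ and play the policy $\pi_t$ suggested by $\mathsf{ALG}_{j_t}$, that is, drawn from the distribution it prescribes given its record; if feedback is received, pass it (with $\pi_t$) to $\mathsf{ALG}_{j_t}$ with probability $2^{-j_t-1}/w_t$ and discard it otherwise. **Theorem.** There is a universal constant $c>0$ such that the following holds for both kinds of environments. If a base algorithm is corruption-robust with constants $(\beta_1,\beta_2,\beta_3)$ against environments of that kind, then there are constants $$\beta_1'\le c\,\beta_1\log T,\qquad \beta_2'\le c\,(\beta_2+\beta_3L\log T),\qquad \beta_3'\le c\,\beta_3\log T$$ such that STABILISE, run with this base algorithm and any choice of the arbitrary policies, is $\tfrac12$-stable corruption-robust with constants $(\beta_1',\beta_2',\beta_3')$ against environments of the same kind. -/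

import Mathlib

open MeasureTheory ProbabilityTheory
open scoped ENNReal

universe u

noncomputable section

/-! ### Layered episodic MDPs -/

namespace LayeredMDP

variable {L : ℕ} (S : Fin (L + 1) → Type u) (A : Type u)
  [∀ k, Fintype (S k)] [Fintype A]

/-- A stochastic policy: for every layer `k < L` and every state of layer `k`, a probability
vector on the actions. -/
abbrev Policy : Type u := ∀ k : Fin L, S k.castSucc → stdSimplex ℝ A

/-- A valid transition function: for every `k < L` and `(s, a)` in layer `k`, a probability vector
on the states of layer `k + 1`. -/
abbrev Transition : Type u := ∀ k : Fin L, S k.castSucc → A → stdSimplex ℝ (S k.succ)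

/-- A loss function, with values in `[0, 1]`. -/
abbrev Loss : Type u := ∀ k : Fin L, S k.castSucc → A → unitInterval

/-- The MDP of one episode: a transition function and a loss function. -/
abbrev MDP : Type u := Transition S A × Loss S A

/-- A trajectory: the states visited in layers `0, …, L` and the actions in layers
`0, …, L - 1`. -/
def Traj : Type u := (∀ k : Fin (L + 1), S k) × (Fin L → A)

instance : Fintype (Traj S A) :=
  haveI : DecidableEq (Fin (L + 1)) := inferInstance
  inferInstanceAs (Fintype ((∀ k : Fin (L + 1), S k) × (Fin L → A)))

instance : MeasurableSpace (Traj S A) := ⊤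

instance : DiscreteMeasurableSpace (Traj S A) := ⟨fun _ => trivial⟩

/-- Bandit feedback of one episode: the trajectory and the losses along it. -/
abbrev Feedback : Type u := Traj S A × (Fin L → unitInterval)

/-- A finite record of (executed policy, observed feedback) pairs. -/
abbrev History : Type u := Σ n : ℕ, (Fin n → Policy S A × Feedback S A)

variable {S A}

/-- Probability of a trajectory when executing `p` under transition `P` (layer `0` is a single
state, so no initial distribution occurs). -/
def trajProb (P : Transition S A) (p : Policy S A) (x : Traj S A) : ℝ :=
  ∏ k : Fin L, p k (x.1 k.castSucc) (x.2 k) *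
    P k (x.1 k.castSucc) (x.2 k) (x.1 k.succ)

/-- The feedback generated by a trajectory `x` in the MDP `M`. -/
def feedback (M : MDP S A) (x : Traj S A) : Feedback S A :=
  (x, fun k => M.2 k (x.1 k.castSucc) (x.2 k))

/-- Expected total loss of a policy in the MDP `M`. -/
def expLoss (M : MDP S A) (p : Policy S A) : ℝ :=
  ∑ x : Traj S A, trajProb M.1 p x * ∑ k : Fin L, (M.2 k (x.1 k.castSucc) (x.2 k) : ℝ)

/-- Corruption of one episode relative to the ground truth transition `P`:
the sum over the layers of the largest `ℓ₁` distance between the transition probabilities. -/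
def corruption (P : Transition S A) (M : MDP S A) : ℝ :=
  ∑ k : Fin L, ⨆ sa : S k.castSucc × A,
    ∑ s' : S k.succ, |M.1 k sa.1 sa.2 s' - P k sa.1 sa.2 s'|

/-- Append one (policy, feedback) pair to a record. -/
def History.append (h : History S A) (y : Policy S A × Feedback S A) : History S A :=
  ⟨h.1 + 1, Fin.snoc (α := fun _ => Policy S A × Feedback S A) h.2 y⟩

theorem History.measurable_append :
    Measurable (fun z : History S A × (Policy S A × Feedback S A) => z.1.append z.2) := by
  have key : ∀ n : ℕ, Measurable
      (fun z : (Fin n → Policy S A × Feedback S A) × (Policy S A × Feedback S A) =>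
        (⟨n + 1, Fin.snoc (α := fun _ => Policy S A × Feedback S A) z.1 z.2⟩ : History S A)) := by
    intro n
    have hmk : Measurable (fun f : Fin (n + 1) → Policy S A × Feedback S A =>
        (⟨n + 1, f⟩ : History S A)) := measurable_iff_le_map.2 (iInf_le _ _)
    refine hmk.comp (measurable_pi_iff.2 fun i => ?_)
    refine Fin.lastCases ?_ (fun i => ?_) i
    · simpa using measurable_snd
    · simp only [Fin.snoc_castSucc]
      exact (measurable_pi_apply i).comp measurable_fst
  intro s hs
  have hset : (fun z : History S A × (Policy S A × Feedback S A) => z.1.append z.2) ⁻¹' s =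
      ⋃ n : ℕ, (fun z : (Fin n → Policy S A × Feedback S A) × (Policy S A × Feedback S A) =>
        ((⟨n, z.1⟩ : History S A), z.2)) ''
        ((fun z : (Fin n → Policy S A × Feedback S A) × (Policy S A × Feedback S A) =>
        (⟨n + 1, Fin.snoc (α := fun _ => Policy S A × Feedback S A) z.1 z.2⟩ : History S A)) ⁻¹'
          s) := by
    ext ⟨⟨n, f⟩, y⟩
    simp only [Set.mem_preimage, Set.mem_iUnion, Set.mem_image]
    constructor
    · intro h
      exact ⟨n, (f, y), h, rfl⟩
    · rintro ⟨m, z, h, hz⟩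
      cases hz
      exact h
  rw [hset]
  refine MeasurableSet.iUnion fun n => ?_
  have hemb : MeasurableEmbedding
      (fun z : (Fin n → Policy S A × Feedback S A) × (Policy S A × Feedback S A) =>
        ((⟨n, z.1⟩ : History S A), z.2)) := by
    have : MeasurableEmbedding (fun f : Fin n → Policy S A × Feedback S A =>
        (⟨n, f⟩ : History S A)) := by
      have hinj : Function.Injective (fun f : Fin n → Policy S A × Feedback S A =>
          (⟨n, f⟩ : History S A)) := fun f g hfg => by
        cases hfg
        rfl
      refine ⟨hinj, measurable_iff_le_map.2 (iInf_le _ _), ?_⟩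
      intro t ht
      refine MeasurableSpace.measurableSet_iInf.2 fun m => ?_
      change MeasurableSet ((fun f => (⟨m, f⟩ : History S A)) ⁻¹' _)
      by_cases hm : m = n
      · subst hm
        rw [Set.preimage_image_eq _ hinj]
        exact ht
      · convert MeasurableSet.empty
        ext f
        simp only [Set.mem_preimage, Set.mem_image, Set.mem_empty_iff_false, iff_false]
        rintro ⟨g, -, hg⟩
        exact hm (congrArg Sigma.fst hg).symm
    exact this.prodMap MeasurableEmbedding.id
  exact hemb.measurableSet_image.2 (key n hs)

end LayeredMDP

open LayeredMDP

/-! ### Adversaries -/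

/-- Two kinds of environments: an oblivious one fixes all its choices ahead of time; an adaptive
one makes the choices of an episode knowing everything that happened in earlier episodes. -/
inductive Adversary
  | oblivious
  | adaptive

/-- Index of the information on which the choices for episode `t` may depend, where `ℱ n` is the
information available after `n` episodes (and `ℱ 0` what is there before the first one). -/
def Adversary.info : Adversary → ℕ → ℕ
  | .oblivious, _ => 0
  | .adaptive, t => t

variable {L : ℕ} (S : Fin (L + 1) → Type u) (A : Type u)
  [∀ k, Fintype (S k)] [Fintype A]

/-! ### Adversarial MDP algorithms and corruption robustness -/

/-- An adversarial MDP algorithm: it draws the next policy from a distribution that depends on its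
record of past policies and bandit feedback. -/
structure MDPAlgorithm where
  /-- distribution of the next policy given the record -/
  policy : Kernel (History S A) (Policy S A)
  isMarkov : IsMarkovKernel policy

variable {S A}

/-- The record after `t` episodes. -/
def record {Ω : Type u} (M : ℕ → Ω → MDP S A) (p : ℕ → Ω → Policy S A) (x : ℕ → Ω → Traj S A)
    (t : ℕ) (ω : Ω) : History S A :=
  ⟨t, fun i => (p i ω, feedback (M i ω) (x i ω))⟩

/-- `alg` interacts with an environment of kind `adv` until the random stopping time `τ ≤ T`.
Episodes are numbered `0, 1, …`; episode `t` takes place on `{t < τ}`.  Given the information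
`ℱ t` from before episode `t`, the policy `p t` is drawn from the distribution that `alg`
prescribes, and the trajectory `x t` is then drawn by executing `p t` in the MDP `M t`. -/
structure IsRun (adv : Adversary) (T : ℕ) (alg : MDPAlgorithm S A)
    {Ω : Type u} [mΩ : MeasurableSpace Ω] (μ : Measure Ω) (ℱ : Filtration ℕ mΩ)
    (M : ℕ → Ω → MDP S A) (p : ℕ → Ω → Policy S A) (x : ℕ → Ω → Traj S A) (τ : Ω → ℕ) :
    Prop where
  stopping : IsStoppingTime ℱ (fun ω => (τ ω : WithTop ℕ))
  stop_le : ∀ ω, τ ω ≤ T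
  env_meas : ∀ t < T, Measurable[ℱ (adv.info t)] (M t)
  policy_meas : ∀ t < T, Measurable[ℱ (t + 1)] (p t)
  traj_meas : ∀ t < T, Measurable[ℱ (t + 1)] (x t)
  law : ∀ t < T, ∀ E : Set Ω, MeasurableSet[ℱ t] E → E ⊆ {ω | t < τ ω} →
    ∀ B : Set (Policy S A), MeasurableSet B → ∀ y : Traj S A,
      μ (E ∩ {ω | p t ω ∈ B ∧ x t ω = y}) =
        ∫⁻ ω in E, ∫⁻ q in B, ENNReal.ofReal (trajProb (M t ω).1 q y)
          ∂(alg.policy (record M p x t ω)) ∂μ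

/-- Corruption robustness over horizon `T` of an algorithm `alg θ` that takes a guess `θ` of the
corruption as input, with constants `β₁, β₂, β₃`: an anytime regret bound, against every fixed
policy and for every ground truth transition `P` relative to which corruption is measured. -/
def CorruptionRobust (adv : Adversary) (T : ℕ) (alg : ℝ → MDPAlgorithm S A) (β₁ β₂ β₃ : ℝ) :
    Prop :=
  (L : ℝ) ^ 2 ≤ β₁ ∧ (L : ℝ) ≤ β₂ ∧ 1 ≤ β₃ ∧
  ∀ θ : ℝ, 0 ≤ θ →
  ∀ (Ω : Type u) [mΩ : MeasurableSpace Ω] (μ : Measure Ω) [IsProbabilityMeasure μ]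
    (ℱ : Filtration ℕ mΩ) (M : ℕ → Ω → MDP S A) (p : ℕ → Ω → Policy S A)
    (x : ℕ → Ω → Traj S A) (τ : Ω → ℕ),
    IsRun adv T (alg θ) μ ℱ M p x τ →
    ∀ (P : Transition S A) (q : Policy S A),
      ∫ ω, ∑ t ∈ Finset.range (τ ω), (expLoss (M t ω) (p t ω) - expLoss (M t ω) q) ∂μ ≤
        ∫ ω, (Real.sqrt (β₁ * τ ω) + if 1 ≤ τ ω then β₂ + β₃ * θ else 0) ∂μ +
          μ.real {ω | θ < ∑ t ∈ Finset.range (τ ω), corruption P (M t ω)} * (L * T)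

/-! ### Learning with randomly revealed feedback, and stability -/

variable (S A) in
/-- A learner for the protocol in which, in every round, a probability `w` is revealed first, the
learner then decides on a policy, and finally sees the feedback with probability `w` and nothing
otherwise.  The learner has a memory, and all its steps may be randomised. -/
structure ProtocolLearner where
  /-- the set of memory states -/
  Mem : Type u
  /-- measurable structure on the memory -/
  mMem : MeasurableSpace Mem
  /-- initial memory -/
  init : Mem
  /-- distribution of the policy given memory and `w` -/
  act : Kernel (Mem × unitInterval) (Policy S A)
  /-- distribution of the new memory given memory, `w`, executed policy, and feedback -/
  seen : Kernel (Mem × unitInterval × Policy S A × Feedback S A) Mem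
  /-- distribution of the new memory when no feedback is seen -/
  unseen : Kernel (Mem × unitInterval × Policy S A) Mem
  act_markov : IsMarkovKernel act
  seen_markov : IsMarkovKernel seen
  unseen_markov : IsMarkovKernel unseen

attribute [instance] ProtocolLearner.mMem

/-- `alg` interacts for `T` rounds with an environment of kind `adv` under the protocol above.
Given the information `ℱ t` from before round `t`: the policy `p t` is drawn as `alg` prescribes
from its memory `m t` and `w t`, the trajectory `x t` is drawn by executing `p t` in `M t`,
the feedback is revealed (`b t = true`) independently with probability `w t`, and the memory
is updated. -/
structure IsProtocolRun (adv : Adversary) (T : ℕ) (alg : ProtocolLearner S A)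
    {Ω : Type u} [mΩ : MeasurableSpace Ω] (μ : Measure Ω) (ℱ : Filtration ℕ mΩ)
    (M : ℕ → Ω → MDP S A) (w : ℕ → Ω → unitInterval) (m : ℕ → Ω → alg.Mem)
    (p : ℕ → Ω → Policy S A) (x : ℕ → Ω → Traj S A) (b : ℕ → Ω → Bool) : Prop where
  mem_init : ∀ ω, m 0 ω = alg.init
  env_meas : ∀ t < T, Measurable[ℱ (adv.info t)] (M t)
  prob_meas : ∀ t < T, Measurable[ℱ (adv.info t)] (w t)
  policy_meas : ∀ t < T, Measurable[ℱ (t + 1)] (p t)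
  traj_meas : ∀ t < T, Measurable[ℱ (t + 1)] (x t)
  reveal_meas : ∀ t < T, Measurable[ℱ (t + 1)] (b t)
  mem_meas : ∀ t ≤ T, Measurable[ℱ t] (m t)
  law : ∀ t < T, ∀ E : Set Ω, MeasurableSet[ℱ t] E →
    ∀ B : Set (Policy S A), MeasurableSet B → ∀ D : Set alg.Mem, MeasurableSet D →
    ∀ y : Traj S A,
      μ (E ∩ {ω | p t ω ∈ B ∧ x t ω = y ∧ b t ω = true ∧ m (t + 1) ω ∈ D}) =
        ∫⁻ ω in E, ∫⁻ q in B, ENNReal.ofReal (trajProb (M t ω).1 q y) *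
          ENNReal.ofReal (w t ω : ℝ) * alg.seen (m t ω, w t ω, q, feedback (M t ω) y) D
          ∂(alg.act (m t ω, w t ω)) ∂μ ∧
      μ (E ∩ {ω | p t ω ∈ B ∧ x t ω = y ∧ b t ω = false ∧ m (t + 1) ω ∈ D}) =
        ∫⁻ ω in E, ∫⁻ q in B, ENNReal.ofReal (trajProb (M t ω).1 q y) *
          ENNReal.ofReal (1 - (w t ω : ℝ)) * alg.unseen (m t ω, w t ω, q) D
          ∂(alg.act (m t ω, w t ω)) ∂μ

/-- `ρ_T = 1 / min_t w_t`, infinite if some `w_t` vanishes. -/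
def rho {Ω : Type u} (T : ℕ) (w : ℕ → Ω → unitInterval) (ω : Ω) : ℝ≥0∞ :=
  (⨅ t : Fin T, ENNReal.ofReal (w t ω : ℝ))⁻¹

/-- `½`-stability with corruption robustness over horizon `T`: `alg C` is the learner that is told
the amount of corruption `C`.  The regret bound is an inequality in `[0, ∞]` because `ρ_T` may be
infinite. -/
def HalfStable (adv : Adversary) (T : ℕ) (alg : ℝ → ProtocolLearner S A) (β₁ β₂ β₃ : ℝ) :
    Prop :=
  (L : ℝ) ^ 2 ≤ β₁ ∧ (L : ℝ) ≤ β₂ ∧ 1 ≤ β₃ ∧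
  ∀ C : ℝ, 0 ≤ C →
  ∀ (Ω : Type u) [mΩ : MeasurableSpace Ω] (μ : Measure Ω) [IsProbabilityMeasure μ]
    (ℱ : Filtration ℕ mΩ) (M : ℕ → Ω → MDP S A) (w : ℕ → Ω → unitInterval)
    (m : ℕ → Ω → (alg C).Mem) (p : ℕ → Ω → Policy S A) (x : ℕ → Ω → Traj S A)
    (b : ℕ → Ω → Bool),
    IsProtocolRun adv T (alg C) μ ℱ M w m p x b →
    ∀ P : Transition S A, (∀ᵐ ω ∂μ, ∑ t ∈ Finset.range T, corruption P (M t ω) ≤ C) →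
    ∀ q : Policy S A,
      ENNReal.ofReal
          (∫ ω, ∑ t ∈ Finset.range T, (expLoss (M t ω) (p t ω) - expLoss (M t ω) q) ∂μ) ≤
        ∫⁻ ω, ((ENNReal.ofReal β₁ * rho T w ω * (T : ℝ≥0∞)) ^ (1 / 2 : ℝ) +
          ENNReal.ofReal β₂ * rho T w ω) ∂μ + ENNReal.ofReal (β₃ * C)

/-! ### The STABILISE procedure -/

namespace Stabilise

/-- The bin of `w`: the integer `j` with `w ∈ (2^{-j-1}, 2^{-j}]`. -/
def bin (w : unitInterval) : ℕ := ⌊-Real.logb 2 (w : ℝ)⌋₊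

theorem bin_spec (w : unitInterval) (hw : 0 < (w : ℝ)) :
    ((2 : ℝ) ^ (bin w + 1))⁻¹ < w ∧ (w : ℝ) ≤ ((2 : ℝ) ^ bin w)⁻¹ := by
  have h0 : 0 ≤ -Real.logb 2 (w : ℝ) :=
    neg_nonneg.2 (Real.logb_nonpos (by norm_num) hw.le w.2.2)
  have h1 : (bin w : ℝ) ≤ -Real.logb 2 (w : ℝ) := Nat.floor_le h0
  have h2 : -Real.logb 2 (w : ℝ) < (bin w : ℝ) + 1 := Nat.lt_floor_add_one _
  have e : ∀ n : ℕ, ((2 : ℝ) ^ n)⁻¹ = (2 : ℝ) ^ (-(n : ℝ)) := fun n => by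
    rw [Real.rpow_neg (by norm_num), Real.rpow_natCast]
  rw [e, e]
  constructor
  · refine (Real.lt_logb_iff_rpow_lt (by norm_num) hw).1 ?_
    push_cast
    linarith
  · refine (Real.logb_le_iff_le_rpow (by norm_num) hw).1 ?_
    linarith

theorem measurable_bin : Measurable bin :=
  Nat.measurable_floor.comp
    (((Real.measurable_log.comp measurable_subtype_coe).div_const _).neg)

/-- Index set of the instances, `j = 0, …, ⌈log₂ T⌉`. -/
abbrev Slot (T : ℕ) : Type := Fin (Nat.clog 2 T + 1)

/-- The instance responsible for `w`.  (For `w > 1 / T` the minimum is `bin w`.) -/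
def slot (T : ℕ) (w : unitInterval) : Slot T := ⟨min (bin w) (Nat.clog 2 T), by omega⟩

/-- The input `θ_j` of the `j`-th instance. -/
def theta (T : ℕ) (C : ℝ) (j : ℕ) : ℝ := 2 * C / 2 ^ j + 16 * L * Real.log T

variable (S A) in
/-- Memory: the records of all the instances. -/
abbrev Memory (T : ℕ) : Type u := Slot T → History S A

/-- Rounds with `w ≤ 1 / T` are ignored. -/
def ignored (T : ℕ) : Set unitInterval := {w | (w : ℝ) ≤ 1 / T}

theorem measurableSet_ignored (T : ℕ) : MeasurableSet (ignored T) :=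
  measurableSet_le measurable_subtype_coe measurable_const

theorem measurable_slot (T : ℕ) : Measurable (slot T) :=
  (measurable_from_top (f := fun n : ℕ => (⟨min n (Nat.clog 2 T), by omega⟩ : Slot T))).comp
    measurable_bin

/-- The policy is suggested by the instance responsible for `w`. -/
def suggest (T : ℕ) (base : ℝ → MDPAlgorithm S A) (C : ℝ) :
    Kernel (Memory S A T × unitInterval) (Policy S A) where
  toFun z := (base (theta (L := L) T C (slot T z.2))).policy (z.1 (slot T z.2))
  measurable' := by
    have h : Measurable (fun y : Slot T × Memory S A T =>
        (base (theta (L := L) T C y.1)).policy (y.2 y.1)) :=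
      measurable_from_prod_countable_right fun j =>
        (base (theta (L := L) T C j)).policy.measurable.comp (measurable_pi_apply j)
    exact h.comp (((measurable_slot T).comp measurable_snd).prodMk measurable_fst)

instance (T : ℕ) (base : ℝ → MDPAlgorithm S A) (C : ℝ) : IsMarkovKernel (suggest T base C) :=
  ⟨fun z => by
    have := (base (theta (L := L) T C (slot T z.2))).isMarkov
    exact this.isProbabilityMeasure _⟩

/-- The probability `2^{-j-1} / w` with which received feedback is passed on. -/
def passProb (w : unitInterval) : ℝ := ((2 : ℝ) ^ (bin w + 1))⁻¹ / w

theorem measurable_passProb : Measurable passProb :=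
  ((measurable_from_top (f := fun n : ℕ => ((2 : ℝ) ^ (n + 1))⁻¹)).comp measurable_bin).div
    measurable_subtype_coe

/-- Memory after passing the (policy, feedback) pair on to the instance responsible for `w`. -/
def pass (T : ℕ) (z : Memory S A T × unitInterval × Policy S A × Feedback S A) :
    Memory S A T :=
  Function.update z.1 (slot T z.2.1) ((z.1 (slot T z.2.1)).append z.2.2)

theorem measurable_pass (T : ℕ) : Measurable (pass (S := S) (A := A) T) := by
  have h : Measurable (fun y : Slot T × (Memory S A T × Policy S A × Feedback S A) =>
      Function.update y.2.1 y.1 ((y.2.1 y.1).append y.2.2)) := by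
    refine measurable_from_prod_countable_right fun j => measurable_pi_iff.2 fun i => ?_
    by_cases hij : i = j
    · subst hij
      simp only [Function.update_self]
      have h1 : Measurable (fun y : Memory S A T × Policy S A × Feedback S A => (y.1 i, y.2)) :=
        ((measurable_pi_apply i).comp measurable_fst).prodMk measurable_snd
      exact History.measurable_append.comp h1
    · simp only [Function.update_of_ne hij]
      exact (measurable_pi_apply i).comp measurable_fst
  exact h.comp (((measurable_slot T).comp (measurable_fst.comp measurable_snd)).prodMk
    (measurable_fst.prodMk (measurable_snd.comp measurable_snd)))

/-- Memory update when feedback is received in a round with `w > 1 / T`: with probability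
`passProb w` it is passed on, otherwise it is discarded. -/
def subsample (T : ℕ) :
    Kernel (Memory S A T × unitInterval × Policy S A × Feedback S A) (Memory S A T) where
  toFun z := ENNReal.ofReal (passProb z.2.1) • Measure.dirac (pass T z) +
    ENNReal.ofReal (1 - passProb z.2.1) • Measure.dirac z.1
  measurable' := by
    have hq : Measurable (fun z : Memory S A T × unitInterval × Policy S A × Feedback S A =>
        passProb z.2.1) := measurable_passProb.comp (measurable_fst.comp measurable_snd)
    refine Measure.measurable_of_measurable_coe _ fun s hs => ?_
    simp only [Measure.coe_add, Measure.coe_smul, Pi.add_apply, Pi.smul_apply, smul_eq_mul]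
    refine Measurable.add ?_ ?_
    · exact hq.ennreal_ofReal.mul
        ((Measure.measurable_coe hs).comp (Measure.measurable_dirac.comp (measurable_pass T)))
    · exact (hq.const_sub 1).ennreal_ofReal.mul
        ((Measure.measurable_coe hs).comp (Measure.measurable_dirac.comp measurable_fst))

open scoped Classical in
/-- STABILISE over horizon `T`, run with the base algorithm `base` and the corruption amount `C`.
In ignored rounds it plays an arbitrary policy, drawn from `fallback`. -/
def learner (T : ℕ) (base : ℝ → MDPAlgorithm S A)
    (fallback : Kernel (Memory S A T × unitInterval) (Policy S A)) [IsMarkovKernel fallback]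
    (C : ℝ) : ProtocolLearner S A where
  Mem := Memory S A T
  mMem := inferInstance
  init := fun _ => ⟨0, Fin.elim0⟩
  act := Kernel.piecewise (measurable_snd (measurableSet_ignored T)) fallback (suggest T base C)
  seen := Kernel.piecewise ((measurable_fst.comp measurable_snd) (measurableSet_ignored T))
    (Kernel.deterministic Prod.fst measurable_fst) (subsample T)
  unseen := Kernel.deterministic Prod.fst measurable_fst
  act_markov := inferInstance
  seen_markov := by
    refine ⟨fun z => ?_⟩
    rw [Kernel.piecewise_apply]
    split_ifs with hz
    · infer_instance
    · refine ⟨?_⟩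
      have hw : 0 < (z.2.1 : ℝ) := by
        have : ¬ (z.2.1 : ℝ) ≤ 1 / T := hz
        have h' : (0 : ℝ) ≤ 1 / T := by positivity
        linarith
      have hp1 : passProb z.2.1 ≤ 1 := (div_le_one hw).2 (bin_spec _ hw).1.le
      have hp0 : 0 ≤ passProb z.2.1 := div_nonneg (by positivity) hw.le
      change (ENNReal.ofReal (passProb z.2.1) • Measure.dirac (pass T z) +
        ENNReal.ofReal (1 - passProb z.2.1) • Measure.dirac z.1) Set.univ = 1
      simp only [Measure.coe_add, Measure.coe_smul, Pi.add_apply, Pi.smul_apply, smul_eq_mul,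
        measure_univ, mul_one]
      rw [← ENNReal.ofReal_add hp0 (by linarith)]
      simp
  unseen_markov := inferInstance

end Stabilise

end

set_option linter.unusedSectionVars false

noncomputable section

open LayeredMDP

variable {L : ℕ} {S : Fin (L + 1) → Type u} {A : Type u}
  [∀ k, Fintype (S k)] [Fintype A]

/-! ### Measurability of equality of records -/

/-! Fix an instance `j` and call a round active if `w > 1 / T` and `w` lies in its bin. Feedback is
revealed with probability `w` and then passed on with probability `2^{-j-1} / w`, so an active round
is passed on with probability exactly `r = 2^{-j-1}`, independently of its policy and trajectory.
The record of the instance changes only in these rounds. Renumbered consecutively, they therefore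
form a genuine run of the base algorithm, stopped after their random number `N`
(`IsThinnedRun.isRun`), and the expected regret of this run is `r` times the expected regret over
all active rounds (`IsThinnedRun.integral_sum_sampled_policy`).

The renumbering has to respect the kind of environment. Against an adaptive one, the information
before a passed-on round contains the coins up to and including that round. Against an oblivious
one, the MDP of the `i`-th passed-on round must be known from the start although it depends on the
coins, so all coins before the horizon count as known. This does not disturb the law of a round: the
active sets are fixed in advance, so later coins carry no information about the play
(`IsThinnedRun.measure_inter_round`).

The terms of the base bound are then estimated. One has `E √N ≤ √(r T) Pr[used]`, where "used" means
that some round is active. The corruption over the passed-on rounds is controlled by an exponential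
supermartingale and exceeds `θ_j` with probability at most `T⁻²` if `L > 0`
(`measureReal_corruption_le`, `tail_le`). Division by `r` leaves a coefficient of order `√(β₁ T 2^j)
+ 2^j (β₂ + β₃ L log T)` on the event that the instance is used, plus `4 β₃ C + 4 L`.

A used instance has `2^j ≤ ρ_T`, so the coefficients add up geometrically and lose no logarithm
(`sum_usedCoeff_le`); the remainders are summed over `O(log T)` instances. An ignored round forces
`ρ_T ≥ T`, so the trivial regret `L T` of ignored rounds is at most `L ρ_T`. -/

instance MeasurableEq.prod {α β : Type*} [MeasurableSpace α] [MeasurableSpace β]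
    [MeasurableEq α] [MeasurableEq β] : MeasurableEq (α × β) := by
  refine ⟨?_⟩
  have h1 : MeasurableSet {z : (α × β) × (α × β) | z.1.1 = z.2.1} :=
    measurableSet_eq_fun (by fun_prop) (by fun_prop)
  have h2 : MeasurableSet {z : (α × β) × (α × β) | z.1.2 = z.2.2} :=
    measurableSet_eq_fun (by fun_prop) (by fun_prop)
  convert h1.inter h2 using 1
  ext z
  simp [Prod.ext_iff]

instance MeasurableEq.pi {ι : Type*} [Countable ι] {β : ι → Type*} [∀ i, MeasurableSpace (β i)]
    [∀ i, MeasurableEq (β i)] : MeasurableEq (∀ i, β i) := by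
  refine ⟨?_⟩
  have h := MeasurableSet.iInter fun i => measurableSet_eq_fun
    ((measurable_pi_apply i).comp (measurable_fst (α := ∀ i, β i) (β := ∀ i, β i)))
    ((measurable_pi_apply i).comp (measurable_snd (α := ∀ i, β i) (β := ∀ i, β i)))
  convert h using 1
  ext z
  simp [funext_iff]

theorem measurable_sigma {ι α : Type*} {β : ι → Type*} [∀ i, MeasurableSpace (β i)]
    [MeasurableSpace α] {f : (Σ i, β i) → α} (hf : ∀ i, Measurable fun b : β i => f ⟨i, b⟩) :
    Measurable f :=
  fun _ hs => MeasurableSpace.measurableSet_iInf.2 fun i => hf i hs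

theorem measurable_sigma_fst {ι : Type*} {β : ι → Type*} [∀ i, MeasurableSpace (β i)]
    [MeasurableSpace ι] : Measurable (Sigma.fst : (Σ i, β i) → ι) :=
  measurable_sigma fun _ => measurable_const

theorem measurableEmbedding_sigmaMk {ι : Type*} {β : ι → Type*} [∀ i, MeasurableSpace (β i)]
    (i : ι) : MeasurableEmbedding (Sigma.mk i : β i → Σ i, β i) := by
  refine ⟨sigma_mk_injective, measurable_iff_le_map.2 (iInf_le _ _), fun s hs => ?_⟩
  refine MeasurableSpace.measurableSet_iInf.2 fun k => ?_
  change MeasurableSet (Sigma.mk k ⁻¹' (Sigma.mk i '' s))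
  by_cases h : k = i
  · subst h
    rwa [Set.preimage_image_eq _ sigma_mk_injective]
  · rw [Set.preimage_image_sigmaMk_of_ne h]
    exact MeasurableSet.empty

instance MeasurableEq.sigma {ι : Type*} [Countable ι] {β : ι → Type*}
    [∀ i, MeasurableSpace (β i)] [∀ i, MeasurableEq (β i)] : MeasurableEq (Σ i, β i) := by
  refine ⟨?_⟩
  have h := MeasurableSet.iUnion fun i => ((measurableEmbedding_sigmaMk (β := β) i).prodMap
    (measurableEmbedding_sigmaMk (β := β) i)).measurableSet_image.2
      (measurableSet_diagonal (α := β i))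
  convert h using 1
  ext ⟨⟨i, a⟩, ⟨k, b⟩⟩
  simp only [Set.mem_diagonal_iff, Set.mem_iUnion, Set.mem_image, Prod.exists, Prod.map,
    Prod.mk.injEq]
  constructor
  · rintro h
    cases h
    exact ⟨i, a, a, rfl, rfl, rfl⟩
  · rintro ⟨l, a', b', h, h1, h2⟩
    rw [← h1, ← h2, h]

instance : MeasurableEq (Policy S A) :=
  inferInstanceAs (MeasurableEq (∀ k : Fin L, S k.castSucc → stdSimplex ℝ A))

instance : Countable (Traj S A) := Finite.to_countable

/-- Policies form an uncountable space, so equality of records is not automatically a measurable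
event; `badUpdate` below needs it. -/
instance : MeasurableEq (History S A) := inferInstance

/-! ### Layered MDPs -/

theorem trajProb_nonneg (P : Transition S A) (p : Policy S A) (x : Traj S A) :
    0 ≤ trajProb P p x :=
  Finset.prod_nonneg fun k _ => mul_nonneg ((p k _).2.1 _) ((P k _ _).2.1 _)

/-- Summing out the last action and state gives a factor one, so induction peels off the layers from
the end. No starting state is fixed, hence each state of layer `0` contributes mass one. -/
theorem sum_path_prod_eq_card (L : ℕ) (S : Fin (L + 1) → Type u) (A : Type u)
    [∀ k, Fintype (S k)] [Fintype A]
    (f : ∀ k : Fin L, S k.castSucc → A → S k.succ → ℝ)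
    (hf : ∀ k s, ∑ a, ∑ s', f k s a s' = 1) :
    ∑ z : (∀ k, S k) × (Fin L → A),
      ∏ k : Fin L, f k (z.1 k.castSucc) (z.2 k) (z.1 k.succ) = Fintype.card (S 0) := by
  classical
  induction L with
  | zero =>
    simp only [Finset.univ_eq_empty, Finset.prod_empty, Finset.sum_const, nsmul_eq_mul, mul_one,
      Finset.card_univ, Fintype.card_prod]
    have : Fintype.card (∀ k, S k) = Fintype.card (S 0) := by
      rw [Fintype.card_pi]; simp
    simp [this]
  | succ L ih =>
    have ih' := ih (fun k => S k.castSucc) (fun k => f k.castSucc) (fun k s => hf k.castSucc s)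
    let e := (Fin.snocEquiv S).prodCongr (Fin.snocEquiv fun _ : Fin (L + 1) => A)
    rw [← e.sum_comp]
    let e' := Equiv.prodProdProdComm (S (Fin.last (L + 1))) (∀ i : Fin (L + 1), S i.castSucc)
      A (Fin L → A)
    rw [← e'.symm.sum_comp, Fintype.sum_prod_type_right]
    refine Eq.trans (Finset.sum_congr rfl fun z _ => ?_) ih'
    have key : ∀ y : S (Fin.last (L + 1)) × A,
        ∏ k : Fin (L + 1), f k ((e (e'.symm (y, z))).1 k.castSucc) ((e (e'.symm (y, z))).2 k)
          ((e (e'.symm (y, z))).1 k.succ) =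
        (∏ k : Fin L, f k.castSucc (z.1 k.castSucc) (z.2 k) (z.1 k.succ)) *
          f (Fin.last L) (z.1 (Fin.last L)) y.2 y.1 := by
      intro y
      rw [Fin.prod_univ_castSucc]
      congr 1
      · refine Finset.prod_congr rfl fun k _ => ?_
        have h1 : (e (e'.symm (y, z))).1 k.castSucc.castSucc = z.1 k.castSucc :=
          Fin.snoc_castSucc (α := S) _ _ _
        have h2 : (e (e'.symm (y, z))).1 k.castSucc.succ = z.1 k.succ :=
          Fin.snoc_castSucc (α := S) (i := k.succ) ..
        have h3 : (e (e'.symm (y, z))).2 k.castSucc = z.2 k :=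
          Fin.snoc_castSucc (α := fun _ => A) _ _ _
        rw [h1, h2, h3]
      · have h1 : (e (e'.symm (y, z))).1 (Fin.last L).castSucc = z.1 (Fin.last L) :=
          Fin.snoc_castSucc (α := S) _ _ _
        have h2 : (e (e'.symm (y, z))).1 (Fin.last L).succ = y.1 :=
          Fin.snoc_last (α := S) _ _
        have h3 : (e (e'.symm (y, z))).2 (Fin.last L) = y.2 :=
          Fin.snoc_last (α := fun _ => A) _ _
        rw [h1, h2, h3]
    simp_rw [key]
    rw [← Finset.mul_sum, Fintype.sum_prod_type_right]
    exact (congrArg _ (hf (Fin.last L) _)).trans (mul_one _)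

theorem sum_trajProb [Nonempty (S 0)] [Subsingleton (S 0)] (P : Transition S A)
    (p : Policy S A) : ∑ x : Traj S A, trajProb P p x = 1 := by
  have h := sum_path_prod_eq_card L S A (fun k s a s' => p k s a * P k s a s') fun k s => by
    have h1 : ∀ a, ∑ s', P k s a s' = 1 := fun a => (P k s a).2.2
    simp_rw [← Finset.mul_sum, h1, mul_one]
    exact (p k s).2.2
  have h1 : Fintype.card (S 0) = 1 :=
    le_antisymm (Fintype.card_le_one_iff_subsingleton.2 inferInstance) Fintype.card_pos
  rw [h1, Nat.cast_one] at h
  exact h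

theorem expLoss_nonneg (M : MDP S A) (p : Policy S A) : 0 ≤ expLoss M p :=
  Finset.sum_nonneg fun _ _ => mul_nonneg (trajProb_nonneg _ _ _)
    (Finset.sum_nonneg fun k _ => (M.2 k _ _).2.1)

theorem expLoss_le [Nonempty (S 0)] [Subsingleton (S 0)] (M : MDP S A) (p : Policy S A) :
    expLoss M p ≤ L := by
  calc expLoss M p ≤ ∑ x : Traj S A, trajProb M.1 p x * L := by
        refine Finset.sum_le_sum fun x _ => mul_le_mul_of_nonneg_left ?_ (trajProb_nonneg _ _ _)
        calc ∑ k : Fin L, (M.2 k (x.1 k.castSucc) (x.2 k) : ℝ) ≤ ∑ k : Fin L, (1 : ℝ) :=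
              Finset.sum_le_sum fun k _ => (M.2 k _ _).2.2
          _ = L := by simp
    _ = L := by rw [← Finset.sum_mul, sum_trajProb, one_mul]

theorem abs_expLoss_sub_le [Nonempty (S 0)] [Subsingleton (S 0)] (M : MDP S A)
    (p q : Policy S A) : |expLoss M p - expLoss M q| ≤ L := by
  rw [abs_sub_le_iff]
  constructor <;> linarith [expLoss_nonneg M p, expLoss_nonneg M q, expLoss_le M p, expLoss_le M q]

theorem measurable_policy_apply (k : Fin L) (s : S k.castSucc) (a : A) :
    Measurable fun p : Policy S A => (p k s a : ℝ) :=
  (measurable_pi_apply a).comp (measurable_subtype_coe.comp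
    ((measurable_pi_apply s).comp (measurable_pi_apply k)))

theorem measurable_transition_apply (k : Fin L) (s : S k.castSucc) (a : A) (s' : S k.succ) :
    Measurable fun P : Transition S A => (P k s a s' : ℝ) :=
  (measurable_pi_apply s').comp (measurable_subtype_coe.comp ((measurable_pi_apply a).comp
    ((measurable_pi_apply s).comp (measurable_pi_apply k))))

theorem measurable_loss_apply (k : Fin L) (s : S k.castSucc) (a : A) :
    Measurable fun l : Loss S A => l k s a :=
  (measurable_pi_apply a).comp ((measurable_pi_apply s).comp (measurable_pi_apply k))

theorem measurable_trajProb (x : Traj S A) :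
    Measurable fun z : Transition S A × Policy S A => trajProb z.1 z.2 x :=
  Finset.measurable_prod _ fun k _ => ((measurable_policy_apply k _ _).comp measurable_snd).mul
    ((measurable_transition_apply k _ _ _).comp measurable_fst)

theorem measurable_expLoss :
    Measurable fun z : MDP S A × Policy S A => expLoss z.1 z.2 := by
  refine Finset.measurable_sum _ fun x _ => Measurable.mul ?_ ?_
  · exact (measurable_trajProb x).comp ((measurable_fst.comp measurable_fst).prodMk measurable_snd)
  · exact Finset.measurable_sum _ fun k _ => measurable_subtype_coe.comp
      ((measurable_loss_apply k _ _).comp (measurable_snd.comp measurable_fst))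

theorem measurable_feedback (x : Traj S A) :
    Measurable fun M : MDP S A => feedback M x :=
  measurable_const.prodMk (measurable_pi_iff.2 fun k =>
    (measurable_loss_apply k _ _).comp measurable_snd)

theorem corruption_nonneg (P : Transition S A) (M : MDP S A) : 0 ≤ corruption P M :=
  Finset.sum_nonneg fun _ _ => Real.iSup_nonneg fun _ => Finset.sum_nonneg fun _ _ => abs_nonneg _

theorem corruption_le (P : Transition S A) (M : MDP S A) : corruption P M ≤ 2 * L := by
  calc corruption P M ≤ ∑ k : Fin L, (2 : ℝ) := by
        refine Finset.sum_le_sum fun k _ => Real.iSup_le (fun sa => ?_) zero_le_two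
        calc ∑ s', |M.1 k sa.1 sa.2 s' - P k sa.1 sa.2 s'|
            ≤ ∑ s', ((M.1 k sa.1 sa.2 s' : ℝ) + P k sa.1 sa.2 s') :=
              Finset.sum_le_sum fun s' _ => (abs_sub _ _).trans_eq (congrArg₂ _
                (abs_of_nonneg ((M.1 k sa.1 sa.2).2.1 s'))
                (abs_of_nonneg ((P k sa.1 sa.2).2.1 s')))
          _ = 2 := by
              rw [Finset.sum_add_distrib, show ∑ s', M.1 k sa.1 sa.2 s' = 1 from
                (M.1 k sa.1 sa.2).2.2, show ∑ s', P k sa.1 sa.2 s' = 1 from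
                (P k sa.1 sa.2).2.2]
              norm_num
    _ = 2 * L := by simp [mul_comm]

theorem measurable_corruption (P : Transition S A) :
    Measurable fun M : MDP S A => corruption P M :=
  Finset.measurable_sum _ fun k _ => Measurable.iSup fun sa => Finset.measurable_sum _ fun s' _ =>
    (((measurable_transition_apply k sa.1 sa.2 s').comp measurable_fst).sub_const _).abs

/-! ### Thinning: the rounds at which a coin comes up heads -/

namespace Thinning

/-- The sets of this form are closed under complements and countable unions and contain the
generators. Adding one coin thus amounts to choosing one old event for heads and one for tails. -/
theorem measurableSet_sup_singleton {Ω : Type*} {m : MeasurableSpace Ω} {H E : Set Ω}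
    (hE : MeasurableSet[m ⊔ MeasurableSpace.generateFrom {H}] E) :
    ∃ E₁ E₀, MeasurableSet[m] E₁ ∧ MeasurableSet[m] E₀ ∧ E = (E₁ ∩ H) ∪ (E₀ \ H) := by
  rw [MeasurableSpace.measurableSet_sup] at hE
  induction hE with
  | basic u hu =>
    rcases hu with hu | hu
    · exact ⟨u, u, hu, hu, (Set.inter_union_sdiff u H).symm⟩
    · induction hu with
      | basic u hu =>
        rw [Set.mem_singleton_iff.1 hu]
        exact ⟨Set.univ, ∅, MeasurableSet.univ, MeasurableSet.empty, by simp⟩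
      | empty => exact ⟨∅, ∅, MeasurableSet.empty, MeasurableSet.empty, by simp⟩
      | compl u _ ih =>
        obtain ⟨E₁, E₀, h1, h0, rfl⟩ := ih
        exact ⟨E₁ᶜ, E₀ᶜ, h1.compl, h0.compl, by ext ω; by_cases h : ω ∈ H <;> simp [h]⟩
      | iUnion f _ ih =>
        choose E₁ E₀ h1 h0 h using ih
        refine ⟨⋃ n, E₁ n, ⋃ n, E₀ n, MeasurableSet.iUnion h1, MeasurableSet.iUnion h0, ?_⟩
        ext ω
        by_cases hω : ω ∈ H <;> simp [h, hω]
  | empty => exact ⟨∅, ∅, MeasurableSet.empty, MeasurableSet.empty, by simp⟩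
  | compl u _ ih =>
    obtain ⟨E₁, E₀, h1, h0, rfl⟩ := ih
    exact ⟨E₁ᶜ, E₀ᶜ, h1.compl, h0.compl, by ext ω; by_cases h : ω ∈ H <;> simp [h]⟩
  | iUnion f _ ih =>
    choose E₁ E₀ h1 h0 h using ih
    refine ⟨⋃ n, E₁ n, ⋃ n, E₀ n, MeasurableSet.iUnion h1, MeasurableSet.iUnion h0, ?_⟩
    ext ω
    by_cases hω : ω ∈ H <;> simp [h, hω]

variable {Ω : Type u}

/-- The σ-algebra `m` enlarged by the outcomes of the first `n` coins. -/
def coinSpace (m : MeasurableSpace Ω) (smp : ℕ → Set Ω) : ℕ → MeasurableSpace Ω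
  | 0 => m
  | n + 1 => coinSpace m smp n ⊔ MeasurableSpace.generateFrom {smp n}

theorem le_coinSpace (m : MeasurableSpace Ω) (smp : ℕ → Set Ω) (n : ℕ) :
    m ≤ coinSpace m smp n := by
  induction n with
  | zero => exact le_rfl
  | succ n ih => exact ih.trans le_sup_left

theorem measurableSet_coinSpace (m : MeasurableSpace Ω) (smp : ℕ → Set Ω) {s n : ℕ}
    (h : s < n) : MeasurableSet[coinSpace m smp n] (smp s) := by
  induction n with
  | zero => omega
  | succ n ih =>
    rcases Nat.lt_succ_iff_lt_or_eq.1 h with h | rfl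
    · exact (le_sup_left : coinSpace m smp n ≤ _) _ (ih h)
    · exact (le_sup_right : MeasurableSpace.generateFrom {smp s} ≤ _) _
        (MeasurableSpace.measurableSet_generateFrom rfl)

theorem coinSpace_le {m m' : MeasurableSpace Ω} {smp : ℕ → Set Ω} {n : ℕ} (hm : m ≤ m')
    (h : ∀ s < n, MeasurableSet[m'] (smp s)) : coinSpace m smp n ≤ m' := by
  induction n with
  | zero => exact hm
  | succ n ih =>
    refine sup_le (ih fun s hs => h s (by omega)) (MeasurableSpace.generateFrom_le ?_)
    rintro _ rfl
    exact h n (by omega)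

open scoped Classical in
/-- The number of heads before time `t` (and before the horizon `T`). -/
def count (T : ℕ) (smp : ℕ → Set Ω) (t : ℕ) (ω : Ω) : ℕ :=
  Nat.count (fun s => s < T ∧ ω ∈ smp s) t

open scoped Classical in
/-- The time of the `i`-th head, and `0` if there is none. -/
def time (T : ℕ) (smp : ℕ → Set Ω) (i : ℕ) (ω : Ω) : ℕ :=
  if i < count T smp T ω then Nat.nth (fun s => s < T ∧ ω ∈ smp s) i else 0

/-- The event that the `i`-th head occurs at time `t`. -/
def hit (T : ℕ) (smp : ℕ → Set Ω) (i t : ℕ) : Set Ω := {ω | ω ∈ smp t ∧ count T smp t ω = i}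

section

variable {T : ℕ} {smp : ℕ → Set Ω}

@[simp] theorem count_zero (ω : Ω) : count T smp 0 ω = 0 := by
  classical exact Nat.count_zero _

open scoped Classical in
theorem count_succ {t : ℕ} (ht : t < T) (ω : Ω) :
    count T smp (t + 1) ω = count T smp t ω + if ω ∈ smp t then 1 else 0 := by
  simp [count, Nat.count_succ, ht]

theorem count_mono (ω : Ω) {s t : ℕ} (h : s ≤ t) : count T smp s ω ≤ count T smp t ω := by
  classical exact Nat.count_monotone _ h

theorem count_le (t : ℕ) (ω : Ω) : count T smp t ω ≤ t := by
  classical exact Nat.count_le _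

theorem lt_count_of_mem_hit {i t : ℕ} {ω : Ω} (ht : t < T) (h : ω ∈ hit T smp i t) :
    i < count T smp (t + 1) ω := by
  classical
  rw [count_succ ht, h.2, if_pos h.1]
  omega

theorem time_eq_of_mem_hit {i t : ℕ} {ω : Ω} (ht : t < T) (h : ω ∈ hit T smp i t) :
    time T smp i ω = t := by
  classical
  rw [time, if_pos ((lt_count_of_mem_hit ht h).trans_le (count_mono ω ht)), ← h.2]
  exact Nat.nth_count (p := fun s => s < T ∧ ω ∈ smp s) ⟨ht, h.1⟩

theorem exists_mem_hit {i t : ℕ} {ω : Ω} (ht : t ≤ T) (h : i < count T smp t ω) :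
    ∃ s < t, ω ∈ hit T smp i s := by
  induction t with
  | zero => simp at h
  | succ t ih =>
    classical
    rw [count_succ ht] at h
    by_cases h' : i < count T smp t ω
    · obtain ⟨s, hs, hit⟩ := ih (by omega) h'
      exact ⟨s, by omega, hit⟩
    · by_cases hω : ω ∈ smp t
      · rw [if_pos hω] at h
        exact ⟨t, by omega, hω, by omega⟩
      · rw [if_neg hω] at h
        omega

theorem time_lt {i t : ℕ} {ω : Ω} (ht : t ≤ T) (h : i < count T smp t ω) :
    time T smp i ω < t := by
  obtain ⟨s, hs, hit⟩ := exists_mem_hit ht h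
  rwa [time_eq_of_mem_hit (by omega) hit]

/-- Converts sums over the renumbered rounds into sums over original time, where expectations can be
taken round by round. -/
theorem sum_count (G : ℕ → Ω → ℝ) {t : ℕ} (ht : t ≤ T) (ω : Ω) :
    ∑ i ∈ Finset.range (count T smp t ω), G (time T smp i ω) ω =
      ∑ s ∈ Finset.range t, (smp s).indicator (G s) ω := by
  classical
  induction t with
  | zero => simp
  | succ t ih =>
    rw [Finset.sum_range_succ, ← ih (by omega), count_succ ht]
    by_cases hω : ω ∈ smp t
    · rw [if_pos hω, Set.indicator_of_mem hω, Finset.sum_range_succ,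
        time_eq_of_mem_hit (smp := smp) (i := count T smp t ω) (t := t) ht ⟨hω, rfl⟩]
    · rw [if_neg hω, Set.indicator_of_notMem hω, add_zero, add_zero]

theorem measurable_count (m : MeasurableSpace Ω) {t : ℕ} (ht : t ≤ T)
    (h : ∀ s < t, MeasurableSet[m] (smp s)) : Measurable[m] (count T smp t) := by
  induction t with
  | zero =>
    have : count T smp 0 = fun _ => 0 := funext fun ω => count_zero ω
    rw [this]
    exact measurable_const
  | succ t ih =>
    classical
    have : count T smp (t + 1) = fun ω => count T smp t ω + if ω ∈ smp t then 1 else 0 :=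
      funext fun ω => count_succ ht ω
    rw [this]
    exact (ih (by omega) fun s hs => h s (by omega)).add
      (Measurable.ite (h t (by omega)) measurable_const measurable_const)

theorem measurableSet_hit (m : MeasurableSpace Ω) {i t : ℕ} (ht : t < T)
    (h : ∀ s ≤ t, MeasurableSet[m] (smp s)) : MeasurableSet[m] (hit T smp i t) :=
  (h t le_rfl).inter ((measurable_count m ht.le fun s hs => h s hs.le) (measurableSet_singleton i))

/-- Each head but the first is preceded by another one; this makes the σ-algebras `sampledSpace`
increase with the index. -/
theorem hit_succ_subset {i t : ℕ} (ht : t < T) :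
    hit T smp (i + 1) t ⊆ ⋃ s : Fin t, hit T smp i s := fun ω hω => by
  obtain ⟨s, hs, h⟩ := exists_mem_hit (T := T) (smp := smp) (i := i) (t := t) (ω := ω) ht.le
    (by rw [hω.2]; omega)
  exact Set.mem_iUnion.2 ⟨⟨s, hs⟩, h⟩

theorem measurable_time (m : MeasurableSpace Ω) (h : ∀ s < T, MeasurableSet[m] (smp s)) (i : ℕ) :
    Measurable[m] (time T smp i) := by
  refine measurable_to_countable' fun t => ?_
  have h1 : MeasurableSet[m] {ω | i < count T smp T ω} :=
    (measurable_count m le_rfl h) (measurableSet_Ioi (a := i))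
  have h2 : time T smp i ⁻¹' {t} =
      (⋃ s : Fin T, if (s : ℕ) = t then hit T smp i s else ∅) ∪
        (if t = 0 then {ω | i < count T smp T ω}ᶜ else ∅) := by
    ext ω
    simp only [Set.mem_preimage, Set.mem_singleton_iff, Set.mem_union, Set.mem_iUnion]
    constructor
    · rintro rfl
      by_cases hi : i < count T smp T ω
      · obtain ⟨s, hs, hit⟩ := exists_mem_hit le_rfl hi
        exact Or.inl ⟨⟨s, hs⟩, by simp [time_eq_of_mem_hit hs hit, hit]⟩
      · exact Or.inr (by simp [time, hi])
    · rintro (⟨s, hs⟩ | h0)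
      · split_ifs at hs with hst
        · rw [← hst]; exact time_eq_of_mem_hit s.2 hs
        · exact hs.elim
      · split_ifs at h0 with ht
        · simp only [Set.mem_compl_iff, Set.mem_ofPred_eq] at h0
          simp [time, h0, ht]
        · exact h0.elim
  rw [h2]
  refine MeasurableSet.union (MeasurableSet.iUnion fun s => ?_) ?_
  · split_ifs
    · exact measurableSet_hit m s.2 fun r hr => h r (by omega)
    · exact MeasurableSet.empty
  · split_ifs
    · exact h1.compl
    · exact MeasurableSet.empty

/-- Evaluation of a process at the time of the `i`-th head. -/
def sampled (T : ℕ) (smp : ℕ → Set Ω) {β : Type*} (Y : ℕ → Ω → β) (i : ℕ) (ω : Ω) : β :=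
  Y (time T smp i ω) ω

/-- The default `0` for a missing head is also a round before the horizon, so a sampled process only
takes values of the original process that are known to be measurable. -/
theorem time_lt_horizon (hT : 0 < T) (i : ℕ) (ω : Ω) : time T smp i ω < T := by
  by_cases hi : i < count T smp T ω
  · exact time_lt le_rfl hi
  · simpa [time, hi] using hT

theorem measurable_sampled {β : Type*} [MeasurableSpace β] (m : MeasurableSpace Ω) (hT : 0 < T)
    (h : ∀ s < T, MeasurableSet[m] (smp s)) {Y : ℕ → Ω → β} (hY : ∀ s < T, Measurable[m] (Y s))
    (i : ℕ) : Measurable[m] (sampled T smp Y i) := by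
  intro B hB
  have h2 : sampled T smp Y i ⁻¹' B = ⋃ s : Fin T, (time T smp i ⁻¹' {(s : ℕ)} ∩ Y s ⁻¹' B) := by
    ext ω
    simp only [Set.mem_preimage, Set.mem_iUnion, Set.mem_inter_iff, Set.mem_singleton_iff, sampled]
    constructor
    · intro hω
      exact ⟨⟨_, time_lt_horizon hT i ω⟩, rfl, hω⟩
    · rintro ⟨s, hs, hω⟩
      rwa [hs]
  rw [h2]
  exact MeasurableSet.iUnion fun s =>
    (measurable_time m h i (measurableSet_singleton _)).inter (hY s s.2 hB)

theorem sampled_eq_of_mem_hit {β : Type*} (Y : ℕ → Ω → β) {i t : ℕ} {ω : Ω} (ht : t < T)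
    (h : ω ∈ hit T smp i t) : sampled T smp Y i ω = Y t ω := by
  rw [sampled, time_eq_of_mem_hit ht h]

end

end Thinning

/-! ### Thinned runs, and the law of a round given the coins -/

namespace Thinning

/-- Probability, given the record `h` and the MDP `M`, that the algorithm plays a policy in `B`
and that the trajectory is `y`. -/
def roundLaw (alg : MDPAlgorithm S A) (B : Set (Policy S A)) (y : Traj S A) (h : History S A)
    (M : MDP S A) : ℝ≥0∞ :=
  ∫⁻ q in B, ENNReal.ofReal (trajProb M.1 q y) ∂(alg.policy h)

theorem measurable_roundLaw (alg : MDPAlgorithm S A) {B : Set (Policy S A)}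
    (hB : MeasurableSet B) (y : Traj S A) :
    Measurable fun z : History S A × MDP S A => roundLaw alg B y z.1 z.2 := by
  have := alg.isMarkov
  have hf : Measurable (Function.uncurry fun (z : History S A × MDP S A) (q : Policy S A) =>
      ENNReal.ofReal (trajProb z.2.1 q y)) :=
    ((measurable_trajProb y).comp (((measurable_fst.comp measurable_snd).comp
      measurable_fst).prodMk measurable_snd)).ennreal_ofReal
  exact Measurable.setLIntegral_kernel_prod_right
    (κ := alg.policy.comap Prod.fst measurable_fst) hf hB

/-- An algorithm is run by a process that passes on the rounds `smp` only.  It decides on the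
policies in the rounds `act`, and conditionally on what happens in such a round this is passed on
with probability `r`; `h t` is the record of the algorithm before round `t`. -/
structure IsThinnedRun (adv : Adversary) (T : ℕ) (alg : MDPAlgorithm S A) (r : ℝ≥0∞)
    {Ω : Type u} [mΩ : MeasurableSpace Ω] (μ : Measure Ω) (ℱ : Filtration ℕ mΩ)
    (M : ℕ → Ω → MDP S A) (p : ℕ → Ω → Policy S A) (x : ℕ → Ω → Traj S A)
    (h : ℕ → Ω → History S A) (act smp : ℕ → Set Ω) : Prop where
  env_meas : ∀ t < T, Measurable[ℱ (adv.info t)] (M t)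
  policy_meas : ∀ t < T, Measurable[ℱ (t + 1)] (p t)
  traj_meas : ∀ t < T, Measurable[ℱ (t + 1)] (x t)
  record_meas : ∀ t ≤ T, Measurable[ℱ t] (h t)
  active_meas : ∀ t < T, MeasurableSet[ℱ (adv.info t)] (act t)
  sampled_meas : ∀ t < T, MeasurableSet[ℱ (t + 1)] (smp t)
  record_zero : ∀ ω, h 0 ω = ⟨0, Fin.elim0⟩
  record_sampled : ∀ t < T, ∀ᵐ ω ∂μ, ω ∈ smp t →
    h (t + 1) ω = (h t ω).append (p t ω, feedback (M t ω) (x t ω))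
  record_skipped : ∀ t < T, ∀ᵐ ω ∂μ, ω ∉ smp t → h (t + 1) ω = h t ω
  law_active : ∀ t < T, ∀ E, MeasurableSet[ℱ t] E → ∀ B, MeasurableSet B → ∀ y,
    μ (E ∩ act t ∩ {ω | p t ω ∈ B ∧ x t ω = y}) =
      ∫⁻ ω in E ∩ act t, roundLaw alg B y (h t ω) (M t ω) ∂μ
  law_sampled : ∀ t < T, ∀ E, MeasurableSet[ℱ t] E → ∀ B, MeasurableSet B → ∀ y,
    μ (E ∩ smp t ∩ {ω | p t ω ∈ B ∧ x t ω = y}) =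
      r * μ (E ∩ act t ∩ {ω | p t ω ∈ B ∧ x t ω = y})

theorem _root_.Adversary.info_le (adv : Adversary) (t : ℕ) : adv.info t ≤ t := by
  cases adv <;> simp [Adversary.info]

/-- The number of coins whose outcomes count as known before the decision of round `t`. -/
def knownCoins (adv : Adversary) (T t : ℕ) : ℕ :=
  match adv with
  | .oblivious => T
  | .adaptive => t + 1

namespace IsThinnedRun

variable {adv : Adversary} {T : ℕ} {alg : MDPAlgorithm S A} {r : ℝ≥0∞}
  {Ω : Type u} [mΩ : MeasurableSpace Ω] {μ : Measure Ω} [IsProbabilityMeasure μ]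
  {ℱ : Filtration ℕ mΩ} {M : ℕ → Ω → MDP S A} {p : ℕ → Ω → Policy S A} {x : ℕ → Ω → Traj S A}
  {h : ℕ → Ω → History S A} {act smp : ℕ → Set Ω}

theorem measurable_env (H : IsThinnedRun adv T alg r μ ℱ M p x h act smp) {t : ℕ} (ht : t < T) :
    Measurable[ℱ t] (M t) :=
  (H.env_meas t ht).mono (ℱ.mono (adv.info_le t)) le_rfl

theorem measurableSet_active (H : IsThinnedRun adv T alg r μ ℱ M p x h act smp) {t : ℕ}
    (ht : t < T) : MeasurableSet[ℱ t] (act t) :=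
  ℱ.mono (adv.info_le t) _ (H.active_meas t ht)

theorem measurableSet_sampled (H : IsThinnedRun adv T alg r μ ℱ M p x h act smp) {s t : ℕ}
    (hs : s < t) (ht : t ≤ T) : MeasurableSet[ℱ t] (smp s) :=
  ℱ.mono (Nat.succ_le_of_lt hs) _ (H.sampled_meas s (by omega))

theorem measurableSet_round (H : IsThinnedRun adv T alg r μ ℱ M p x h act smp) {t : ℕ}
    (ht : t < T) {B : Set (Policy S A)} (hB : MeasurableSet B) (y : Traj S A) :
    MeasurableSet[ℱ (t + 1)] {ω | p t ω ∈ B ∧ x t ω = y} :=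
  (H.policy_meas t ht hB).inter (H.traj_meas t ht (measurableSet_singleton y))

theorem measurable_roundLaw (H : IsThinnedRun adv T alg r μ ℱ M p x h act smp) {t : ℕ}
    (ht : t < T) {B : Set (Policy S A)} (hB : MeasurableSet B) (y : Traj S A) :
    Measurable[ℱ t] fun ω => roundLaw alg B y (h t ω) (M t ω) :=
  (Thinning.measurable_roundLaw alg hB y).comp
    (Measurable.prodMk (H.record_meas t ht.le) (H.measurable_env ht))

theorem sum_inter_traj (H : IsThinnedRun adv T alg r μ ℱ M p x h act smp) {t : ℕ} (ht : t < T)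
    {E : Set Ω} (hE : MeasurableSet E) {B : Set (Policy S A)} (hB : MeasurableSet B) :
    ∑ y, μ (E ∩ {ω | p t ω ∈ B ∧ x t ω = y}) = μ (E ∩ {ω | p t ω ∈ B}) := by
  have hd : Pairwise (Function.onFun Disjoint fun y => E ∩ {ω | p t ω ∈ B ∧ x t ω = y}) := by
    intro y z hyz
    refine Set.disjoint_left.2 fun ω h1 h2 => hyz ?_
    rw [← h1.2.2, ← h2.2.2]
  rw [← tsum_fintype (L := .unconditional _), ← measure_iUnion hd fun y =>
    hE.inter (ℱ.le _ _ (H.measurableSet_round ht hB y))]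
  congr 1
  ext ω
  simp

theorem measure_sampled_policy (H : IsThinnedRun adv T alg r μ ℱ M p x h act smp) {t : ℕ}
    (ht : t < T) {E : Set Ω} (hE : MeasurableSet[ℱ t] E) {B : Set (Policy S A)}
    (hB : MeasurableSet B) :
    μ (E ∩ smp t ∩ {ω | p t ω ∈ B}) = r * μ (E ∩ act t ∩ {ω | p t ω ∈ B}) := by
  rw [← H.sum_inter_traj ht ((ℱ.le t _ hE).inter (ℱ.le _ _ (H.sampled_meas t ht))) hB,
    ← H.sum_inter_traj ht ((ℱ.le t _ hE).inter (ℱ.le _ _ (H.measurableSet_active ht))) hB,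
    Finset.mul_sum]
  exact Finset.sum_congr rfl fun y _ => H.law_sampled t ht E hE B hB y

theorem measure_sampled (H : IsThinnedRun adv T alg r μ ℱ M p x h act smp) {t : ℕ}
    (ht : t < T) {E : Set Ω} (hE : MeasurableSet[ℱ t] E) :
    μ (E ∩ smp t) = r * μ (E ∩ act t) := by
  simpa using H.measure_sampled_policy ht hE MeasurableSet.univ

/-- Take the complement of the active event as test event: an inactive round is passed on with
probability zero. -/
theorem ae_active (H : IsThinnedRun adv T alg r μ ℱ M p x h act smp) {t : ℕ} (ht : t < T) :
    ∀ᵐ ω ∂μ, ω ∈ smp t → ω ∈ act t := by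
  have h0 := H.measure_sampled ht (H.measurableSet_active ht).compl
  rw [Set.compl_inter_self, measure_empty, mul_zero] at h0
  filter_upwards [measure_eq_zero_iff_ae_notMem.1 h0] with ω hω hs
  by_contra ha
  exact hω ⟨ha, hs⟩

/-- On events known before round `t`, restricting to the passed-on event is the same as restricting
to the active event and scaling by `r`. Integrals of functions known before the round then follow by
trimming. -/
theorem trim_sampled (H : IsThinnedRun adv T alg r μ ℱ M p x h act smp) {t : ℕ} (ht : t < T) :
    (μ.restrict (smp t)).trim (ℱ.le t) = r • (μ.restrict (act t)).trim (ℱ.le t) := by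
  refine @Measure.ext _ (ℱ t) _ _ fun E hE => ?_
  rw [trim_measurableSet_eq _ hE, Measure.smul_apply, trim_measurableSet_eq _ hE,
    Measure.restrict_apply (ℱ.le t _ hE), Measure.restrict_apply (ℱ.le t _ hE), smul_eq_mul,
    H.measure_sampled ht hE]

theorem setLIntegral_sampled (H : IsThinnedRun adv T alg r μ ℱ M p x h act smp) {t : ℕ}
    (ht : t < T) {f : Ω → ℝ≥0∞} (hf : Measurable[ℱ t] f) {E : Set Ω}
    (hE : MeasurableSet[ℱ t] E) :
    ∫⁻ ω in E ∩ smp t, f ω ∂μ = r * ∫⁻ ω in E ∩ act t, f ω ∂μ := by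
  rw [← Measure.restrict_restrict (ℱ.le t _ hE), ← Measure.restrict_restrict (ℱ.le t _ hE),
    ← lintegral_indicator (ℱ.le t _ hE), ← lintegral_indicator (ℱ.le t _ hE),
    ← lintegral_trim (ℱ.le t) (hf.indicator hE), ← lintegral_trim (ℱ.le t) (hf.indicator hE),
    H.trim_sampled ht, lintegral_smul_measure, smul_eq_mul]

theorem setIntegral_sampled (H : IsThinnedRun adv T alg r μ ℱ M p x h act smp) {t : ℕ}
    (ht : t < T) {f : Ω → ℝ} (hf : Measurable[ℱ t] f) :
    ∫ ω in smp t, f ω ∂μ = r.toReal * ∫ ω in act t, f ω ∂μ := by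
  have e (ν : Measure Ω) : ∫ ω, f ω ∂ν = ∫ ω, f ω ∂(ν.trim (ℱ.le t)) :=
    integral_trim (ℱ.le t) hf.stronglyMeasurable
  rw [e (μ.restrict (smp t)), e (μ.restrict (act t)), H.trim_sampled ht, integral_smul_measure,
    smul_eq_mul]

/-- The law of the policy and the trajectory is the one prescribed, even given coins. -/
theorem measure_inter_round (H : IsThinnedRun adv T alg r μ ℱ M p x h act smp) {t : ℕ}
    (ht : t < T) {B : Set (Policy S A)} (hB : MeasurableSet B) (y : Traj S A) {n : ℕ}
    (hn : t + 1 ≤ n) (hn' : n ≤ knownCoins adv T t) (E : Set Ω)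
    (hE : MeasurableSet[coinSpace (ℱ t) smp n] E) (hEs : E ⊆ smp t) :
    μ (E ∩ {ω | p t ω ∈ B ∧ x t ω = y}) =
      ∫⁻ ω in E, roundLaw alg B y (h t ω) (M t ω) ∂μ := by
  have hK := H.measurable_roundLaw ht hB y
  have hQ := H.measurableSet_round ht hB y
  induction n, hn using Nat.le_induction generalizing E with
  | base =>
    -- The earlier coins already belong to `ℱ t`, so only the coin of round `t` is new, and inside
    -- `smp t` only its heads part `E₁` matters. The factor `r` then appears on both sides.
    obtain ⟨E₁, E₀, h1, h0, rfl⟩ := measurableSet_sup_singleton hE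
    have hE₁ : MeasurableSet[ℱ t] E₁ :=
      coinSpace_le le_rfl (fun s hs => H.measurableSet_sampled hs ht.le) _ h1
    have he : E₁ ∩ smp t ∪ E₀ \ smp t = E₁ ∩ smp t := by
      refine Set.union_eq_left.2 fun ω hω => (hω.2 (hEs (Or.inr hω))).elim
    rw [he, H.law_sampled t ht E₁ hE₁ B hB y, H.law_active t ht E₁ hE₁ B hB y,
      H.setLIntegral_sampled ht hK hE₁]
  | succ n hn ih =>
    -- A coin later than round `t` is only ever counted as known in the oblivious case.
    have hadv : adv = .oblivious := by
      cases adv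
      · rfl
      · simp only [knownCoins] at hn'
        omega
    have hnT : n < T := by
      subst hadv
      exact hn'
    have ih := ih (by omega)
    have hle : coinSpace (ℱ t) smp n ≤ ℱ n :=
      coinSpace_le (ℱ.mono (by omega)) fun s hs => H.measurableSet_sampled hs hnT.le
    -- The decisive use of obliviousness: whether round `n` is active is known at time `0`, so it
    -- can be intersected with a test event about round `t < n`.
    have hact : MeasurableSet[coinSpace (ℱ t) smp n] (act n) := by
      refine le_coinSpace _ _ _ _ (ℱ.mono ?_ _ (H.active_meas n hnT))
      simp [hadv, Adversary.info]
    have hKn : Measurable[ℱ n] fun ω => roundLaw alg B y (h t ω) (M t ω) :=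
      hK.mono (ℱ.mono (by omega)) le_rfl
    have hQn := ℱ.mono hn _ hQ
    -- Heads in round `n` equals `r` times activity in round `n`, both for the measure of the play
    -- in round `t` and for the integral of its prescribed law.
    have heads : ∀ E', MeasurableSet[coinSpace (ℱ t) smp n] E' → E' ⊆ smp t →
        μ (E' ∩ smp n ∩ {ω | p t ω ∈ B ∧ x t ω = y}) =
          ∫⁻ ω in E' ∩ smp n, roundLaw alg B y (h t ω) (M t ω) ∂μ := by
      intro E' hE' hs
      rw [Set.inter_right_comm, H.measure_sampled hnT ((hle _ hE').inter hQn),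
        Set.inter_right_comm, ih _ (hE'.inter hact) (Set.inter_subset_left.trans hs),
        H.setLIntegral_sampled hnT hKn (hle _ hE')]
    -- Tails follow by subtracting heads from the induction hypothesis; the subtraction is
    -- legitimate as the measures are finite.
    have tails : ∀ E', MeasurableSet[coinSpace (ℱ t) smp n] E' → E' ⊆ smp t →
        μ (E' \ smp n ∩ {ω | p t ω ∈ B ∧ x t ω = y}) =
          ∫⁻ ω in E' \ smp n, roundLaw alg B y (h t ω) (M t ω) ∂μ := by
      intro E' hE' hs
      have hms : MeasurableSet (smp n) := ℱ.le _ _ (H.sampled_meas n hnT)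
      have h1 := ih _ hE' hs
      have h2 := heads E' hE' hs
      have h3 := measure_inter_add_sdiff (μ := μ) (E' ∩ {ω | p t ω ∈ B ∧ x t ω = y}) hms
      have h4 := lintegral_inter_add_sdiff (μ := μ)
        (fun ω => roundLaw alg B y (h t ω) (M t ω)) E' hms
      have h5 : (E' ∩ {ω | p t ω ∈ B ∧ x t ω = y}) \ smp n =
          E' \ smp n ∩ {ω | p t ω ∈ B ∧ x t ω = y} := by
        ext ω
        simp only [Set.mem_inter_iff, Set.mem_sdiff]
        tauto
      rw [Set.inter_right_comm, h2, h5, h1, ← h4] at h3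
      refine (ENNReal.add_right_inj ?_).1 h3
      rw [← h2]
      exact measure_ne_top _ _
    obtain ⟨E₁, E₀, h1, h0, rfl⟩ := measurableSet_sup_singleton hE
    have ht' : MeasurableSet[coinSpace (ℱ t) smp n] (smp t) := measurableSet_coinSpace _ _ hn
    have he : E₁ ∩ smp n ∪ E₀ \ smp n = E₁ ∩ smp t ∩ smp n ∪ (E₀ ∩ smp t) \ smp n := by
      ext ω
      have := @hEs ω
      simp only [Set.mem_union, Set.mem_inter_iff, Set.mem_sdiff] at this ⊢
      tauto
    have hms : MeasurableSet (smp n) := ℱ.le _ _ (H.sampled_meas n hnT)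
    have hm0 : MeasurableSet ((E₀ ∩ smp t) \ smp n) :=
      (ℱ.le n _ (hle _ (h0.inter ht'))).diff hms
    have hd : Disjoint (E₁ ∩ smp t ∩ smp n) ((E₀ ∩ smp t) \ smp n) :=
      Set.disjoint_left.2 fun ω h1 h2 => h2.2 h1.2
    rw [he, Set.union_inter_distrib_right, lintegral_union hm0 hd, measure_union
      (hd.mono Set.inter_subset_left Set.inter_subset_left) (hm0.inter (ℱ.le _ _ hQ)),
      heads _ (h1.inter ht') Set.inter_subset_right, tails _ (h0.inter ht') Set.inter_subset_right]

end IsThinnedRun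

end Thinning

/-! ### The rounds passed on form a run of the base algorithm -/

namespace Thinning

theorem record_succ {Ω : Type u} (M : ℕ → Ω → MDP S A) (p : ℕ → Ω → Policy S A)
    (x : ℕ → Ω → Traj S A) (n : ℕ) (ω : Ω) :
    record M p x (n + 1) ω = (record M p x n ω).append (p n ω, feedback (M n ω) (x n ω)) := by
  refine Sigma.ext rfl (heq_of_eq (funext fun i => ?_))
  refine Fin.lastCases ?_ (fun i => ?_) i
  · exact (Fin.snoc_last (α := fun _ => Policy S A × Feedback S A) _ _).symm
  · exact (Fin.snoc_castSucc (α := fun _ => Policy S A × Feedback S A) _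
      (record M p x n ω).2 i).symm

theorem knownCoins_mono (adv : Adversary) (T : ℕ) {s t : ℕ} (h : s ≤ t) :
    knownCoins adv T s ≤ knownCoins adv T t := by
  cases adv
  · exact le_rfl
  · exact Nat.succ_le_succ h

theorem succ_le_knownCoins (adv : Adversary) {T t : ℕ} (h : t < T) :
    t + 1 ≤ knownCoins adv T t := by
  cases adv
  · exact h
  · exact le_rfl

theorem coinSpace_mono {Ω : Type u} {m m' : MeasurableSpace Ω} (smp : ℕ → Set Ω) {n n' : ℕ}
    (hm : m ≤ m') (hn : n ≤ n') : coinSpace m smp n ≤ coinSpace m' smp n' :=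
  coinSpace_le (hm.trans (le_coinSpace _ _ _)) fun _ hs =>
    measurableSet_coinSpace _ _ (hs.trans_le hn)

namespace IsThinnedRun

variable {adv : Adversary} {T : ℕ} {alg : MDPAlgorithm S A} {r : ℝ≥0∞}
  {Ω : Type u} [mΩ : MeasurableSpace Ω] {μ : Measure Ω} [IsProbabilityMeasure μ]
  {ℱ : Filtration ℕ mΩ} {M : ℕ → Ω → MDP S A} {p : ℕ → Ω → Policy S A} {x : ℕ → Ω → Traj S A}
  {h : ℕ → Ω → History S A} {act smp : ℕ → Set Ω}

theorem sampled_meas' (H : IsThinnedRun adv T alg r μ ℱ M p x h act smp) {t : ℕ} (ht : t < T) :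
    MeasurableSet (smp t) :=
  ℱ.le _ _ (H.sampled_meas t ht)

theorem measurableSet_hit_coinSpace {m : MeasurableSpace Ω} {i t : ℕ} (ht : t < T) :
    MeasurableSet[coinSpace m smp (knownCoins adv T t)] (hit T smp i t) :=
  measurableSet_hit _ ht fun _ hs => measurableSet_coinSpace _ _
    ((Nat.lt_succ_of_le hs).trans_le (succ_le_knownCoins adv ht))

/-- The information available before the `i`-th round that is passed on. -/
def sampledSpace (adv : Adversary) (T : ℕ) (ℱ : Filtration ℕ mΩ) (smp : ℕ → Set Ω) (i : ℕ) :
    MeasurableSpace Ω where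
  -- As for a stopped σ-algebra, an event is tested only on the occurrences of the `i`-th head.
  -- Where there is no such head nothing is required beyond measurability, since the run has stopped
  -- there.
  MeasurableSet' E := MeasurableSet E ∧ ∀ t < T,
    MeasurableSet[coinSpace (ℱ t) smp (knownCoins adv T t)] (E ∩ hit T smp i t)
  measurableSet_empty := ⟨MeasurableSet.empty, fun t _ => by simp⟩
  measurableSet_compl E hE := ⟨hE.1.compl, fun t ht => by
    rw [show Eᶜ ∩ hit T smp i t = hit T smp i t \ (E ∩ hit T smp i t) by
      ext ω; simp only [Set.mem_inter_iff, Set.mem_compl_iff, Set.mem_sdiff]; tauto]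
    exact (measurableSet_hit_coinSpace ht).diff (hE.2 t ht)⟩
  measurableSet_iUnion f hf := ⟨MeasurableSet.iUnion fun n => (hf n).1, fun t ht => by
    rw [Set.iUnion_inter]
    exact MeasurableSet.iUnion fun n => (hf n).2 t ht⟩

theorem measurableSet_inter_hit_succ {i t : ℕ} (ht : t < T) {E : Set Ω}
    (hE : ∀ s < t, MeasurableSet[coinSpace (ℱ t) smp (knownCoins adv T t)] (E ∩ hit T smp i s)) :
    MeasurableSet[coinSpace (ℱ t) smp (knownCoins adv T t)] (E ∩ hit T smp (i + 1) t) := by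
  have h1 : E ∩ hit T smp (i + 1) t =
      (⋃ s : Fin t, E ∩ hit T smp i s) ∩ hit T smp (i + 1) t := by
    rw [← Set.inter_iUnion, Set.inter_assoc, Set.inter_eq_self_of_subset_right (hit_succ_subset ht)]
  rw [h1]
  exact (MeasurableSet.iUnion fun s : Fin t => hE s s.2).inter (measurableSet_hit_coinSpace ht)

/-- The filtration of the information available before the rounds that are passed on. -/
def sampledFiltration (adv : Adversary) (T : ℕ) (ℱ : Filtration ℕ mΩ) (smp : ℕ → Set Ω) :
    Filtration ℕ mΩ where
  seq := sampledSpace adv T ℱ smp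
  mono' := monotone_nat_of_le_succ fun _ _ hE => ⟨hE.1, fun _ ht =>
    measurableSet_inter_hit_succ ht fun s hs => coinSpace_mono smp (ℱ.mono hs.le)
      (knownCoins_mono adv T hs.le) _ (hE.2 s (hs.trans ht))⟩
  le' _ _ hE := hE.1

/-- Skipped rounds leave the record alone and the others append to it, so the record at time `t` is
that of the renumbered process after as many rounds as there were heads. At the `i`-th head it has
length `i`. -/
theorem record_eq (H : IsThinnedRun adv T alg r μ ℱ M p x h act smp) :
    ∀ᵐ ω ∂μ, ∀ t ≤ T, h t ω =
      record (sampled T smp M) (sampled T smp p) (sampled T smp x) (count T smp t ω) ω := by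
  have h1 : ∀ᵐ ω ∂μ, ∀ t, t < T → ω ∈ smp t →
      h (t + 1) ω = (h t ω).append (p t ω, feedback (M t ω) (x t ω)) :=
    ae_all_iff.2 fun t => Filter.eventually_imp_distrib_left.2 (H.record_sampled t)
  have h2 : ∀ᵐ ω ∂μ, ∀ t, t < T → ω ∉ smp t → h (t + 1) ω = h t ω :=
    ae_all_iff.2 fun t => Filter.eventually_imp_distrib_left.2 (H.record_skipped t)
  filter_upwards [h1, h2] with ω h1 h2 t
  induction t with
  | zero =>
    intro _
    rw [H.record_zero, count_zero]
    exact Sigma.ext rfl (heq_of_eq (funext fun i => i.elim0))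
  | succ t ih =>
    intro ht
    classical
    rw [count_succ ht]
    by_cases hω : ω ∈ smp t
    · have hh : ω ∈ hit T smp (count T smp t ω) t := ⟨hω, rfl⟩
      rw [if_pos hω, record_succ, h1 t ht hω, ih (by omega), sampled_eq_of_mem_hit p ht hh,
        sampled_eq_of_mem_hit M ht hh, sampled_eq_of_mem_hit x ht hh]
    · rw [if_neg hω, h2 t ht hω, ih (by omega), add_zero]

theorem measurable_sampled_succ (H : IsThinnedRun adv T alg r μ ℱ M p x h act smp)
    {β : Type*} [MeasurableSpace β] {Y : ℕ → Ω → β} (hT : 0 < T)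
    (hY : ∀ t < T, Measurable[ℱ (t + 1)] (Y t)) (i : ℕ) :
    Measurable[sampledFiltration adv T ℱ smp (i + 1)] (sampled T smp Y i) := by
  intro B hB
  refine ⟨measurable_sampled mΩ hT (fun s hs => H.sampled_meas' hs)
    (fun s hs => (hY s hs).mono (ℱ.le _) le_rfl) i hB, fun t ht =>
    measurableSet_inter_hit_succ ht fun s hs => ?_⟩
  have h1 : sampled T smp Y i ⁻¹' B ∩ hit T smp i s = Y s ⁻¹' B ∩ hit T smp i s := by
    ext ω
    refine and_congr_left fun hω => ?_
    rw [Set.mem_preimage, sampled_eq_of_mem_hit Y (hs.trans ht) hω, Set.mem_preimage]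
  rw [h1]
  exact (le_coinSpace _ _ _ _ (ℱ.mono hs _ (hY s (hs.trans ht) hB))).inter
    (coinSpace_mono smp le_rfl (knownCoins_mono adv T hs.le) _
      (measurableSet_hit_coinSpace (hs.trans ht)))

/-- In the oblivious case the selected MDP is a function of the initial information and of all the
coins. In the adaptive case it coincides on the `i`-th head at time `t` with `M t`, which is known
before round `t`. -/
theorem measurable_sampled_env (H : IsThinnedRun adv T alg r μ ℱ M p x h act smp)
    (hT : 0 < T) (i : ℕ) :
    Measurable[sampledFiltration adv T ℱ smp (adv.info i)] (sampled T smp M i) := by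
  intro B hB
  refine ⟨measurable_sampled mΩ hT (fun s hs => H.sampled_meas' hs)
    (fun s hs => (H.env_meas s hs).mono (ℱ.le _) le_rfl) i hB, fun t ht => ?_⟩
  cases adv with
  | oblivious =>
    have h1 : MeasurableSet[coinSpace (ℱ t) smp T] (sampled T smp M i ⁻¹' B) :=
      measurable_sampled _ hT (fun s hs => measurableSet_coinSpace _ _ hs)
        (fun s hs => (H.env_meas s hs).mono
          ((ℱ.mono (Nat.zero_le t)).trans (le_coinSpace _ _ _)) le_rfl) i hB
    exact h1.inter (measurableSet_hit_coinSpace (adv := .oblivious) ht)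
  | adaptive =>
    have h1 : sampled T smp M i ⁻¹' B ∩ hit T smp i t = M t ⁻¹' B ∩ hit T smp i t := by
      ext ω
      refine and_congr_left fun hω => ?_
      rw [Set.mem_preimage, sampled_eq_of_mem_hit M ht hω, Set.mem_preimage]
    change MeasurableSet[coinSpace (ℱ t) smp _] (sampled T smp M i ⁻¹' B ∩ hit T smp i t)
    rw [h1]
    exact (le_coinSpace _ _ _ _ (H.measurable_env ht hB)).inter (measurableSet_hit_coinSpace ht)

/-- The rounds that are passed on form a run of the algorithm, stopped when there are no more. -/
theorem isRun (H : IsThinnedRun adv T alg r μ ℱ M p x h act smp) :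
    IsRun adv T alg μ (sampledFiltration adv T ℱ smp) (sampled T smp M) (sampled T smp p)
      (sampled T smp x) (count T smp T) where
  stopping i := by
    refine ⟨?_, fun t ht => ?_⟩
    · have h1 : MeasurableSet {ω | count T smp T ω ≤ i} :=
        (measurable_count mΩ le_rfl fun s hs => H.sampled_meas' hs) (measurableSet_Iic (a := i))
      convert h1 using 3
      exact Nat.cast_le
    -- If the `i`-th head occurs (counting from `0`), the total number of heads exceeds `i`, so the
    -- test events are empty.
    · convert MeasurableSet.empty
      ext ω
      simp only [Set.mem_inter_iff, Set.mem_empty_iff_false, iff_false, not_and]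
      intro h1 h2
      have h3 := (lt_count_of_mem_hit ht h2).trans_le (count_mono ω ht)
      have h4 : count T smp T ω ≤ i := by simpa using h1
      omega
  stop_le := count_le T
  env_meas i hi := H.measurable_sampled_env (by omega) i
  policy_meas i hi := H.measurable_sampled_succ (by omega) H.policy_meas i
  traj_meas i hi := H.measurable_sampled_succ (by omega) H.traj_meas i
  law i hi E hE hEs B hB y := by
    have hT : 0 < T := by omega
    -- The run has not stopped on `E`, so the `i`-th head exists there; splitting by its time
    -- reduces the claim to the law of a fixed original round.
    have hEu : E = ⋃ t : Fin T, E ∩ hit T smp i t := by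
      rw [← Set.inter_iUnion]
      refine (Set.inter_eq_left.2 fun ω hω => ?_).symm
      obtain ⟨s, hs, h1⟩ := exists_mem_hit le_rfl (hEs hω)
      exact Set.mem_iUnion.2 ⟨⟨s, hs⟩, h1⟩
    have hdis : Pairwise (Function.onFun Disjoint fun t : Fin T => E ∩ hit T smp i t) := by
      intro s t hst
      refine Set.disjoint_left.2 fun ω h1 h2 => hst (Fin.ext ?_)
      rw [← time_eq_of_mem_hit s.2 h1.2, ← time_eq_of_mem_hit t.2 h2.2]
    have hms : ∀ t : Fin T, MeasurableSet (E ∩ hit T smp i t) := fun t =>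
      hE.1.inter (measurableSet_hit mΩ t.2 fun s hs => H.sampled_meas' (by omega))
    have hmr : MeasurableSet {ω | sampled T smp p i ω ∈ B ∧ sampled T smp x i ω = y} :=
      ((sampledFiltration adv T ℱ smp).le _ _
        ((H.measurable_sampled_succ hT H.policy_meas i hB).inter
          (H.measurable_sampled_succ hT H.traj_meas i (measurableSet_singleton y))))
    change _ = ∫⁻ ω in E, roundLaw alg B y _ (sampled T smp M i ω) ∂μ
    conv_lhs => rw [hEu]
    conv_rhs => rw [hEu]
    rw [Set.iUnion_inter, measure_iUnion (fun s t hst => (hdis hst).mono Set.inter_subset_left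
      Set.inter_subset_left) fun t => (hms t).inter hmr, lintegral_iUnion hms hdis]
    refine tsum_congr fun t => ?_
    have h1 : E ∩ hit T smp i t ∩ {ω | sampled T smp p i ω ∈ B ∧ sampled T smp x i ω = y} =
        E ∩ hit T smp i t ∩ {ω | p t ω ∈ B ∧ x t ω = y} := by
      ext ω
      refine and_congr_right fun hω => ?_
      rw [Set.mem_ofPred_eq, Set.mem_ofPred_eq, sampled_eq_of_mem_hit p t.2 hω.2,
        sampled_eq_of_mem_hit x t.2 hω.2]
    rw [h1, H.measure_inter_round t.2 hB y (succ_le_knownCoins adv t.2) le_rfl _ (hE.2 t t.2)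
      fun ω hω => hω.2.1]
    refine setLIntegral_congr_fun_ae (hms t) ?_
    filter_upwards [H.record_eq] with ω hr hω
    rw [hr t t.2.le, hω.2.2, sampled_eq_of_mem_hit M t.2 hω.2]

end IsThinnedRun

end Thinning

/-! ### Expectations over the passed-on rounds and over the active rounds -/

namespace Thinning

namespace IsThinnedRun

variable {adv : Adversary} {T : ℕ} {alg : MDPAlgorithm S A} {r : ℝ≥0∞}
  {Ω : Type u} [mΩ : MeasurableSpace Ω] {μ : Measure Ω} [IsProbabilityMeasure μ]
  {ℱ : Filtration ℕ mΩ} {M : ℕ → Ω → MDP S A} {p : ℕ → Ω → Policy S A} {x : ℕ → Ω → Traj S A}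
  {h : ℕ → Ω → History S A} {act smp : ℕ → Set Ω}

theorem active_meas' (H : IsThinnedRun adv T alg r μ ℱ M p x h act smp) {t : ℕ} (ht : t < T) :
    MeasurableSet (act t) :=
  ℱ.le _ _ (H.active_meas t ht)

theorem measurable_prodMk (H : IsThinnedRun adv T alg r μ ℱ M p x h act smp) {t : ℕ}
    (ht : t < T) : Measurable fun ω => (M t ω, p t ω) :=
  ((H.measurable_env ht).mono (ℱ.le _) le_rfl).prodMk
    ((H.policy_meas t ht).mono (ℱ.le _) le_rfl)

/-- The policy is not known before the round, so trimming does not apply. Instead the joint laws are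
compared on products: the condition on the MDP joins the test event and the condition on the policy
is covered by `measure_sampled_policy`. -/
theorem map_sampled (H : IsThinnedRun adv T alg r μ ℱ M p x h act smp) {t : ℕ} (ht : t < T) :
    (μ.restrict (smp t)).map (fun ω => (M t ω, p t ω)) =
      r • (μ.restrict (act t)).map (fun ω => (M t ω, p t ω)) := by
  have hm := H.measurable_prodMk ht
  have := Measure.isFiniteMeasure_map (μ.restrict (smp t)) (fun ω => (M t ω, p t ω))
  refine Measure.ext_prod fun {D B} hD hB => ?_
  have hM := H.measurable_env ht hD
  have hp := (ℱ.le _) _ (H.policy_meas t ht hB)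
  rw [Measure.smul_apply, Measure.map_apply hm (hD.prod hB), Measure.map_apply hm (hD.prod hB),
    Measure.restrict_apply (hm (hD.prod hB)), Measure.restrict_apply (hm (hD.prod hB)), smul_eq_mul]
  have h1 := H.measure_sampled_policy ht hM hB
  convert h1 using 2
  · ext ω; simp only [Set.mem_inter_iff, Set.mem_preimage, Set.mem_prod, Set.mem_ofPred_eq]; tauto
  · congr 1
    ext ω; simp only [Set.mem_inter_iff, Set.mem_preimage, Set.mem_prod, Set.mem_ofPred_eq]; tauto

theorem setIntegral_sampled_policy (H : IsThinnedRun adv T alg r μ ℱ M p x h act smp) {t : ℕ}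
    (ht : t < T) {g : MDP S A × Policy S A → ℝ} (hg : Measurable g) :
    ∫ ω in smp t, g (M t ω, p t ω) ∂μ = r.toReal * ∫ ω in act t, g (M t ω, p t ω) ∂μ := by
  have hm := H.measurable_prodMk ht
  rw [← integral_map hm.aemeasurable hg.aestronglyMeasurable,
    ← integral_map hm.aemeasurable hg.aestronglyMeasurable, H.map_sampled ht,
    integral_smul_measure, smul_eq_mul]

theorem integral_sum_sampled_policy (H : IsThinnedRun adv T alg r μ ℱ M p x h act smp)
    {g : MDP S A × Policy S A → ℝ} (hg : Measurable g) {c : ℝ} (hc : ∀ z, |g z| ≤ c) :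
    ∫ ω, ∑ t ∈ Finset.range T, (smp t).indicator (fun ω => g (M t ω, p t ω)) ω ∂μ =
      r.toReal *
        ∫ ω, ∑ t ∈ Finset.range T, (act t).indicator (fun ω => g (M t ω, p t ω)) ω ∂μ := by
  have hi : ∀ t ∈ Finset.range T, Integrable (fun ω => g (M t ω, p t ω)) μ := fun t ht =>
    Integrable.of_bound (hg.comp (H.measurable_prodMk (Finset.mem_range.1 ht))).aestronglyMeasurable
      c (ae_of_all _ fun ω => hc _)
  rw [integral_finsetSum _ fun t ht => (hi t ht).indicator
      (H.sampled_meas' (Finset.mem_range.1 ht)), integral_finsetSum _ fun t ht =>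
      (hi t ht).indicator (H.active_meas' (Finset.mem_range.1 ht)), Finset.mul_sum]
  refine Finset.sum_congr rfl fun t ht => ?_
  have ht := Finset.mem_range.1 ht
  rw [integral_indicator (H.sampled_meas' ht), integral_indicator (H.active_meas' ht),
    H.setIntegral_sampled_policy ht hg]

/-- The event that the algorithm is responsible for at least one round. -/
def used (T : ℕ) (act : ℕ → Set Ω) : Set Ω := ⋃ t : Fin T, act t

theorem measurableSet_used (H : IsThinnedRun adv T alg r μ ℱ M p x h act smp) :
    MeasurableSet (used T act) :=
  MeasurableSet.iUnion fun t => H.active_meas' t.2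

theorem count_eq_zero (H : IsThinnedRun adv T alg r μ ℱ M p x h act smp) :
    ∀ᵐ ω ∂μ, ω ∉ used T act → count T smp T ω = 0 := by
  have h1 : ∀ᵐ ω ∂μ, ∀ t, t < T → ω ∈ smp t → ω ∈ act t :=
    ae_all_iff.2 fun t => Filter.eventually_imp_distrib_left.2 fun ht => H.ae_active ht
  filter_upwards [h1] with ω h1 hω
  by_contra h0
  obtain ⟨s, hs, hh⟩ := exists_mem_hit (T := T) (smp := smp) (i := 0) le_rfl
    (Nat.pos_of_ne_zero h0)
  exact hω (Set.mem_iUnion.2 ⟨⟨s, hs⟩, h1 s hs hh.1⟩)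

theorem count_eq_sum (ω : Ω) :
    (count T smp T ω : ℝ) = ∑ t ∈ Finset.range T, (smp t).indicator (fun _ => 1) ω := by
  rw [← sum_count (T := T) (smp := smp) (fun _ _ => 1) le_rfl ω]
  simp

theorem measurable_count' (H : IsThinnedRun adv T alg r μ ℱ M p x h act smp) :
    Measurable (count T smp T) :=
  measurable_count mΩ le_rfl fun _ hs => H.sampled_meas' hs

theorem integrable_count (H : IsThinnedRun adv T alg r μ ℱ M p x h act smp) :
    Integrable (fun ω => (count T smp T ω : ℝ)) μ :=
  Integrable.of_bound (measurable_from_top.comp H.measurable_count').aestronglyMeasurable T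
    (ae_of_all _ fun ω => by simpa using count_le T ω)

/-- Each active round contributes `r` times its probability; every active event lies in `used`, and
there are at most `T` of them. Keeping the probability of `used` allows charging only used instances
later. -/
theorem integral_count_le (H : IsThinnedRun adv T alg r μ ℱ M p x h act smp) :
    ∫ ω, (count T smp T ω : ℝ) ∂μ ≤ r.toReal * T * μ.real (used T act) := by
  simp_rw [count_eq_sum]
  rw [H.integral_sum_sampled_policy (g := fun _ => 1) measurable_const (c := 1) (by simp),
    mul_assoc]
  refine mul_le_mul_of_nonneg_left ?_ ENNReal.toReal_nonneg
  rw [integral_finsetSum _ fun t ht => (integrable_const _).indicator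
    (H.active_meas' (Finset.mem_range.1 ht))]
  calc ∑ t ∈ Finset.range T, ∫ ω, (act t).indicator (fun _ => (1 : ℝ)) ω ∂μ
      ≤ ∑ t ∈ Finset.range T, μ.real (used T act) := by
        refine Finset.sum_le_sum fun t ht => ?_
        have ht := Finset.mem_range.1 ht
        rw [integral_indicator_const _ (H.active_meas' ht), smul_eq_mul, mul_one]
        exact measureReal_mono (Set.subset_iUnion (fun t : Fin T => act t) ⟨t, ht⟩)
    _ = T * μ.real (used T act) := by simp

/-- Pointwise `√N ≤ (N / a + a) / 2` with `a = √(r T)`, and `N = 0` almost surely off `used`. This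
choice of `a` balances the two terms after `integral_count_le`. -/
theorem integral_sqrt_count_le (H : IsThinnedRun adv T alg r μ ℱ M p x h act smp)
    (hT : 0 < T) (hr : 0 < r.toReal) :
    ∫ ω, √(count T smp T ω : ℝ) ∂μ ≤ √(r.toReal * T) * μ.real (used T act) := by
  set a := √(r.toReal * T) with ha
  have hrT : 0 < r.toReal * T := by positivity
  have ha0 : 0 < a := Real.sqrt_pos.2 hrT
  have haa : a * a = r.toReal * T := Real.mul_self_sqrt hrT.le
  have hi2 : Integrable ((used T act).indicator fun _ => a) μ :=
    (integrable_const a).indicator H.measurableSet_used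
  have hi1 := H.integrable_count.div_const a
  calc ∫ ω, √(count T smp T ω : ℝ) ∂μ
      ≤ ∫ ω, ((count T smp T ω : ℝ) / a + (used T act).indicator (fun _ => a) ω) / 2 ∂μ := by
        refine integral_mono_of_nonneg (ae_of_all _ fun ω => Real.sqrt_nonneg _)
          ((hi1.add hi2).div_const 2) ?_
        filter_upwards [H.count_eq_zero] with ω hω
        by_cases hu : ω ∈ used T act
        · rw [Set.indicator_of_mem hu]
          set s := √(count T smp T ω : ℝ)
          have hs : (count T smp T ω : ℝ) = s * s := (Real.mul_self_sqrt (Nat.cast_nonneg _)).symm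
          rw [hs, le_div_iff₀ two_pos, div_add' _ _ _ ha0.ne', le_div_iff₀ ha0]
          nlinarith [sq_nonneg (s - a)]
        · rw [hω hu, Set.indicator_of_notMem hu]
          simp
    _ = ((∫ ω, (count T smp T ω : ℝ) ∂μ) / a + a * μ.real (used T act)) / 2 := by
        rw [integral_div, integral_add hi1 hi2, integral_div,
          integral_indicator_const _ H.measurableSet_used, smul_eq_mul, mul_comm a]
    _ ≤ (r.toReal * T * μ.real (used T act) / a + a * μ.real (used T act)) / 2 := by
        gcongr
        exact H.integral_count_le
    _ = a * μ.real (used T act) := by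
        rw [← haa]
        field_simp
        ring

end IsThinnedRun

end Thinning

/-! ### Concentration of the corruption and the regret of one instance -/

namespace Thinning

namespace IsThinnedRun

variable {adv : Adversary} {T : ℕ} {alg : MDPAlgorithm S A} {r : ℝ≥0∞}
  {Ω : Type u} [mΩ : MeasurableSpace Ω] {μ : Measure Ω} [IsProbabilityMeasure μ]
  {ℱ : Filtration ℕ mΩ} {M : ℕ → Ω → MDP S A} {p : ℕ → Ω → Policy S A} {x : ℕ → Ω → Traj S A}
  {h : ℕ → Ω → History S A} {act smp : ℕ → Set Ω}

/-- Exponent of the supermartingale that controls the sum of `f` over the rounds passed on. -/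
def exponent (r : ℝ) (f : ℕ → Ω → ℝ) (act smp : ℕ → Set Ω) (t : ℕ) (ω : Ω) : ℝ :=
  ∑ s ∈ Finset.range t, ((smp s).indicator (f s) ω - 2 * r * (act s).indicator (f s) ω)

theorem measurable_exponent (H : IsThinnedRun adv T alg r μ ℱ M p x h act smp)
    {f : ℕ → Ω → ℝ} (hf : ∀ t < T, Measurable[ℱ t] (f t)) {t : ℕ} (ht : t ≤ T) :
    Measurable[ℱ t] (exponent r.toReal f act smp t) := by
  refine Finset.measurable_sum _ fun s hs => ?_
  have hs := Finset.mem_range.1 hs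
  have hfs : Measurable[ℱ t] (f s) := (hf s (by omega)).mono (ℱ.mono hs.le) le_rfl
  exact (hfs.indicator (H.measurableSet_sampled hs ht)).sub
    ((hfs.indicator (ℱ.mono hs.le _ (H.measurableSet_active (by omega)))).const_mul _)

theorem exponent_le {r : ℝ} (hr : 0 ≤ r) {f : ℕ → Ω → ℝ} (h0 : ∀ t ω, 0 ≤ f t ω)
    (h1 : ∀ t ω, f t ω ≤ 1) (t : ℕ) (ω : Ω) : exponent r f act smp t ω ≤ t := by
  calc exponent r f act smp t ω ≤ ∑ s ∈ Finset.range t, (1 : ℝ) := by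
        refine Finset.sum_le_sum fun s _ => ?_
        have h2 : 0 ≤ 2 * r * (act s).indicator (f s) ω :=
          mul_nonneg (by positivity) (Set.indicator_nonneg (fun ω _ => h0 s ω) ω)
        have h3 : (smp s).indicator (f s) ω ≤ 1 :=
          Set.indicator_le' (g := fun _ => 1) (fun ω _ => h1 s ω) (fun _ _ => zero_le_one) ω
        linarith
    _ = t := by simp

/-- The exponential is a supermartingale. Given the past, round `t` multiplies `exp (f 1_smp)` in
expectation by `1 + r 1_act (e^f - 1)`, which is at most `1 + 2 r f 1_act ≤ exp (2 r f 1_act)`, the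
factor compensated in `exponent`. -/
theorem integral_exp_exponent_le (H : IsThinnedRun adv T alg r μ ℱ M p x h act smp)
    {f : ℕ → Ω → ℝ} (hf : ∀ t < T, Measurable[ℱ t] (f t)) (h0 : ∀ t ω, 0 ≤ f t ω)
    (h1 : ∀ t ω, f t ω ≤ 1) {t : ℕ} (ht : t ≤ T) :
    ∫ ω, Real.exp (exponent r.toReal f act smp t ω) ∂μ ≤ 1 := by
  have hr : 0 ≤ r.toReal := ENNReal.toReal_nonneg
  have hint : ∀ t ≤ T, Integrable (fun ω => Real.exp (exponent r.toReal f act smp t ω)) μ := by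
    intro t ht
    refine Integrable.of_bound (((H.measurable_exponent hf ht).mono (ℱ.le _)
      le_rfl).exp.aestronglyMeasurable) (Real.exp t) (ae_of_all _ fun ω => ?_)
    rw [Real.norm_eq_abs, Real.abs_exp]
    exact Real.exp_le_exp.2 (exponent_le hr h0 h1 t ω)
  induction t with
  | zero => simp [exponent]
  | succ t ih =>
    have ht' : t < T := ht
    refine le_trans ?_ (ih ht'.le)
    let g : Ω → ℝ := fun ω => Real.exp (exponent r.toReal f act smp t ω -
      2 * r.toReal * (act t).indicator (f t) ω)
    have hgm : Measurable[ℱ t] g :=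
      ((H.measurable_exponent hf ht'.le).sub (((hf t ht').indicator
        (H.measurableSet_active ht')).const_mul _)).exp
    have hem : Measurable[ℱ t] fun ω => g ω * (Real.exp (f t ω) - 1) :=
      hgm.mul ((hf t ht').exp.sub_const 1)
    have hg0 : ∀ ω, 0 ≤ g ω := fun ω => (Real.exp_pos _).le
    have hgle : ∀ ω, g ω ≤ Real.exp (exponent r.toReal f act smp t ω) := fun ω =>
      Real.exp_le_exp.2 (sub_le_self _ (mul_nonneg (by positivity)
        (Set.indicator_nonneg (fun ω _ => h0 t ω) ω)))
    -- Source of the factor `2` in `exponent`: `e^y - 1 ≤ 2 y` for `y` in `[0, 1]`.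
    have hex : ∀ ω, Real.exp (f t ω) - 1 ≤ 2 * f t ω := fun ω => by
      have := Real.abs_exp_sub_one_le (x := f t ω) (by rw [abs_of_nonneg (h0 t ω)]; exact h1 t ω)
      rw [abs_of_nonneg (h0 t ω)] at this
      exact (le_abs_self _).trans this
    have hex0 : ∀ ω, 0 ≤ Real.exp (f t ω) - 1 := fun ω => by
      linarith [Real.add_one_le_exp (f t ω), h0 t ω]
    have hgi : Integrable g μ := (hint t ht'.le).mono' ((hgm.mono (ℱ.le _)
      le_rfl).aestronglyMeasurable) (ae_of_all _ fun ω => by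
        rw [Real.norm_eq_abs, abs_of_nonneg (hg0 ω)]; exact hgle ω)
    have hei : Integrable (fun ω => g ω * (Real.exp (f t ω) - 1)) μ :=
      (hgi.const_mul 2).mono' ((hem.mono (ℱ.le _) le_rfl).aestronglyMeasurable)
        (ae_of_all _ fun ω => by
          rw [Real.norm_eq_abs, abs_of_nonneg (mul_nonneg (hg0 ω) (hex0 ω)), mul_comm]
          exact mul_le_mul_of_nonneg_right ((hex ω).trans (by linarith [h1 t ω])) (hg0 ω))
    have hsm := H.sampled_meas' ht'
    have ham := H.active_meas' ht'
    calc ∫ ω, Real.exp (exponent r.toReal f act smp (t + 1) ω) ∂μ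
        = ∫ ω, (g ω + (smp t).indicator (fun ω => g ω * (Real.exp (f t ω) - 1)) ω) ∂μ := by
          refine integral_congr_ae (ae_of_all _ fun ω => ?_)
          simp only [exponent, Finset.sum_range_succ, g]
          by_cases hω : ω ∈ smp t
          · rw [Set.indicator_of_mem hω, Set.indicator_of_mem hω, add_sub, add_comm _ (f t ω),
              add_sub_assoc, Real.exp_add]
            ring
          · rw [Set.indicator_of_notMem hω, Set.indicator_of_notMem hω, add_zero, zero_sub,
              sub_eq_add_neg]
      _ = ∫ ω, g ω ∂μ + r.toReal * ∫ ω in act t, g ω * (Real.exp (f t ω) - 1) ∂μ := by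
          rw [integral_add hgi (hei.indicator hsm), integral_indicator hsm,
            H.setIntegral_sampled ht' hem]
      _ = ∫ ω, (g ω + r.toReal * (act t).indicator
            (fun ω => g ω * (Real.exp (f t ω) - 1)) ω) ∂μ := by
          rw [integral_add hgi ((hei.indicator ham).const_mul _), integral_const_mul,
            integral_indicator ham]
      _ ≤ ∫ ω, Real.exp (exponent r.toReal f act smp t ω) ∂μ := by
          refine integral_mono (hgi.add ((hei.indicator ham).const_mul _)) (hint t ht'.le)
            fun ω => ?_
          by_cases hω : ω ∈ act t
          · simp only [Set.indicator_of_mem hω]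
            have h2 : Real.exp (exponent r.toReal f act smp t ω) =
                g ω * Real.exp (2 * r.toReal * f t ω) := by
              simp only [g, Set.indicator_of_mem hω]
              rw [← Real.exp_add, sub_add_cancel]
            rw [h2]
            calc g ω + r.toReal * (g ω * (Real.exp (f t ω) - 1))
                = g ω * (1 + r.toReal * (Real.exp (f t ω) - 1)) := by ring
              _ ≤ g ω * Real.exp (2 * r.toReal * f t ω) := by
                  refine mul_le_mul_of_nonneg_left ?_ (hg0 ω)
                  have := Real.add_one_le_exp (2 * r.toReal * f t ω)
                  have := mul_le_mul_of_nonneg_left (hex ω) hr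
                  linarith
          · simp only [Set.indicator_of_notMem hω, mul_zero, add_zero]
            exact hgle ω

/-- Tail bound for the corruption in the rounds passed on. -/
theorem measureReal_corruption_le (H : IsThinnedRun adv T alg r μ ℱ M p x h act smp) (hL : 0 < L)
    (P : Transition S A) {C θ : ℝ}
    (hC : ∀ᵐ ω ∂μ, ∑ t ∈ Finset.range T, corruption P (M t ω) ≤ C) :
    μ.real {ω | θ < ∑ t ∈ Finset.range T, (smp t).indicator (fun ω => corruption P (M t ω)) ω} ≤
      Real.exp ((2 * r.toReal * C - θ) / (2 * L)) := by
  have hr : 0 ≤ r.toReal := ENNReal.toReal_nonneg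
  have hL' : (0 : ℝ) < 2 * L := by positivity
  -- One round has corruption at most `2 L`, so this scaling puts `f` in `[0, 1]` as the
  -- supermartingale requires; Markov's inequality at level `ε` then gives the tail.
  let f : ℕ → Ω → ℝ := fun t ω => corruption P (M t ω) / (2 * L)
  have hf : ∀ t < T, Measurable[ℱ t] (f t) := fun t ht =>
    ((measurable_corruption P).comp (H.measurable_env ht)).div_const _
  have h0 : ∀ t ω, 0 ≤ f t ω := fun t ω => div_nonneg (corruption_nonneg _ _) hL'.le
  have h1 : ∀ t ω, f t ω ≤ 1 := fun t ω => (div_le_one hL').2 (corruption_le _ _)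
  have hle := H.integral_exp_exponent_le hf h0 h1 le_rfl
  set ε := Real.exp (-((2 * r.toReal * C - θ) / (2 * L))) with hε
  have hint : Integrable (fun ω => Real.exp (exponent r.toReal f act smp T ω)) μ := by
    refine Integrable.of_bound (((H.measurable_exponent hf le_rfl).mono (ℱ.le _)
      le_rfl).exp.aestronglyMeasurable) (Real.exp T) (ae_of_all _ fun ω => ?_)
    rw [Real.norm_eq_abs, Real.abs_exp]
    exact Real.exp_le_exp.2 (exponent_le hr h0 h1 T ω)
  have hmarkov := mul_meas_ge_le_integral_of_nonneg (μ := μ)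
    (ae_of_all _ fun ω => (Real.exp_pos _).le) hint ε
  have hsub : μ.real {ω | θ < ∑ t ∈ Finset.range T,
      (smp t).indicator (fun ω => corruption P (M t ω)) ω} ≤
      μ.real {ω | ε ≤ Real.exp (exponent r.toReal f act smp T ω)} := by
    refine ENNReal.toReal_mono (measure_ne_top _ _) (measure_mono_ae ?_)
    filter_upwards [hC] with ω hω hθ
    have hθ : θ < ∑ t ∈ Finset.range T,
      (smp t).indicator (fun ω => corruption P (M t ω)) ω := hθ
    change ε ≤ Real.exp (exponent r.toReal f act smp T ω)
    refine Real.exp_le_exp.2 ?_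
    have e1 : exponent r.toReal f act smp T ω = (∑ t ∈ Finset.range T,
        (smp t).indicator (fun ω => corruption P (M t ω)) ω - 2 * r.toReal *
        ∑ t ∈ Finset.range T, (act t).indicator (fun ω => corruption P (M t ω)) ω) / (2 * L) := by
      rw [Finset.mul_sum, ← Finset.sum_sub_distrib, Finset.sum_div]
      refine Finset.sum_congr rfl fun t _ => ?_
      by_cases h2 : ω ∈ smp t <;> by_cases h3 : ω ∈ act t <;>
        simp only [f, h2, h3, Set.indicator_of_mem, Set.indicator_of_notMem, not_false_eq_true] <;>
        ring
    rw [e1, ← neg_div]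
    refine div_le_div_of_nonneg_right ?_ hL'.le
    have h2 : ∑ t ∈ Finset.range T, (act t).indicator (fun ω => corruption P (M t ω)) ω ≤ C :=
      (Finset.sum_le_sum fun t _ => Set.indicator_le_self' (fun _ _ => corruption_nonneg _ _)
        ω).trans hω
    have h3 := mul_le_mul_of_nonneg_left h2 (mul_nonneg zero_le_two hr)
    linarith
  have hεpos : 0 < ε := Real.exp_pos _
  have hinv : Real.exp ((2 * r.toReal * C - θ) / (2 * L)) = ε⁻¹ := by
    rw [hε, Real.exp_neg, inv_inv]
  rw [hinv]
  refine hsub.trans ?_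
  rw [← one_div, le_div_iff₀ hεpos, mul_comm]
  exact hmarkov.trans hle

theorem measurable_expLoss_sub (q : Policy S A) :
    Measurable fun z : MDP S A × Policy S A => expLoss z.1 z.2 - expLoss z.1 q := by
  have h1 : Measurable fun z : MDP S A × Policy S A => (z.1, q) :=
    Measurable.prodMk measurable_fst measurable_const
  have h2 := Measurable.comp (g := fun z : MDP S A × Policy S A => expLoss z.1 z.2)
    measurable_expLoss h1
  simp only [Function.comp_def] at h2
  exact Measurable.sub measurable_expLoss h2

/-- The robustness guarantee applied to the renumbered run, with its regret and its corruption
rewritten over original time. -/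
theorem integral_regret_le_count [Nonempty (S 0)] [Subsingleton (S 0)]
    {base : ℝ → MDPAlgorithm S A} {β₁ β₂ β₃ : ℝ}
    (hrob : CorruptionRobust adv T base β₁ β₂ β₃) {θ : ℝ} (hθ : 0 ≤ θ)
    (H : IsThinnedRun adv T (base θ) r μ ℱ M p x h act smp) (P : Transition S A)
    (q : Policy S A) :
    r.toReal * ∫ ω, ∑ t ∈ Finset.range T,
        (act t).indicator (fun ω => expLoss (M t ω) (p t ω) - expLoss (M t ω) q) ω ∂μ ≤
      ∫ ω, (√(β₁ * (count T smp T ω : ℝ)) +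
          if 1 ≤ count T smp T ω then β₂ + β₃ * θ else 0) ∂μ +
        μ.real {ω | θ < ∑ t ∈ Finset.range T,
          (smp t).indicator (fun ω => corruption P (M t ω)) ω} * (L * T) := by
  have hrun := hrob.2.2.2 θ hθ Ω μ _ _ _ _ _ H.isRun P q
  have hg := measurable_expLoss_sub q
  have e1 := H.integral_sum_sampled_policy hg (c := L) fun z => abs_expLoss_sub_le _ _ _
  have e2 : ∀ ω, ∑ t ∈ Finset.range (count T smp T ω), (expLoss (sampled T smp M t ω)
      (sampled T smp p t ω) - expLoss (sampled T smp M t ω) q) = ∑ t ∈ Finset.range T,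
        (smp t).indicator (fun ω => expLoss (M t ω) (p t ω) - expLoss (M t ω) q) ω :=
    fun ω => sum_count (fun t ω => expLoss (M t ω) (p t ω) - expLoss (M t ω) q) le_rfl ω
  have e3 : ∀ ω, ∑ t ∈ Finset.range (count T smp T ω), corruption P (sampled T smp M t ω) =
      ∑ t ∈ Finset.range T, (smp t).indicator (fun ω => corruption P (M t ω)) ω :=
    fun ω => sum_count (fun t ω => corruption P (M t ω)) le_rfl ω
  rw [← e1]
  simp only [e2, e3] at hrun
  exact hrun

/-- Both terms vanish almost surely unless the instance is used, so the probability of `used`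
factors out. -/
theorem integral_sqrt_add_le (H : IsThinnedRun adv T alg r μ ℱ M p x h act smp)
    (hT : 0 < T) (hr : 0 < r.toReal) {β K : ℝ} (hβ : 0 ≤ β) (hK : 0 ≤ K) :
    ∫ ω, (√(β * (count T smp T ω : ℝ)) + if 1 ≤ count T smp T ω then K else 0) ∂μ ≤
      (√β * √(r.toReal * T) + K) * μ.real (used T act) := by
  have i1 : Integrable (fun ω => √(count T smp T ω : ℝ)) μ :=
    Integrable.of_bound (measurable_from_top (f := fun n : ℕ => √(n : ℝ)) |>.comp
      H.measurable_count').aestronglyMeasurable (√T) (ae_of_all _ fun ω => by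
        rw [Real.norm_eq_abs, abs_of_nonneg (Real.sqrt_nonneg _)]
        exact Real.sqrt_le_sqrt (Nat.cast_le.2 (count_le T ω)))
  have i2 : Integrable ((used T act).indicator fun _ => K) μ :=
    (integrable_const _).indicator H.measurableSet_used
  calc ∫ ω, (√(β * (count T smp T ω : ℝ)) +
        if 1 ≤ count T smp T ω then K else 0) ∂μ
      ≤ ∫ ω, (√β * √(count T smp T ω : ℝ) +
          (used T act).indicator (fun _ => K) ω) ∂μ := by
        refine integral_mono_of_nonneg (ae_of_all _ fun ω => add_nonneg (Real.sqrt_nonneg _)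
          (by split_ifs <;> simp [hK])) ((i1.const_mul _).add i2) ?_
        filter_upwards [H.count_eq_zero] with ω hω
        rw [Real.sqrt_mul hβ]
        refine add_le_add le_rfl ?_
        split_ifs with h1
        · rw [Set.indicator_of_mem]
          by_contra hu
          rw [hω hu] at h1
          omega
        · exact Set.indicator_nonneg (fun _ _ => hK) ω
    _ = √β * ∫ ω, √(count T smp T ω : ℝ) ∂μ + K * μ.real (used T act) := by
        rw [integral_add (i1.const_mul _) i2, integral_const_mul,
          integral_indicator_const _ H.measurableSet_used, smul_eq_mul, mul_comm (μ.real _)]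
    _ ≤ √β * (√(r.toReal * T) * μ.real (used T act)) +
          K * μ.real (used T act) := by
        gcongr
        exact H.integral_sqrt_count_le hT hr
    _ = _ := by ring

/-- Regret of the algorithm in all the rounds it is responsible for, passed on or not. -/
theorem integral_regret_le [Nonempty (S 0)] [Subsingleton (S 0)] {base : ℝ → MDPAlgorithm S A}
    {β₁ β₂ β₃ : ℝ} (hrob : CorruptionRobust adv T base β₁ β₂ β₃) {θ C : ℝ} (hθ : 0 ≤ θ)
    (H : IsThinnedRun adv T (base θ) r μ ℱ M p x h act smp) (hT : 0 < T) (hr : 0 < r.toReal)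
    (P : Transition S A) (hC : ∀ᵐ ω ∂μ, ∑ t ∈ Finset.range T, corruption P (M t ω) ≤ C)
    (q : Policy S A) :
    r.toReal * ∫ ω, ∑ t ∈ Finset.range T,
        (act t).indicator (fun ω => expLoss (M t ω) (p t ω) - expLoss (M t ω) q) ω ∂μ ≤
      (√β₁ * √(r.toReal * T) + (β₂ + β₃ * θ)) * μ.real (used T act) +
        Real.exp ((2 * r.toReal * C - θ) / (2 * L)) * (L * T) := by
  have hβ1' : 0 ≤ β₁ := (sq_nonneg _).trans hrob.1
  have hβ2' : 0 ≤ β₂ := (Nat.cast_nonneg _).trans hrob.2.1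
  have hK : 0 ≤ β₂ + β₃ * θ := by
    have := mul_nonneg (zero_le_one.trans hrob.2.2.1) hθ
    linarith
  refine (integral_regret_le_count hrob hθ H P q).trans (add_le_add
    (H.integral_sqrt_add_le hT hr hβ1' hK) ?_)
  -- The tail bound divides by `2 L`; for `L = 0` the tail is multiplied by `L T = 0`.
  rcases Nat.eq_zero_or_pos L with hL | hL
  · have : (L : ℝ) = 0 := by rw [hL, Nat.cast_zero]
    rw [this, zero_mul, mul_zero, mul_zero]
  · exact mul_le_mul_of_nonneg_right (H.measureReal_corruption_le hL P hC) (by positivity)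

end IsThinnedRun

end Thinning

/-- A null set for a two-step kernel is a null set for variables whose law on measurable boxes is
given by this kernel. -/
theorem measure_inter_eq_zero_of_law {Ω α β γ : Type*} [MeasurableSpace Ω] [MeasurableSpace α]
    [MeasurableSpace β] [MeasurableSpace γ] {μ : Measure Ω} [IsFiniteMeasure μ] {Z : Ω → α}
    {Y : Ω → β} {V : Ω → γ} (hZ : Measurable Z) (hY : Measurable Y) (hV : Measurable V)
    {Q : Set Ω} (κ : Kernel α β) [IsFiniteKernel κ] (η : Kernel (α × β) γ)
    [IsSFiniteKernel η] {f : α → β → ℝ≥0∞} (hf : Measurable (Function.uncurry f))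
    (hf' : ∀ a b, f a b ≠ ∞)
    (hlaw : ∀ D B G, MeasurableSet D → MeasurableSet B → MeasurableSet G →
      μ (Z ⁻¹' D ∩ (Y ⁻¹' B ∩ V ⁻¹' G) ∩ Q) =
        ∫⁻ ω in Z ⁻¹' D, ∫⁻ q in B, f (Z ω) q * η (Z ω, q) G ∂(κ (Z ω)) ∂μ)
    {W : Set (α × β × γ)} (hW : MeasurableSet W)
    (hηW : ∀ a b, η (a, b) {c | (a, b, c) ∈ W} = 0) :
    μ ({ω | (Z ω, Y ω, V ω) ∈ W} ∩ Q) = 0 := by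
  have hZYV : Measurable fun ω => (Z ω, Y ω, V ω) := hZ.prodMk (hY.prodMk hV)
  have hsf := Kernel.isSFiniteKernel_withDensity_of_isFiniteKernel κ hf'
  -- The law on boxes identifies the joint law with a two-step kernel, so a set that is null in each
  -- fibre is null. This is needed because `W` need not be a box.
  have e : (μ.restrict Q).map (fun ω => (Z ω, Y ω, V ω)) =
      (μ.map Z) ⊗ₘ (κ.withDensity f ⊗ₖ η) := by
    have := Measure.isFiniteMeasure_map (μ.restrict Q) (fun ω => (Z ω, Y ω, V ω))
    refine Measure.ext_prod₃ fun {D B G} hD hB hG => ?_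
    rw [Measure.map_apply hZYV (hD.prod (hB.prod hG)), Measure.restrict_apply
      (hZYV (hD.prod (hB.prod hG))), Measure.compProd_apply_prod hD (hB.prod hG),
      setLIntegral_map hD (Kernel.measurable_coe _ (hB.prod hG)) hZ]
    refine (hlaw D B G hD hB hG).trans (lintegral_congr fun ω => ?_)
    have h1 : Measurable (f (Z ω)) := hf.comp measurable_prodMk_left
    have h2 : Measurable fun q => η (Z ω, q) G :=
      (Kernel.measurable_coe η hG).comp measurable_prodMk_left
    rw [Kernel.compProd_apply_prod hB hG, Kernel.withDensity_apply _ hf,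
      setLIntegral_withDensity_eq_setLIntegral_mul _ h1 h2 hB]
    rfl
  have h0 : ((μ.restrict Q).map (fun ω => (Z ω, Y ω, V ω))) W = 0 := by
    rw [e, Measure.compProd_apply hW]
    refine (lintegral_congr fun a => ?_).trans lintegral_zero
    rw [Kernel.compProd_apply (measurable_prodMk_left hW)]
    exact (lintegral_congr fun b => hηW a b).trans lintegral_zero
  rwa [Measure.map_apply hZYV hW, Measure.restrict_apply (hZYV hW)] at h0

set_option synthInstance.maxSize 1000

/-! ### The transition kernels of STABILISE -/

namespace Stabilise

open Thinning

/-- The values of `w` for which the `j`-th instance is responsible. -/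
def activeSet (T : ℕ) (j : Slot T) : Set unitInterval := {w | 1 / (T : ℝ) < w ∧ slot T w = j}

theorem measurableSet_activeSet (T : ℕ) (j : Slot T) : MeasurableSet (activeSet T j) :=
  (measurableSet_lt measurable_const measurable_subtype_coe).inter
    (measurable_slot T (measurableSet_singleton j))

/-- From `1 / T < w ≤ 2^{-bin}` one gets `2^bin < T`, so the truncation in `slot` is not in effect.
-/
theorem bin_eq_of_mem_activeSet {T : ℕ} (hT : 0 < T) {j : Slot T} {w : unitInterval}
    (hw : w ∈ activeSet T j) : bin w = j := by
  have hT' : (0 : ℝ) < T := by exact_mod_cast hT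
  have hw0 : 0 < (w : ℝ) := (by positivity : (0 : ℝ) < 1 / T).trans hw.1
  have h1 := hw.1.trans_le (bin_spec w hw0).2
  rw [one_div, inv_lt_inv₀ hT' (by positivity)] at h1
  have h2 : 2 ^ bin w < T := by exact_mod_cast h1
  have h3 : bin w < Nat.clog 2 T :=
    (Nat.pow_lt_pow_iff_right one_lt_two).1 (h2.trans_le (Nat.le_pow_clog one_lt_two T))
  rw [← hw.2, slot]
  exact (min_eq_left h3.le).symm

open scoped Classical in
/-- Distribution of the policy that STABILISE executes. -/
def actKernel (T : ℕ) (base : ℝ → MDPAlgorithm S A)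
    (fallback : Kernel (Memory S A T × unitInterval) (Policy S A)) (C : ℝ) :
    Kernel (Memory S A T × unitInterval) (Policy S A) :=
  Kernel.piecewise (measurable_snd (measurableSet_ignored T)) fallback (suggest T base C)

open scoped Classical in
/-- Distribution of the memory of STABILISE when feedback is received. -/
def seenKernel (S : Fin (L + 1) → Type u) (A : Type u) [∀ k, Fintype (S k)] [Fintype A] (T : ℕ) :
    Kernel (Memory S A T × unitInterval × Policy S A × Feedback S A) (Memory S A T) :=
  Kernel.piecewise ((measurable_fst.comp measurable_snd) (measurableSet_ignored T))
    (Kernel.deterministic Prod.fst measurable_fst) (subsample T)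

/-- Distribution of the memory of STABILISE when no feedback is received. -/
def unseenKernel (S : Fin (L + 1) → Type u) (A : Type u) [∀ k, Fintype (S k)] [Fintype A] (T : ℕ) :
    Kernel (Memory S A T × unitInterval × Policy S A) (Memory S A T) :=
  Kernel.deterministic Prod.fst measurable_fst

variable {T : ℕ} {base : ℝ → MDPAlgorithm S A}
  {fallback : Kernel (Memory S A T × unitInterval) (Policy S A)} [IsMarkovKernel fallback] {C : ℝ}

instance : IsMarkovKernel (actKernel T base fallback C) :=
  (learner T base fallback C).act_markov

instance : IsMarkovKernel (unseenKernel S A T) :=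
  inferInstanceAs (IsMarkovKernel (Kernel.deterministic Prod.fst measurable_fst))

theorem actKernel_apply_of_mem_activeSet {j : Slot T} {w : unitInterval} (hw : w ∈ activeSet T j)
    (z : Memory S A T) :
    actKernel T base fallback C (z, w) = (base (theta (L := L) T C j)).policy (z j) := by
  classical
  have h1 : (z, w) ∉ Prod.snd ⁻¹' ignored T := not_le.2 hw.1
  rw [actKernel, Kernel.piecewise_apply, if_neg h1]
  change (base (theta (L := L) T C (slot T w))).policy (z (slot T w)) = _
  rw [hw.2]

theorem seenKernel_apply (z : Memory S A T × unitInterval × Policy S A × Feedback S A)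
    {D : Set (Memory S A T)} (hD : MeasurableSet D) :
    seenKernel S A T z D = if 1 / (T : ℝ) < z.2.1 then
      ENNReal.ofReal (passProb z.2.1) * D.indicator 1 (pass T z) +
        ENNReal.ofReal (1 - passProb z.2.1) * D.indicator 1 z.1 else D.indicator 1 z.1 := by
  classical
  rw [seenKernel, Kernel.piecewise_apply]
  by_cases h : 1 / (T : ℝ) < z.2.1
  · rw [if_pos h, if_neg (show z ∉ _ from not_le.2 h)]
    change (ENNReal.ofReal (passProb z.2.1) • Measure.dirac (pass T z) +
      ENNReal.ofReal (1 - passProb z.2.1) • Measure.dirac z.1) D = _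
    rw [Measure.add_apply, Measure.smul_apply, Measure.smul_apply, Measure.dirac_apply' _ hD,
      Measure.dirac_apply' _ hD]
    rfl
  · rw [if_neg h, if_pos (show z ∈ _ from not_lt.1 h), Kernel.deterministic_apply,
      Measure.dirac_apply' _ hD]

theorem unseenKernel_apply (z : Memory S A T × unitInterval × Policy S A)
    {D : Set (Memory S A T)} (hD : MeasurableSet D) :
    unseenKernel S A T z D = D.indicator 1 z.1 := by
  rw [unseenKernel, Kernel.deterministic_apply, Measure.dirac_apply' _ hD]

theorem passProb_le_one {w : unitInterval} (hw : 0 < (w : ℝ)) : passProb w ≤ 1 :=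
  (div_le_one hw).2 (bin_spec _ hw).1.le

instance : IsMarkovKernel (seenKernel S A T) := by
  refine ⟨fun z => ⟨?_⟩⟩
  rw [seenKernel_apply z MeasurableSet.univ]
  simp only [Set.indicator_univ, Pi.one_apply, mul_one]
  split_ifs with h
  · have hw : 0 < (z.2.1 : ℝ) := (by positivity : (0 : ℝ) ≤ 1 / T).trans_lt h
    have hp : 0 ≤ passProb z.2.1 := div_nonneg (by positivity) hw.le
    rw [← ENNReal.ofReal_add hp (sub_nonneg.2 (passProb_le_one hw)), add_sub_cancel, ENNReal.ofReal_one]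
  · rfl

theorem pass_apply_of_eq {j : Slot T} (z : Memory S A T × unitInterval × Policy S A × Feedback S A)
    (h : slot T z.2.1 = j) : pass T z j = (z.1 j).append z.2.2 := by
  subst h
  exact Function.update_self _ _ _

theorem pass_apply_of_ne {j : Slot T} (z : Memory S A T × unitInterval × Policy S A × Feedback S A)
    (h : slot T z.2.1 ≠ j) : pass T z j = z.1 j :=
  Function.update_of_ne h.symm _ _

/-- The memory states in which the record of the `j`-th instance does not have length `n`. -/
def lengthNe (S : Fin (L + 1) → Type u) (A : Type u) [∀ k, Fintype (S k)] [Fintype A]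
    (T : ℕ) (j : Slot T) (n : ℕ) : Set (Memory S A T) := {z | (z j).1 ≠ n}

theorem measurable_length (j : Slot T) : Measurable fun z : Memory S A T => (z j).1 :=
  measurable_sigma_fst.comp (measurable_pi_apply j)

theorem measurableSet_lengthNe (j : Slot T) (n : ℕ) : MeasurableSet (lengthNe S A T j n) :=
  (measurable_length j) (measurableSet_singleton n).compl

open scoped Classical in
-- Passing on is visible in the memory as growth of the record, so the hidden subsampling coin can
-- be read off from record lengths.
theorem seen_lengthNe (z : Memory S A T × unitInterval × Policy S A × Feedback S A) (j : Slot T) :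
    seenKernel S A T z (lengthNe S A T j (z.1 j).1) =
      if z.2.1 ∈ activeSet T j then ENNReal.ofReal (passProb z.2.1) else 0 := by
  rw [seenKernel_apply z (measurableSet_lengthNe _ _)]
  have h0 : z.1 ∉ lengthNe S A T j (z.1 j).1 := fun h => h rfl
  rw [Set.indicator_of_notMem h0]
  by_cases hw : 1 / (T : ℝ) < z.2.1
  · by_cases hj : slot T z.2.1 = j
    · have h1 : pass T z ∈ lengthNe S A T j (z.1 j).1 := by
        change (pass T z j).1 ≠ _
        rw [pass_apply_of_eq z hj]
        exact Nat.succ_ne_self _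
      rw [if_pos hw, if_pos ⟨hw, hj⟩, Set.indicator_of_mem h1]
      simp
    · have h1 : pass T z ∉ lengthNe S A T j (z.1 j).1 := by
        intro h
        refine h ?_
        rw [pass_apply_of_ne z hj]
      rw [if_pos hw, if_neg fun h => hj h.2, Set.indicator_of_notMem h1]
      simp
  · rw [if_neg hw, if_neg fun h => hw h.1]

/-- Updates of the `j`-th record that neither keep it nor append the last round. -/
def badUpdate (T : ℕ) (j : Slot T) (y : Traj S A) :
    Set ((Memory S A T × unitInterval × MDP S A) × Policy S A × Memory S A T) :=
  {z | ((z.2.2 j).1 = (z.1.1 j).1 ∧ z.2.2 j ≠ z.1.1 j) ∨ ((z.2.2 j).1 ≠ (z.1.1 j).1 ∧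
    z.2.2 j ≠ (z.1.1 j).append (z.2.1, feedback z.1.2.2 y))}

theorem measurableSet_badUpdate (j : Slot T) (y : Traj S A) :
    MeasurableSet (badUpdate T j y) := by
  have h1 : Measurable fun z : (Memory S A T × unitInterval × MDP S A) × Policy S A ×
      Memory S A T => z.1.1 j := (measurable_pi_apply j).comp (measurable_fst.comp measurable_fst)
  have h2 : Measurable fun z : (Memory S A T × unitInterval × MDP S A) × Policy S A ×
      Memory S A T => z.2.2 j := (measurable_pi_apply j).comp (measurable_snd.comp measurable_snd)
  have h3 : Measurable fun z : (Memory S A T × unitInterval × MDP S A) × Policy S A ×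
      Memory S A T => (z.2.1, feedback z.1.2.2 y) :=
    (measurable_fst.comp measurable_snd).prodMk ((measurable_feedback y).comp
      (measurable_snd.comp (measurable_snd.comp measurable_fst)))
  have h4 := History.measurable_append.comp (h1.prodMk h3)
  have h5 := measurableSet_eq_fun (measurable_sigma_fst.comp h2) (measurable_sigma_fst.comp h1)
  exact (h5.inter (measurableSet_eq_fun h2 h1).compl).union
    (h5.compl.inter (measurableSet_eq_fun h2 h4).compl)

theorem measurableSet_badUpdate_section (z : Memory S A T) (w : unitInterval) (N : MDP S A)
    (q : Policy S A) (j : Slot T) (y : Traj S A) :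
    MeasurableSet {z' : Memory S A T | ((z, w, N), q, z') ∈ badUpdate T j y} := by
  have h1 : Measurable fun z' : Memory S A T => (q, z') :=
    Measurable.prodMk measurable_const measurable_id
  have h2 : Measurable fun z' : Memory S A T => ((z, w, N), q, z') :=
    Measurable.prodMk measurable_const h1
  exact h2 (measurableSet_badUpdate j y)

/-- The kernel is concentrated on the old memory and, in non-ignored rounds, the memory after
passing on. Both are good updates. -/
theorem seen_badUpdate (z : Memory S A T) (w : unitInterval) (N : MDP S A) (q : Policy S A)
    (j : Slot T) (y : Traj S A) :
    seenKernel S A T (z, w, q, feedback N y)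
      {z' | ((z, w, N), q, z') ∈ badUpdate T j y} = 0 := by
  have hm : MeasurableSet {z' : Memory S A T | ((z, w, N), q, z') ∈ badUpdate T j y} :=
    measurableSet_badUpdate_section z w N q j y
  rw [seenKernel_apply _ hm]
  have h1 : z ∉ {z' : Memory S A T | ((z, w, N), q, z') ∈ badUpdate T j y} := by
    rintro (⟨-, h⟩ | ⟨h, -⟩) <;> exact h rfl
  have h2 : pass T (z, w, q, feedback N y) ∉
      {z' : Memory S A T | ((z, w, N), q, z') ∈ badUpdate T j y} := by
    by_cases hj : slot T w = j
    · have e := pass_apply_of_eq (z, w, q, feedback N y) hj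
      rintro (⟨h, -⟩ | ⟨-, h⟩)
      · change (pass T (z, w, q, feedback N y) j).1 = (z j).1 at h
        rw [e] at h
        exact Nat.succ_ne_self _ h
      · exact h e
    · have e := pass_apply_of_ne (z, w, q, feedback N y) hj
      rintro (⟨-, h⟩ | ⟨h, -⟩)
      · exact h e
      · exact h (congrArg Sigma.fst e)
  rw [Set.indicator_of_notMem h1, Set.indicator_of_notMem h2]
  simp

theorem unseen_badUpdate (z : Memory S A T) (w : unitInterval) (N : MDP S A) (q : Policy S A)
    (j : Slot T) (y : Traj S A) :
    unseenKernel S A T (z, w, q)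
      {z' | ((z, w, N), q, z') ∈ badUpdate T j y} = 0 := by
  have hm : MeasurableSet {z' : Memory S A T | ((z, w, N), q, z') ∈ badUpdate T j y} :=
    measurableSet_badUpdate_section z w N q j y
  rw [unseenKernel_apply _ hm]
  have h1 : z ∉ {z' : Memory S A T | ((z, w, N), q, z') ∈ badUpdate T j y} := by
    rintro (⟨-, h⟩ | ⟨h, -⟩) <;> exact h rfl
  rw [Set.indicator_of_notMem h1]

end Stabilise

/-! ### Each instance of STABILISE performs a thinned run -/

namespace Stabilise

open Thinning

variable {T : ℕ} {base : ℝ → MDPAlgorithm S A}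
  {fallback : Kernel (Memory S A T × unitInterval) (Policy S A)} [IsMarkovKernel fallback] {C : ℝ}
  {adv : Adversary} {Ω : Type u} [mΩ : MeasurableSpace Ω] {μ : Measure Ω} [IsProbabilityMeasure μ]
  {ℱ : Filtration ℕ mΩ} {M : ℕ → Ω → MDP S A} {w : ℕ → Ω → unitInterval}
  {m : ℕ → Ω → Memory S A T} {p : ℕ → Ω → Policy S A} {x : ℕ → Ω → Traj S A} {b : ℕ → Ω → Bool}

theorem law_seen (H : IsProtocolRun adv T (learner T base fallback C) μ ℱ M w m p x b)
    {t : ℕ} (ht : t < T) {E : Set Ω} (hE : MeasurableSet[ℱ t] E) {B : Set (Policy S A)}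
    (hB : MeasurableSet B) {D : Set (Memory S A T)} (hD : MeasurableSet D) (y : Traj S A) :
    μ (E ∩ {ω | p t ω ∈ B ∧ x t ω = y ∧ b t ω = true ∧ m (t + 1) ω ∈ D}) =
      ∫⁻ ω in E, ∫⁻ q in B, ENNReal.ofReal (trajProb (M t ω).1 q y) *
        ENNReal.ofReal (w t ω : ℝ) * seenKernel S A T (m t ω, w t ω, q, feedback (M t ω) y) D
        ∂(actKernel T base fallback C (m t ω, w t ω)) ∂μ :=
  (H.law t ht E hE B hB D hD y).1

theorem law_unseen (H : IsProtocolRun adv T (learner T base fallback C) μ ℱ M w m p x b)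
    {t : ℕ} (ht : t < T) {E : Set Ω} (hE : MeasurableSet[ℱ t] E) {B : Set (Policy S A)}
    (hB : MeasurableSet B) {D : Set (Memory S A T)} (hD : MeasurableSet D) (y : Traj S A) :
    μ (E ∩ {ω | p t ω ∈ B ∧ x t ω = y ∧ b t ω = false ∧ m (t + 1) ω ∈ D}) =
      ∫⁻ ω in E, ∫⁻ q in B, ENNReal.ofReal (trajProb (M t ω).1 q y) *
        ENNReal.ofReal (1 - (w t ω : ℝ)) * unseenKernel S A T (m t ω, w t ω, q) D
        ∂(actKernel T base fallback C (m t ω, w t ω)) ∂μ :=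
  (H.law t ht E hE B hB D hD y).2

theorem measurable_memory (H : IsProtocolRun adv T (learner T base fallback C) μ ℱ M w m p x b)
    {t : ℕ} (ht : t ≤ T) : Measurable[ℱ t] (m t) :=
  H.mem_meas t ht

theorem measurable_state (H : IsProtocolRun adv T (learner T base fallback C) μ ℱ M w m p x b)
    {t : ℕ} (ht : t < T) : Measurable[ℱ t] fun ω => (m t ω, w t ω, M t ω) :=
  Measurable.prodMk (measurable_memory H ht.le) (Measurable.prodMk
    ((H.prob_meas t ht).mono (ℱ.mono (adv.info_le t)) le_rfl)
    ((H.env_meas t ht).mono (ℱ.mono (adv.info_le t)) le_rfl))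

theorem measurable_density (y : Traj S A) {g : unitInterval → ℝ≥0∞} (hg : Measurable g) :
    Measurable (Function.uncurry fun (z : Memory S A T × unitInterval × MDP S A)
      (q : Policy S A) => ENNReal.ofReal (trajProb z.2.2.1 q y) * g z.2.1) := by
  have h1 : Measurable fun z : (Memory S A T × unitInterval × MDP S A) × Policy S A =>
      (z.1.2.2.1, z.2) := (measurable_fst.comp (measurable_snd.comp (measurable_snd.comp
        measurable_fst))).prodMk measurable_snd
  have h2 : Measurable fun z : (Memory S A T × unitInterval × MDP S A) × Policy S A => z.1.2.1 :=
    measurable_fst.comp (measurable_snd.comp measurable_fst)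
  exact ((measurable_trajProb y).comp h1).ennreal_ofReal.mul (hg.comp h2)

/-- The protocol specifies the memory only in law, so the update rule holds almost surely only. For
each of the finitely many trajectories, with and without feedback, the bad updates are null for the
kernel. -/
theorem ae_notMem_badUpdate
    (H : IsProtocolRun adv T (learner T base fallback C) μ ℱ M w m p x b) (j : Slot T) {t : ℕ}
    (ht : t < T) :
    ∀ᵐ ω ∂μ, ((m t ω, w t ω, M t ω), p t ω, m (t + 1) ω) ∉ badUpdate T j (x t ω) := by
  have hZ := measurable_state H ht
  have hZ' := hZ.mono (ℱ.le _) le_rfl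
  have hp := (H.policy_meas t ht).mono (ℱ.le _) le_rfl
  have hm := (measurable_memory H (Nat.succ_le_of_lt ht)).mono (ℱ.le _) le_rfl
  have hκ : Measurable fun z : Memory S A T × unitInterval × MDP S A => (z.1, z.2.1) :=
    Measurable.prodMk measurable_fst (measurable_fst.comp measurable_snd)
  have hη : ∀ y, Measurable fun z : (Memory S A T × unitInterval × MDP S A) × Policy S A =>
      (z.1.1, z.1.2.1, z.2, feedback z.1.2.2 y) := fun y =>
    (measurable_fst.comp measurable_fst).prodMk ((measurable_fst.comp (measurable_snd.comp
      measurable_fst)).prodMk (measurable_snd.prodMk ((measurable_feedback y).comp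
        (measurable_snd.comp (measurable_snd.comp measurable_fst)))))
  have hη' : Measurable fun z : (Memory S A T × unitInterval × MDP S A) × Policy S A =>
      (z.1.1, z.1.2.1, z.2) :=
    (measurable_fst.comp measurable_fst).prodMk ((measurable_fst.comp (measurable_snd.comp
      measurable_fst)).prodMk measurable_snd)
  have h1 : ∀ y, μ ({ω | ((m t ω, w t ω, M t ω), p t ω, m (t + 1) ω) ∈ badUpdate T j y} ∩
      {ω | x t ω = y ∧ b t ω = true}) = 0 := by
    intro y
    refine measure_inter_eq_zero_of_law hZ' hp hm
      ((actKernel T base fallback C).comap _ hκ) ((seenKernel S A T).comap _ (hη y))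
      (f := fun z q => ENNReal.ofReal (trajProb z.2.2.1 q y) * ENNReal.ofReal (z.2.1 : ℝ))
      (measurable_density y measurable_subtype_coe.ennreal_ofReal)
      (fun _ _ => ENNReal.mul_ne_top ENNReal.ofReal_ne_top ENNReal.ofReal_ne_top)
      (fun D B G hD hB hG => ?_) (measurableSet_badUpdate j y) fun z q =>
        seen_badUpdate z.1 z.2.1 z.2.2 q j y
    refine Eq.trans ?_ (law_seen H ht (hZ hD) hB hG y)
    congr 1
    ext ω
    simp only [Set.mem_inter_iff, Set.mem_preimage, Set.mem_ofPred_eq]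
    tauto
  have h2 : ∀ y, μ ({ω | ((m t ω, w t ω, M t ω), p t ω, m (t + 1) ω) ∈ badUpdate T j y} ∩
      {ω | x t ω = y ∧ b t ω = false}) = 0 := by
    intro y
    refine measure_inter_eq_zero_of_law hZ' hp hm
      ((actKernel T base fallback C).comap _ hκ) ((unseenKernel S A T).comap _ hη')
      (f := fun z q => ENNReal.ofReal (trajProb z.2.2.1 q y) * ENNReal.ofReal (1 - (z.2.1 : ℝ)))
      (measurable_density y (measurable_const.sub measurable_subtype_coe).ennreal_ofReal)
      (fun _ _ => ENNReal.mul_ne_top ENNReal.ofReal_ne_top ENNReal.ofReal_ne_top)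
      (fun D B G hD hB hG => ?_) (measurableSet_badUpdate j y) fun z q =>
        unseen_badUpdate z.1 z.2.1 z.2.2 q j y
    refine Eq.trans ?_ (law_unseen H ht (hZ hD) hB hG y)
    congr 1
    ext ω
    simp only [Set.mem_inter_iff, Set.mem_preimage, Set.mem_ofPred_eq]
    tauto
  have h3 := ae_all_iff.2 fun y => measure_eq_zero_iff_ae_notMem.1 (h1 y)
  have h4 := ae_all_iff.2 fun y => measure_eq_zero_iff_ae_notMem.1 (h2 y)
  filter_upwards [h3, h4] with ω h3 h4 hbad
  cases hb : b t ω
  · exact h4 _ ⟨hbad, rfl, hb⟩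
  · exact h3 _ ⟨hbad, rfl, hb⟩

theorem measurable_policy_trajProb (N : MDP S A) (y : Traj S A) :
    Measurable fun q : Policy S A => ENNReal.ofReal (trajProb N.1 q y) :=
  ((measurable_trajProb y).comp measurable_prodMk_left).ennreal_ofReal

theorem measurableSet_active
    (H : IsProtocolRun adv T (learner T base fallback C) μ ℱ M w m p x b) (j : Slot T) {t : ℕ}
    (ht : t < T) : MeasurableSet[ℱ t] {ω | w t ω ∈ activeSet T j} :=
  ℱ.mono (adv.info_le t) _ (H.prob_meas t ht (measurableSet_activeSet T j))

theorem measurable_roundLaw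
    (H : IsProtocolRun adv T (learner T base fallback C) μ ℱ M w m p x b) (j : Slot T) {t : ℕ}
    (ht : t < T) {B : Set (Policy S A)} (hB : MeasurableSet B) (y : Traj S A) :
    Measurable fun ω =>
      roundLaw (base (theta (L := L) T C j)) B y (m t ω j) (M t ω) := by
  have h1 := (measurable_pi_apply j).comp ((measurable_memory H ht.le).mono (ℱ.le _) le_rfl)
  have h2 := (H.env_meas t ht).mono (ℱ.le _) le_rfl
  exact (Thinning.measurable_roundLaw (base (theta (L := L) T C j)) hB y).comp (h1.prodMk h2)

/-- Adding the cases with and without feedback, and ignoring the new memory, cancels the reveal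
probability: the weights `w` and `1 - w` sum to one. -/
theorem law_active (H : IsProtocolRun adv T (learner T base fallback C) μ ℱ M w m p x b)
    (j : Slot T) {t : ℕ} (ht : t < T) {E : Set Ω} (hE : MeasurableSet[ℱ t] E)
    {B : Set (Policy S A)} (hB : MeasurableSet B) (y : Traj S A) :
    μ (E ∩ {ω | w t ω ∈ activeSet T j} ∩ {ω | p t ω ∈ B ∧ x t ω = y}) =
      ∫⁻ ω in E ∩ {ω | w t ω ∈ activeSet T j},
        roundLaw (base (theta (L := L) T C j)) B y (m t ω j) (M t ω) ∂μ := by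
  have hact : MeasurableSet[ℱ t] (E ∩ {ω | w t ω ∈ activeSet T j}) :=
    hE.inter (measurableSet_active H j ht)
  have hact' := ℱ.le t _ hact
  have h1 := law_seen H ht hact hB MeasurableSet.univ y
  have h2 := law_unseen H ht hact hB MeasurableSet.univ y
  have hb : MeasurableSet {ω | b t ω = true} :=
    (ℱ.le _) _ (H.reveal_meas t ht (measurableSet_singleton true))
  have hw : Measurable fun ω => (w t ω : ℝ) :=
    measurable_subtype_coe.comp ((H.prob_meas t ht).mono (ℱ.le _) le_rfl)
  have e1 : ∀ ω ∈ E ∩ {ω | w t ω ∈ activeSet T j},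
      ∫⁻ q in B, ENNReal.ofReal (trajProb (M t ω).1 q y) * ENNReal.ofReal (w t ω : ℝ) *
        seenKernel S A T (m t ω, w t ω, q, feedback (M t ω) y) Set.univ
        ∂(actKernel T base fallback C (m t ω, w t ω)) =
      roundLaw (base (theta (L := L) T C j)) B y (m t ω j) (M t ω) *
        ENNReal.ofReal (w t ω : ℝ) := by
    intro ω hω
    simp_rw [measure_univ, mul_one]
    rw [lintegral_mul_const _ (measurable_policy_trajProb _ y),
      actKernel_apply_of_mem_activeSet hω.2]
    rfl
  have e2 : ∀ ω ∈ E ∩ {ω | w t ω ∈ activeSet T j},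
      ∫⁻ q in B, ENNReal.ofReal (trajProb (M t ω).1 q y) * ENNReal.ofReal (1 - (w t ω : ℝ)) *
        unseenKernel S A T (m t ω, w t ω, q) Set.univ
        ∂(actKernel T base fallback C (m t ω, w t ω)) =
      roundLaw (base (theta (L := L) T C j)) B y (m t ω j) (M t ω) *
        ENNReal.ofReal (1 - (w t ω : ℝ)) := by
    intro ω hω
    simp_rw [measure_univ, mul_one]
    rw [lintegral_mul_const _ (measurable_policy_trajProb _ y),
      actKernel_apply_of_mem_activeSet hω.2]
    rfl
  rw [setLIntegral_congr_fun hact' e1] at h1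
  rw [setLIntegral_congr_fun hact' e2] at h2
  rw [← measure_inter_add_sdiff _ hb]
  have s1 : E ∩ {ω | w t ω ∈ activeSet T j} ∩ {ω | p t ω ∈ B ∧ x t ω = y} ∩ {ω | b t ω = true} =
      E ∩ {ω | w t ω ∈ activeSet T j} ∩
        {ω | p t ω ∈ B ∧ x t ω = y ∧ b t ω = true ∧ m (t + 1) ω ∈ Set.univ} := by
    ext ω
    simp only [Set.mem_inter_iff, Set.mem_ofPred_eq, Set.mem_univ]
    tauto
  have s2 : (E ∩ {ω | w t ω ∈ activeSet T j} ∩ {ω | p t ω ∈ B ∧ x t ω = y}) \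
        {ω | b t ω = true} =
      E ∩ {ω | w t ω ∈ activeSet T j} ∩
        {ω | p t ω ∈ B ∧ x t ω = y ∧ b t ω = false ∧ m (t + 1) ω ∈ Set.univ} := by
    ext ω
    simp only [Set.mem_inter_iff, Set.mem_sdiff, Set.mem_ofPred_eq, Set.mem_univ,
      Bool.not_eq_true]
    tauto
  have hmul : Measurable fun ω => roundLaw (base (theta (L := L) T C j)) B y (m t ω j) (M t ω) *
      ENNReal.ofReal (w t ω : ℝ) := (measurable_roundLaw H j ht hB y).mul hw.ennreal_ofReal
  rw [s1, s2, h1, h2, ← lintegral_add_left hmul]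
  refine lintegral_congr fun ω => ?_
  rw [← mul_add, ← ENNReal.ofReal_add (w t ω).2.1 (sub_nonneg.2 (w t ω).2.2), add_sub_cancel,
    ENNReal.ofReal_one, mul_one]

/-- The purpose of subsampling: the reveal probability cancels, and the chance of passing on depends
on the bin alone. -/
theorem ofReal_mul_passProb (hT : 0 < T) {j : Slot T} {v : unitInterval}
    (hv : v ∈ activeSet T j) :
    ENNReal.ofReal (v : ℝ) * ENNReal.ofReal (passProb v) =
      ENNReal.ofReal ((2 : ℝ) ^ ((j : ℕ) + 1))⁻¹ := by
  have hv0 : 0 < (v : ℝ) := (by positivity : (0 : ℝ) ≤ 1 / T).trans_lt hv.1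
  rw [← ENNReal.ofReal_mul hv0.le, passProb, mul_div_cancel₀ _ hv0.ne',
    bin_eq_of_mem_activeSet hT hv]

/-- The rounds whose feedback is passed on to the `j`-th instance. -/
def passed (m : ℕ → Ω → Memory S A T) (j : Slot T) (t : ℕ) : Set Ω :=
  {ω | (m (t + 1) ω j).1 ≠ (m t ω j).1}

theorem measurableSet_passed
    (H : IsProtocolRun adv T (learner T base fallback C) μ ℱ M w m p x b) (j : Slot T) {t : ℕ}
    (ht : t < T) : MeasurableSet[ℱ (t + 1)] (passed m j t) :=
  (measurableSet_eq_fun ((measurable_length j).comp (measurable_memory H (Nat.succ_le_of_lt ht)))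
    ((measurable_length j).comp ((measurable_memory H ht.le).mono (ℱ.mono t.le_succ)
      le_rfl))).compl

/-- With the previous length fixed to `n`, growth of the record is a fixed event for the new memory,
as the protocol law demands. Without feedback it has probability zero; with feedback,
`ofReal_mul_passProb` applies. -/
theorem law_passed_length (hT : 0 < T)
    (H : IsProtocolRun adv T (learner T base fallback C) μ ℱ M w m p x b)
    (j : Slot T) {t : ℕ} (ht : t < T) {E : Set Ω} (hE : MeasurableSet[ℱ t] E)
    {B : Set (Policy S A)} (hB : MeasurableSet B) (y : Traj S A) {n : ℕ}
    (hn : ∀ ω ∈ E, (m t ω j).1 = n) :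
    μ (E ∩ passed m j t ∩ {ω | p t ω ∈ B ∧ x t ω = y}) =
      ENNReal.ofReal ((2 : ℝ) ^ ((j : ℕ) + 1))⁻¹ *
        μ (E ∩ {ω | w t ω ∈ activeSet T j} ∩ {ω | p t ω ∈ B ∧ x t ω = y}) := by
  classical
  have hE' := ℱ.le t _ hE
  have hact' := ℱ.le t _ (measurableSet_active H j ht)
  have h1 := law_seen H ht hE hB (measurableSet_lengthNe j n) y
  have h2 := law_unseen H ht hE hB (measurableSet_lengthNe j n) y
  have hb : MeasurableSet {ω | b t ω = true} :=
    (ℱ.le _) _ (H.reveal_meas t ht (measurableSet_singleton true))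
  have e1 : ∀ ω ∈ E,
      ∫⁻ q in B, ENNReal.ofReal (trajProb (M t ω).1 q y) * ENNReal.ofReal (w t ω : ℝ) *
        seenKernel S A T (m t ω, w t ω, q, feedback (M t ω) y) (lengthNe S A T j n)
        ∂(actKernel T base fallback C (m t ω, w t ω)) =
      {ω | w t ω ∈ activeSet T j}.indicator (fun ω => ENNReal.ofReal ((2 : ℝ) ^ ((j : ℕ) + 1))⁻¹ *
        roundLaw (base (theta (L := L) T C j)) B y (m t ω j) (M t ω)) ω := by
    intro ω hω
    have hs : ∀ q, seenKernel S A T (m t ω, w t ω, q, feedback (M t ω) y) (lengthNe S A T j n) =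
        if w t ω ∈ activeSet T j then ENNReal.ofReal (passProb (w t ω)) else 0 := fun q => by
      rw [← hn ω hω]
      exact seen_lengthNe (m t ω, w t ω, q, feedback (M t ω) y) j
    simp_rw [hs]
    by_cases ha : w t ω ∈ activeSet T j
    · rw [Set.indicator_of_mem (show ω ∈ {ω | w t ω ∈ activeSet T j} from ha)]
      simp_rw [if_pos ha, mul_assoc, ofReal_mul_passProb hT ha]
      rw [lintegral_mul_const _ (measurable_policy_trajProb _ y), mul_comm,
        actKernel_apply_of_mem_activeSet ha]
      rfl
    · rw [Set.indicator_of_notMem (show ω ∉ {ω | w t ω ∈ activeSet T j} from ha)]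
      simp_rw [if_neg ha, mul_zero]
      exact lintegral_zero
  have e2 : ∀ ω ∈ E,
      ∫⁻ q in B, ENNReal.ofReal (trajProb (M t ω).1 q y) * ENNReal.ofReal (1 - (w t ω : ℝ)) *
        unseenKernel S A T (m t ω, w t ω, q) (lengthNe S A T j n)
        ∂(actKernel T base fallback C (m t ω, w t ω)) = 0 := by
    intro ω hω
    have hs : ∀ q, unseenKernel S A T (m t ω, w t ω, q) (lengthNe S A T j n) = 0 := fun q => by
      have h0 : m t ω ∉ lengthNe S A T j n := fun h => h (hn ω hω)
      rw [unseenKernel_apply _ (measurableSet_lengthNe j n), Set.indicator_of_notMem h0]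
    simp_rw [hs, mul_zero]
    exact lintegral_zero
  -- `law_active` is used backwards: the integral of the prescribed law becomes again the
  -- probability of the play in the active round.
  rw [setLIntegral_congr_fun hE' e1, setLIntegral_indicator hact',
    lintegral_const_mul _ (measurable_roundLaw H j ht hB y), Set.inter_comm _ E,
    ← law_active H j ht hE hB y] at h1
  rw [setLIntegral_congr_fun hE' e2, lintegral_zero] at h2
  rw [← measure_inter_add_sdiff _ hb]
  have s1 : E ∩ passed m j t ∩ {ω | p t ω ∈ B ∧ x t ω = y} ∩ {ω | b t ω = true} =
      E ∩ {ω | p t ω ∈ B ∧ x t ω = y ∧ b t ω = true ∧ m (t + 1) ω ∈ lengthNe S A T j n} := by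
    ext ω
    have := hn ω
    simp only [Set.mem_inter_iff, Set.mem_ofPred_eq, passed, lengthNe]
    grind
  have s2 : (E ∩ passed m j t ∩ {ω | p t ω ∈ B ∧ x t ω = y}) \ {ω | b t ω = true} =
      E ∩ {ω | p t ω ∈ B ∧ x t ω = y ∧ b t ω = false ∧ m (t + 1) ω ∈ lengthNe S A T j n} := by
    ext ω
    have := hn ω
    simp only [Set.mem_inter_iff, Set.mem_sdiff, Set.mem_ofPred_eq, passed, lengthNe,
      Bool.not_eq_true]
    grind
  rw [s1, s2, h1, h2, add_zero]

/-- The previous length is known before the round, so the events on which it is constant can be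
summed. -/
theorem law_passed (hT : 0 < T)
    (H : IsProtocolRun adv T (learner T base fallback C) μ ℱ M w m p x b)
    (j : Slot T) {t : ℕ} (ht : t < T) {E : Set Ω} (hE : MeasurableSet[ℱ t] E)
    {B : Set (Policy S A)} (hB : MeasurableSet B) (y : Traj S A) :
    μ (E ∩ passed m j t ∩ {ω | p t ω ∈ B ∧ x t ω = y}) =
      ENNReal.ofReal ((2 : ℝ) ^ ((j : ℕ) + 1))⁻¹ *
        μ (E ∩ {ω | w t ω ∈ activeSet T j} ∩ {ω | p t ω ∈ B ∧ x t ω = y}) := by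
  have hR : MeasurableSet {ω | p t ω ∈ B ∧ x t ω = y} := ℱ.le _ _
    ((H.policy_meas t ht hB).inter (H.traj_meas t ht (measurableSet_singleton y)))
  have hlen : ∀ n, MeasurableSet[ℱ t] {ω | (m t ω j).1 = n} := fun n =>
    ((measurable_length j).comp (measurable_memory H ht.le)) (measurableSet_singleton n)
  have hsplit : ∀ G : Set Ω, MeasurableSet G →
      μ (E ∩ G ∩ {ω | p t ω ∈ B ∧ x t ω = y}) =
        ∑' n, μ (E ∩ {ω | (m t ω j).1 = n} ∩ G ∩ {ω | p t ω ∈ B ∧ x t ω = y}) := by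
    intro G hG
    rw [← measure_iUnion]
    · congr 1
      ext ω
      simp only [Set.mem_inter_iff, Set.mem_iUnion, Set.mem_ofPred_eq]
      constructor
      · rintro ⟨⟨h1, h2⟩, h3⟩
        exact ⟨_, ⟨⟨h1, rfl⟩, h2⟩, h3⟩
      · rintro ⟨n, ⟨⟨h1, -⟩, h2⟩, h3⟩
        exact ⟨⟨h1, h2⟩, h3⟩
    · intro n k hnk
      refine Set.disjoint_left.2 fun ω h1 h2 => hnk ?_
      exact (h1.1.1.2 : (m t ω j).1 = n).symm.trans h2.1.1.2
    · exact fun n => (((ℱ.le _ _ hE).inter (ℱ.le _ _ (hlen n))).inter hG).inter hR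
  rw [hsplit _ (ℱ.le _ _ (measurableSet_passed H j ht)),
    hsplit _ (ℱ.le _ _ (measurableSet_active H j ht)), ← ENNReal.tsum_mul_left]
  exact tsum_congr fun n => law_passed_length hT H j ht (hE.inter (hlen n)) hB y fun ω hω => hω.2

/-- The `j`-th instance of the base algorithm runs on the rounds that are passed on to it. -/
theorem isThinnedRun (hT : 0 < T)
    (H : IsProtocolRun adv T (learner T base fallback C) μ ℱ M w m p x b) (j : Slot T) :
    IsThinnedRun adv T (base (theta (L := L) T C j)) (ENNReal.ofReal ((2 : ℝ) ^ ((j : ℕ) + 1))⁻¹)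
      μ ℱ M p x (fun t ω => m t ω j) (fun t => {ω | w t ω ∈ activeSet T j}) (passed m j) where
  env_meas := H.env_meas
  policy_meas := H.policy_meas
  traj_meas := H.traj_meas
  record_meas _ ht := (measurable_pi_apply j).comp (measurable_memory H ht)
  active_meas t ht := H.prob_meas t ht (measurableSet_activeSet T j)
  sampled_meas _ ht := measurableSet_passed H j ht
  record_zero ω := congrFun (H.mem_init ω : m 0 ω = fun _ => ⟨0, Fin.elim0⟩) j
  record_sampled t ht := by
    filter_upwards [ae_notMem_badUpdate H j ht] with ω h1 h2
    by_contra h3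
    exact h1 (Or.inr ⟨h2, h3⟩)
  record_skipped t ht := by
    filter_upwards [ae_notMem_badUpdate H j ht] with ω h1 h2
    by_contra h3
    exact h1 (Or.inl ⟨not_not.1 h2, h3⟩)
  law_active _ ht _ hE _ hB y := law_active H j ht hE hB y
  law_sampled _ ht _ hE _ hB y := law_passed hT H j ht hE hB y

end Stabilise

/-! ### Geometric sums, numerical estimates, and lower bounds for `ρ_T` -/

open scoped Classical in
-- Discard the top indices not satisfying `c`; the rest is at most the full geometric sum up to the
-- largest index satisfying `c`, whose power is at most `B`.
theorem sum_ite_pow_le {x B : ℝ} (hx : 1 ≤ x) (hB : 0 ≤ B) (N : ℕ) (c : Fin N → Prop)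
    (hc : ∀ j, c j → x ^ (j : ℕ) ≤ B) :
    (x - 1) * ∑ j : Fin N, (if c j then x ^ (j : ℕ) else 0) ≤ x * B := by
  induction N with
  | zero => simpa using mul_nonneg (zero_le_one.trans hx) hB
  | succ N ih =>
    by_cases hN : c (Fin.last N)
    · have h1 : ∑ j : Fin (N + 1), (if c j then x ^ (j : ℕ) else 0) ≤
          ∑ j ∈ Finset.range (N + 1), x ^ j := by
        rw [← Fin.sum_univ_eq_sum_range (fun j => x ^ j)]
        refine Finset.sum_le_sum fun j _ => ?_
        split_ifs
        · exact le_rfl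
        · positivity
      have h2 := mul_geom_sum x (N + 1)
      have h3 := hc _ hN
      calc (x - 1) * ∑ j : Fin (N + 1), (if c j then x ^ (j : ℕ) else 0)
          ≤ x ^ (N + 1) - 1 := h2 ▸ mul_le_mul_of_nonneg_left h1 (sub_nonneg.2 hx)
        _ ≤ x * x ^ N := by rw [pow_succ']; linarith
        _ ≤ x * B := mul_le_mul_of_nonneg_left h3 (zero_le_one.trans hx)
    · rw [Fin.sum_univ_castSucc, if_neg hN, add_zero]
      exact ih (fun j => c j.castSucc) fun j => hc _

namespace Stabilise

open Thinning

/-- Since `clog ≤ log T / log 2 + 1` and `log 2 ≤ log T`, the left side is at most `3 log T / log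
2`, and `3 / log 2 < 5`. -/
theorem clog_add_one_le {T : ℕ} (hT : 2 ≤ T) : (Nat.clog 2 T + 1 : ℝ) ≤ 5 * Real.log T := by
  have hT' : (2 : ℝ) ≤ T := by exact_mod_cast hT
  have h1 : 2 ^ (Nat.clog 2 T - 1) < T := Nat.pow_pred_clog_lt_self one_lt_two (by omega)
  have h2 : 1 ≤ Nat.clog 2 T := Nat.clog_pos one_lt_two hT
  have h3 : ((Nat.clog 2 T - 1 : ℕ) : ℝ) * Real.log 2 ≤ Real.log T := by
    rw [← Real.log_pow]
    exact Real.log_le_log (by positivity) (by exact_mod_cast h1.le)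
  have h4 : Real.log 2 ≤ Real.log T := Real.log_le_log two_pos hT'
  have h5 := Real.log_two_gt_d9
  rw [Nat.cast_sub h2, Nat.cast_one] at h3
  nlinarith

theorem two_pow_clog_le {T : ℕ} (hT : 2 ≤ T) : (2 : ℝ) ^ Nat.clog 2 T ≤ 2 * T := by
  have h1 : 2 ^ (Nat.clog 2 T - 1) < T := Nat.pow_pred_clog_lt_self one_lt_two (by omega)
  have h2 : 1 ≤ Nat.clog 2 T := Nat.clog_pos one_lt_two hT
  have h3 : 2 ^ Nat.clog 2 T ≤ 2 * T := by
    rw [← Nat.sub_add_cancel h2, pow_succ']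
    omega
  exact_mod_cast h3

section rho

variable {Ω : Type u} {T : ℕ} {w : ℕ → Ω → unitInterval} {ω : Ω}

theorem ofReal_le_rho {t : ℕ} (ht : t < T) {a : ℝ} (ha : 0 < a) (h : (w t ω : ℝ) ≤ a⁻¹) :
    ENNReal.ofReal a ≤ rho T w ω := by
  rw [rho, ENNReal.le_inv_iff_le_inv, ← ENNReal.ofReal_inv_of_pos ha]
  exact (iInf_le (fun t : Fin T => ENNReal.ofReal (w t ω : ℝ)) ⟨t, ht⟩).trans
    (ENNReal.ofReal_le_ofReal h)

theorem ofReal_two_pow_le_rho (hT : 0 < T) {j : Slot T}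
    (h : ω ∈ IsThinnedRun.used T fun t => {ω | w t ω ∈ activeSet T j}) :
    ENNReal.ofReal ((2 : ℝ) ^ (j : ℕ)) ≤ rho T w ω := by
  obtain ⟨t, ht⟩ := Set.mem_iUnion.1 h
  refine ofReal_le_rho t.2 (by positivity) ?_
  have h0 : 0 < (w t ω : ℝ) := (by positivity : (0 : ℝ) ≤ 1 / T).trans_lt ht.1
  rw [← bin_eq_of_mem_activeSet hT ht]
  exact (bin_spec _ h0).2

/-- A finite number below `ρ` that dominates all the quantities of interest. -/
theorem exists_le_rho (hT : 0 < T) :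
    ∃ R : ℝ, 1 ≤ R ∧ ENNReal.ofReal R ≤ rho T w ω ∧
      ((∃ t < T, (w t ω : ℝ) ≤ 1 / T) → (T : ℝ) ≤ R) ∧
      ∀ j : Slot T, (ω ∈ IsThinnedRun.used T fun t => {ω | w t ω ∈ activeSet T j}) →
        (2 : ℝ) ^ (j : ℕ) ≤ R := by
  have hT' : (0 : ℝ) < T := by exact_mod_cast hT
  -- `ρ` may be infinite; truncating it at `K` gives a real number. `K` exceeds `1`, `T` and every
  -- `2^j` of a slot, so truncation loses none of the lower bounds.
  set K : ℝ := 1 + T + 2 ^ Nat.clog 2 T with hK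
  have hne : min (rho T w ω) (ENNReal.ofReal K) ≠ ∞ := ne_top_of_le_ne_top ENNReal.ofReal_ne_top
    (min_le_right _ _)
  have h2 : (0 : ℝ) < 2 ^ Nat.clog 2 T := by positivity
  have key : ∀ a : ℝ, 0 ≤ a → a ≤ K → ENNReal.ofReal a ≤ rho T w ω →
      a ≤ (min (rho T w ω) (ENNReal.ofReal K)).toReal := by
    intro a ha haK har
    rw [← ENNReal.toReal_ofReal ha]
    exact ENNReal.toReal_mono hne (le_min har (ENNReal.ofReal_le_ofReal haK))
  refine ⟨(min (rho T w ω) (ENNReal.ofReal K)).toReal, key 1 zero_le_one (by linarith)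
    (ofReal_le_rho hT one_pos (by simpa using (w 0 ω).2.2)), ?_, ?_, ?_⟩
  · rw [ENNReal.ofReal_toReal hne]
    exact min_le_left _ _
  · rintro ⟨t, ht, h⟩
    exact key T hT'.le (by linarith) (ofReal_le_rho ht hT' (by rwa [← one_div]))
  · intro j hj
    refine key _ (by positivity) ?_ (ofReal_two_pow_le_rho hT hj)
    have : (2 : ℝ) ^ (j : ℕ) ≤ 2 ^ Nat.clog 2 T :=
      pow_le_pow_right₀ one_le_two (Nat.lt_succ_iff.1 j.2)
    linarith

end rho

/-- The coefficient of the event that the `j`-th instance is used. -/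
def usedCoeff (T : ℕ) (β K : ℝ) (j : ℕ) : ℝ := √β * √T * √2 ^ (j + 1) + 2 ^ (j + 1) * K

theorem usedCoeff_nonneg (T : ℕ) (β : ℝ) {K : ℝ} (hK : 0 ≤ K) (j : ℕ) :
    0 ≤ usedCoeff T β K j := by
  unfold usedCoeff
  positivity

open scoped Classical in
-- Two geometric sums, with ratios `√2` and `2`, whose largest terms are at most `√R` and `R`.
theorem sum_usedCoeff_le (T : ℕ) (β : ℝ) {K R : ℝ} (hK : 0 ≤ K) (hR : 0 ≤ R) (N : ℕ)
    (c : Fin N → Prop) (hc : ∀ j, c j → (2 : ℝ) ^ (j : ℕ) ≤ R) :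
    ∑ j : Fin N, (if c j then usedCoeff T β K j else 0) ≤
      5 * (√β * √T * √R) + 4 * K * R := by
  have h2 : √2 * √2 = 2 := Real.mul_self_sqrt zero_le_two
  have h2' : (1 : ℝ) ≤ √2 := Real.one_le_sqrt.2 one_le_two
  have h2'' : √2 ≤ 3 / 2 := Real.sqrt_le_iff.2 ⟨by norm_num, by norm_num⟩
  have hpow : ∀ j : ℕ, √2 ^ j = √((2 : ℝ) ^ j) := fun j =>
    ((Real.sqrt_eq_iff_mul_self_eq (by positivity) (by positivity)).2 (by
      rw [← mul_pow, h2])).symm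
  have s1 := sum_ite_pow_le h2' (Real.sqrt_nonneg R) N c fun j hj => by
    rw [hpow]
    exact Real.sqrt_le_sqrt (hc j hj)
  have s2 := sum_ite_pow_le one_le_two hR N c hc
  set X := ∑ j : Fin N, (if c j then √2 ^ (j : ℕ) else 0)
  set Y := ∑ j : Fin N, (if c j then (2 : ℝ) ^ (j : ℕ) else 0)
  have e : ∑ j : Fin N, (if c j then usedCoeff T β K j else 0) =
      √β * √T * (√2 * X) + 2 * K * Y := by
    rw [Finset.mul_sum, Finset.mul_sum, Finset.mul_sum, ← Finset.sum_add_distrib]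
    refine Finset.sum_congr rfl fun j _ => ?_
    split_ifs
    · rw [usedCoeff, pow_succ, pow_succ]
      ring
    · simp
  -- Multiplying by the conjugate `√2 + 1` of `√2 - 1` yields `X ≤ (2 + √2) √R`; then `2 √2 + 2 ≤ 5`
  -- because `√2 ≤ 3 / 2`.
  have hX : √2 * X ≤ 5 * √R := by
    have h3 : (√2 + 1) * ((√2 - 1) * X) ≤ (√2 + 1) * (√2 * √R) :=
      mul_le_mul_of_nonneg_left s1 (by positivity)
    have h4 : X ≤ (2 + √2) * √R := by
      have e1 : (√2 + 1) * ((√2 - 1) * X) = (√2 * √2 - 1) * X := by ring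
      have e2 : (√2 + 1) * (√2 * √R) = (√2 * √2 + √2) * √R := by ring
      rw [e1, e2, h2] at h3
      linarith
    have h5 := mul_le_mul_of_nonneg_left h4 (Real.sqrt_nonneg 2)
    have e3 : √2 * ((2 + √2) * √R) = (2 * √2 + √2 * √2) * √R := by ring
    rw [e3, h2] at h5
    exact h5.trans (mul_le_mul_of_nonneg_right (by linarith) (Real.sqrt_nonneg R))
  have hY : Y ≤ 2 * R := by linarith
  rw [e]
  have h6 : √β * √T * (√2 * X) ≤ √β * √T * (5 * √R) :=
    mul_le_mul_of_nonneg_left hX (by positivity)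
  have h7 : 2 * K * Y ≤ 2 * K * (2 * R) := mul_le_mul_of_nonneg_left hY (by positivity)
  linarith

theorem theta_nonneg {T : ℕ} (hT : 1 ≤ T) {C : ℝ} (hC : 0 ≤ C) (j : ℕ) :
    0 ≤ theta (L := L) T C j := by
  have : 0 ≤ Real.log T := Real.log_nonneg (by exact_mod_cast hT)
  unfold theta
  positivity

/-- With `r = 2^{-j-1}`, `2 r C` is half of the `C`-part of `θ_j`, so the term `16 L log T` makes
the exponential at most `T⁻²`. This absorbs the trivial regret `L T` and the factor `2^{j+1} ≤ 4 T`
from dividing by `r`. -/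
theorem tail_le {T : ℕ} (hT : 2 ≤ T) {C : ℝ} (hC : 0 ≤ C) (j : Slot T) :
    2 ^ ((j : ℕ) + 1) * (Real.exp ((2 * ((2 : ℝ) ^ ((j : ℕ) + 1))⁻¹ * C -
      theta (L := L) T C j) / (2 * L)) * (L * T)) ≤ 4 * L := by
  rcases Nat.eq_zero_or_pos L with hL | hL
  · have : (L : ℝ) = 0 := by rw [hL, Nat.cast_zero]
    rw [this]
    simp
  have hL' : (0 : ℝ) < L := by exact_mod_cast hL
  have hT' : (2 : ℝ) ≤ T := by exact_mod_cast hT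
  have hT0 : (0 : ℝ) < T := by linarith
  have hlog : 0 ≤ Real.log T := Real.log_nonneg (by linarith)
  have h1 : (2 * ((2 : ℝ) ^ ((j : ℕ) + 1))⁻¹ * C - theta (L := L) T C j) / (2 * L) ≤
      -(2 * Real.log T) := by
    rw [div_le_iff₀ (by positivity), theta, pow_succ, mul_inv]
    have h3 : 0 ≤ C / 2 ^ (j : ℕ) := by positivity
    have e1 : 2 * (((2 : ℝ) ^ (j : ℕ))⁻¹ * 2⁻¹) * C = C / 2 ^ (j : ℕ) := by
      rw [div_eq_mul_inv]; ring
    have e2 : 2 * C / 2 ^ (j : ℕ) = 2 * (C / 2 ^ (j : ℕ)) := mul_div_assoc _ _ _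
    rw [e1, e2]
    have h4 := mul_nonneg hL'.le hlog
    linarith
  have h2 : Real.exp (-(2 * Real.log T)) = ((T : ℝ) * T)⁻¹ := by
    rw [Real.exp_neg, two_mul, Real.exp_add, Real.exp_log hT0]
  have h3 : (2 : ℝ) ^ ((j : ℕ) + 1) ≤ 4 * T := by
    have h4 : (2 : ℝ) ^ (j : ℕ) ≤ 2 ^ Nat.clog 2 T :=
      pow_le_pow_right₀ one_le_two (Nat.lt_succ_iff.1 j.2)
    have h5 := two_pow_clog_le hT
    rw [pow_succ]
    linarith
  calc 2 ^ ((j : ℕ) + 1) * (Real.exp ((2 * ((2 : ℝ) ^ ((j : ℕ) + 1))⁻¹ * C -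
        theta (L := L) T C j) / (2 * L)) * (L * T))
      ≤ 4 * T * (((T : ℝ) * T)⁻¹ * (L * T)) := by
        rw [← h2]
        gcongr
    _ = 4 * L := by field_simp

end Stabilise

/-! ### The regret of STABILISE -/

namespace Stabilise

open Thinning

section regret

variable [Nonempty (S 0)] [Subsingleton (S 0)] {T : ℕ} {base : ℝ → MDPAlgorithm S A}
  {fallback : Kernel (Memory S A T × unitInterval) (Policy S A)} [IsMarkovKernel fallback] {C : ℝ}
  {adv : Adversary} {Ω : Type u} [mΩ : MeasurableSpace Ω] {μ : Measure Ω} [IsProbabilityMeasure μ]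
  {ℱ : Filtration ℕ mΩ} {M : ℕ → Ω → MDP S A} {w : ℕ → Ω → unitInterval}
  {m : ℕ → Ω → Memory S A T} {p : ℕ → Ω → Policy S A} {x : ℕ → Ω → Traj S A} {b : ℕ → Ω → Bool}
  {β₁ β₂ β₃ : ℝ}

/-- Regret in the rounds for which the `j`-th instance is responsible. -/
theorem integral_active_le (hrob : CorruptionRobust adv T base β₁ β₂ β₃) (hT : 2 ≤ T) (hC0 : 0 ≤ C)
    (H : IsProtocolRun adv T (learner T base fallback C) μ ℱ M w m p x b)
    (P : Transition S A) (hC : ∀ᵐ ω ∂μ, ∑ t ∈ Finset.range T, corruption P (M t ω) ≤ C)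
    (q : Policy S A) (j : Slot T) :
    ∫ ω, ∑ t ∈ Finset.range T, {ω | w t ω ∈ activeSet T j}.indicator
        (fun ω => expLoss (M t ω) (p t ω) - expLoss (M t ω) q) ω ∂μ ≤
      usedCoeff T β₁ (β₂ + 16 * β₃ * L * Real.log T) j *
        μ.real (IsThinnedRun.used T fun t => {ω | w t ω ∈ activeSet T j}) +
        (4 * β₃ * C + 4 * L) := by
  have hT0 : 0 < T := by omega
  have hpos : (0 : ℝ) < (2 : ℝ) ^ ((j : ℕ) + 1) := by positivity
  have hr : (ENNReal.ofReal ((2 : ℝ) ^ ((j : ℕ) + 1))⁻¹).toReal = ((2 : ℝ) ^ ((j : ℕ) + 1))⁻¹ :=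
    ENNReal.toReal_ofReal (by positivity)
  have h1 := IsThinnedRun.integral_regret_le hrob (theta_nonneg (by omega) hC0 j)
    (isThinnedRun hT0 H j) hT0 (by rw [hr]; positivity) P hC q
  have h2 := tail_le (L := L) hT hC0 j
  rw [hr] at h1
  set I := ∫ ω, ∑ t ∈ Finset.range T, {ω | w t ω ∈ activeSet T j}.indicator
        (fun ω => expLoss (M t ω) (p t ω) - expLoss (M t ω) q) ω ∂μ
  set U := μ.real (IsThinnedRun.used T fun t => {ω | w t ω ∈ activeSet T j})
  set e := Real.exp ((2 * ((2 : ℝ) ^ ((j : ℕ) + 1))⁻¹ * C - theta (L := L) T C j) / (2 * L))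
  have hU0 : 0 ≤ U := measureReal_nonneg
  have hU1 : U ≤ 1 := measureReal_le_one
  have hβ3 : 0 ≤ β₃ := zero_le_one.trans hrob.2.2.1
  have hs : (2 : ℝ) ^ ((j : ℕ) + 1) * √(((2 : ℝ) ^ ((j : ℕ) + 1))⁻¹ * T) =
      √T * √2 ^ ((j : ℕ) + 1) := by
    have h3 : √2 ^ ((j : ℕ) + 1) * √2 ^ ((j : ℕ) + 1) = (2 : ℝ) ^ ((j : ℕ) + 1) := by
      rw [← mul_pow, Real.mul_self_sqrt zero_le_two]
    have h4 : √((2 : ℝ) ^ ((j : ℕ) + 1)) = √2 ^ ((j : ℕ) + 1) :=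
      (Real.sqrt_eq_iff_mul_self_eq (by positivity) (by positivity)).2 h3.symm
    have h5 : 0 < √2 ^ ((j : ℕ) + 1) := by positivity
    rw [Real.sqrt_mul (by positivity), Real.sqrt_inv, h4]
    nth_rewrite 1 [← h3]
    field_simp
  -- The `C`-part of `θ_j` scales like `r`, so after division by `r` every instance pays the same `4
  -- C`; only the logarithmic part still grows with `2^j`.
  have hθ : (2 : ℝ) ^ ((j : ℕ) + 1) * theta (L := L) T C j =
      4 * C + 2 ^ ((j : ℕ) + 1) * (16 * L * Real.log T) := by
    rw [theta, mul_add]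
    congr 1
    rw [pow_succ]
    field_simp
    ring
  have h3 := mul_le_mul_of_nonneg_left h1 hpos.le
  rw [mul_inv_cancel_left₀ hpos.ne'] at h3
  refine h3.trans ?_
  have h4 : (2 : ℝ) ^ ((j : ℕ) + 1) * ((√β₁ * √(((2 : ℝ) ^ ((j : ℕ) + 1))⁻¹ * T) +
      (β₂ + β₃ * theta (L := L) T C j)) * U + e * (L * T)) =
      (√β₁ * ((2 : ℝ) ^ ((j : ℕ) + 1) * √(((2 : ℝ) ^ ((j : ℕ) + 1))⁻¹ * T)) +
      (2 ^ ((j : ℕ) + 1) * β₂ + β₃ * (2 ^ ((j : ℕ) + 1) * theta (L := L) T C j))) * U +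
      2 ^ ((j : ℕ) + 1) * (e * (L * T)) := by ring
  rw [h4, hs, hθ, usedCoeff]
  have h5 : 4 * β₃ * C * U ≤ 4 * β₃ * C := mul_le_of_le_one_right (by positivity) hU1
  linarith

theorem sum_indicator_active (g : ℝ) (v : unitInterval) :
    g = {v : unitInterval | (v : ℝ) ≤ 1 / T}.indicator (fun _ => g) v +
      ∑ j : Slot T, (activeSet T j).indicator (fun _ => g) v := by
  by_cases hv : (v : ℝ) ≤ 1 / T
  · rw [Set.indicator_of_mem (show v ∈ {v : unitInterval | (v : ℝ) ≤ 1 / T} from hv),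
      Finset.sum_eq_zero fun j _ => Set.indicator_of_notMem (fun h => not_lt.2 hv h.1) _, add_zero]
  · rw [Set.indicator_of_notMem (show v ∉ {v : unitInterval | (v : ℝ) ≤ 1 / T} from hv), zero_add,
      Finset.sum_eq_single (slot T v)
        (fun j _ hj => Set.indicator_of_notMem (fun h => hj h.2.symm) _) (by simp),
      Set.indicator_of_mem (show v ∈ activeSet T (slot T v) from ⟨not_le.1 hv, rfl⟩)]

/-- The event that some round is ignored. -/
def someIgnored (T : ℕ) (w : ℕ → Ω → unitInterval) : Set Ω :=
  ⋃ t : Fin T, {ω | (w t ω : ℝ) ≤ 1 / T}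

/-- A round is either ignored or active for exactly one instance. Ignored rounds are charged `L`
each, on the event that there is one. -/
theorem integral_regret_le (hrob : CorruptionRobust adv T base β₁ β₂ β₃) (hT : 2 ≤ T) (hC0 : 0 ≤ C)
    (H : IsProtocolRun adv T (learner T base fallback C) μ ℱ M w m p x b)
    (P : Transition S A) (hC : ∀ᵐ ω ∂μ, ∑ t ∈ Finset.range T, corruption P (M t ω) ≤ C)
    (q : Policy S A) :
    ∫ ω, ∑ t ∈ Finset.range T, (expLoss (M t ω) (p t ω) - expLoss (M t ω) q) ∂μ ≤
      L * T * μ.real (someIgnored T w) +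
      ∑ j : Slot T, (usedCoeff T β₁ (β₂ + 16 * β₃ * L * Real.log T) j *
        μ.real (IsThinnedRun.used T fun t => {ω | w t ω ∈ activeSet T j}) +
        (4 * β₃ * C + 4 * L)) := by
  have hT0 : 0 < T := by omega
  have hr : ∀ t ∈ Finset.range T,
      Integrable (fun ω => expLoss (M t ω) (p t ω) - expLoss (M t ω) q) μ := fun t ht =>
    Integrable.of_bound ((IsThinnedRun.measurable_expLoss_sub q).comp
      ((isThinnedRun hT0 H 0).measurable_prodMk (Finset.mem_range.1 ht))).aestronglyMeasurable L
      (ae_of_all _ fun ω => abs_expLoss_sub_le _ _ _)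
  have hign : ∀ t ∈ Finset.range T, MeasurableSet {ω | (w t ω : ℝ) ≤ 1 / T} := fun t ht =>
    ((H.prob_meas t (Finset.mem_range.1 ht)).mono (ℱ.le _) le_rfl) (measurableSet_ignored T)
  have hact : ∀ (j : Slot T), ∀ t ∈ Finset.range T, MeasurableSet {ω | w t ω ∈ activeSet T j} :=
    fun j t ht => (isThinnedRun hT0 H j).active_meas' (Finset.mem_range.1 ht)
  have hi1 : Integrable (fun ω => ∑ t ∈ Finset.range T, {ω | (w t ω : ℝ) ≤ 1 / T}.indicator
      (fun ω => expLoss (M t ω) (p t ω) - expLoss (M t ω) q) ω) μ :=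
    integrable_finsetSum _ fun t ht => (hr t ht).indicator (hign t ht)
  have hi2 : ∀ j : Slot T, Integrable (fun ω => ∑ t ∈ Finset.range T,
      {ω | w t ω ∈ activeSet T j}.indicator
        (fun ω => expLoss (M t ω) (p t ω) - expLoss (M t ω) q) ω) μ := fun j =>
    integrable_finsetSum _ fun t ht => (hr t ht).indicator (hact j t ht)
  have hdec : ∀ ω, ∑ t ∈ Finset.range T, (expLoss (M t ω) (p t ω) - expLoss (M t ω) q) =
      ∑ t ∈ Finset.range T, {ω | (w t ω : ℝ) ≤ 1 / T}.indicator
        (fun ω => expLoss (M t ω) (p t ω) - expLoss (M t ω) q) ω +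
      ∑ j : Slot T, ∑ t ∈ Finset.range T, {ω | w t ω ∈ activeSet T j}.indicator
        (fun ω => expLoss (M t ω) (p t ω) - expLoss (M t ω) q) ω := by
    intro ω
    rw [Finset.sum_comm, ← Finset.sum_add_distrib]
    exact Finset.sum_congr rfl fun t _ => sum_indicator_active _ (w t ω)
  simp_rw [hdec]
  rw [integral_add hi1 (integrable_finsetSum _ fun j _ => hi2 j),
    integral_finsetSum _ fun j _ => hi2 j]
  refine add_le_add ?_ (Finset.sum_le_sum fun j _ => integral_active_le hrob hT hC0 H P hC q j)
  have hms : MeasurableSet (someIgnored T w) :=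
    MeasurableSet.iUnion fun t => hign t (Finset.mem_range.2 t.2)
  calc ∫ ω, ∑ t ∈ Finset.range T, {ω | (w t ω : ℝ) ≤ 1 / T}.indicator
        (fun ω => expLoss (M t ω) (p t ω) - expLoss (M t ω) q) ω ∂μ
      ≤ ∫ ω, (someIgnored T w).indicator (fun _ => (L : ℝ) * T) ω ∂μ := by
        refine integral_mono hi1 ((integrable_const _).indicator hms) fun ω => ?_
        by_cases hω : ω ∈ someIgnored T w
        · rw [Set.indicator_of_mem hω]
          calc _ ≤ ∑ t ∈ Finset.range T, (L : ℝ) := by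
                refine Finset.sum_le_sum fun t _ => ?_
                exact Set.indicator_apply_le' (fun _ => (le_abs_self _).trans
                  (abs_expLoss_sub_le _ _ _)) fun _ => Nat.cast_nonneg _
            _ = L * T := by simp [mul_comm]
        · rw [Set.indicator_of_notMem hω]
          refine Finset.sum_nonpos fun t ht => (Set.indicator_of_notMem ?_ _).le
          exact fun h => hω (Set.mem_iUnion.2 ⟨⟨t, Finset.mem_range.1 ht⟩, h⟩)
    _ = L * T * μ.real (someIgnored T w) := by
        rw [integral_indicator_const _ hms, smul_eq_mul, mul_comm]

/-- STABILISE turns a corruption-robust algorithm into a stable one. -/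
theorem halfStable (hrob : CorruptionRobust adv T base β₁ β₂ β₃) (hT : 2 ≤ T) :
    HalfStable adv T (learner T base fallback) (100 * (β₁ * Real.log T))
      (100 * (β₂ + β₃ * L * Real.log T)) (100 * (β₃ * Real.log T)) := by
  have hT0 : 0 < T := by omega
  have hlog : 1 / 2 ≤ Real.log T := by
    have h1 := Real.log_two_gt_d9
    have h2 : Real.log 2 ≤ Real.log T := Real.log_le_log two_pos (by exact_mod_cast hT)
    linarith
  obtain ⟨hβ1, hβ2, hβ3, -⟩ := id hrob
  have hβ1' : 0 ≤ β₁ := (sq_nonneg _).trans hβ1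
  have hL0 : (0 : ℝ) ≤ L := Nat.cast_nonneg _
  have hβ2' : 0 ≤ β₂ := hL0.trans hβ2
  have hβ3' : 0 ≤ β₃ := zero_le_one.trans hβ3
  have hLlog : 0 ≤ L * Real.log T := by positivity
  have hβ3L : L * Real.log T ≤ β₃ * L * Real.log T := by
    rw [mul_assoc]
    exact le_mul_of_one_le_left hLlog hβ3
  refine ⟨by nlinarith, by nlinarith, by nlinarith, ?_⟩
  intro C hC0 Ω mΩ μ _ ℱ M w m p x b H P hC q
  replace H : IsProtocolRun adv T (learner T base fallback C) μ ℱ M w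
    (m : ℕ → Ω → Memory S A T) p x b := H
  have hmain := integral_regret_le hrob hT hC0 H P hC q
  have hms : MeasurableSet (someIgnored T w) := MeasurableSet.iUnion fun t =>
    ((H.prob_meas t t.2).mono (ℱ.le _) le_rfl) (measurableSet_ignored T)
  set K := β₂ + 16 * β₃ * L * Real.log T with hK
  have hK0 : 0 ≤ K := by positivity
  set used : Slot T → Set Ω := fun j =>
    IsThinnedRun.used T fun t => {ω | w t ω ∈ activeSet T j} with hused
  have hmu : ∀ j, MeasurableSet (used j) := fun j => (isThinnedRun hT0 H j).measurableSet_used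
  have hcoef : ∀ j : ℕ, 0 ≤ usedCoeff T β₁ K j := usedCoeff_nonneg T β₁ hK0
  -- `Φ` collects everything to be compared pointwise with `ρ_T`. There are at most `5 log T`
  -- instances with remainder `4 β₃ C + 4 L`: the `L`-part gives the constant `20 L log T` here, and
  -- the `C`-part goes into the last constant.
  let Φ : Ω → ℝ := fun ω => (someIgnored T w).indicator (fun _ => (L : ℝ) * T) ω +
    ∑ j : Slot T, (used j).indicator (fun _ => usedCoeff T β₁ K j) ω + 20 * (L * Real.log T)
  have hΦ1 : Integrable ((someIgnored T w).indicator fun _ => (L : ℝ) * T) μ :=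
    (integrable_const _).indicator hms
  have hΦ2 : ∀ j : Slot T, Integrable ((used j).indicator fun _ => usedCoeff T β₁ K j) μ :=
    fun j => (integrable_const _).indicator (hmu j)
  have hΦ3 : Integrable (fun ω => ∑ j : Slot T, (used j).indicator
      (fun _ => usedCoeff T β₁ K j) ω) μ := integrable_finsetSum _ fun j _ => hΦ2 j
  have hΦ4 : Integrable (fun ω => (someIgnored T w).indicator (fun _ => (L : ℝ) * T) ω +
      ∑ j : Slot T, (used j).indicator (fun _ => usedCoeff T β₁ K j) ω) μ := hΦ1.add hΦ3
  have hΦi : Integrable Φ μ := hΦ4.add (integrable_const _)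
  have hΦ0 : ∀ ω, 0 ≤ Φ ω := fun ω => add_nonneg (add_nonneg
    (Set.indicator_nonneg (fun _ _ => by positivity) ω) (Finset.sum_nonneg fun j _ =>
      Set.indicator_nonneg (fun _ _ => hcoef j) ω)) (by positivity)
  have hΦint : ∫ ω, Φ ω ∂μ = L * T * μ.real (someIgnored T w) +
      ∑ j : Slot T, usedCoeff T β₁ K j * μ.real (used j) + 20 * (L * Real.log T) := by
    have e1 : ∫ ω, Φ ω ∂μ = ∫ ω, (someIgnored T w).indicator (fun _ => (L : ℝ) * T) ω ∂μ +
        ∫ ω, ∑ j : Slot T, (used j).indicator (fun _ => usedCoeff T β₁ K j) ω ∂μ +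
        ∫ _, 20 * (L * Real.log T) ∂μ := by
      rw [← integral_add hΦ1 hΦ3, ← integral_add hΦ4 (integrable_const _)]
    rw [e1, integral_finsetSum _ fun j _ => hΦ2 j, integral_indicator_const _ hms, smul_eq_mul,
      mul_comm (μ.real _), integral_const, probReal_univ, one_smul]
    congr 2
    refine Finset.sum_congr rfl fun j _ => ?_
    rw [integral_indicator_const _ (hmu j), smul_eq_mul, mul_comm]
  have hbins := clog_add_one_le hT
  have hsum : ∫ ω, ∑ t ∈ Finset.range T, (expLoss (M t ω) (p t ω) - expLoss (M t ω) q) ∂μ ≤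
      ∫ ω, Φ ω ∂μ + 100 * (β₃ * Real.log T) * C := by
    refine hmain.trans ?_
    rw [hΦint, Finset.sum_add_distrib, Finset.sum_const, Finset.card_univ, Fintype.card_fin,
      nsmul_eq_mul]
    push_cast
    have h1 : (Nat.clog 2 T + 1 : ℝ) * (4 * β₃ * C + 4 * L) ≤
        5 * Real.log T * (4 * β₃ * C + 4 * L) :=
      mul_le_mul_of_nonneg_right hbins (by positivity)
    have h2 : 0 ≤ β₃ * Real.log T * C := by positivity
    linarith
  refine (ENNReal.ofReal_le_ofReal hsum).trans (ENNReal.ofReal_add_le.trans ?_)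
  refine add_le_add ?_ le_rfl
  rw [ofReal_integral_eq_lintegral_ofReal hΦi (ae_of_all _ hΦ0)]
  refine lintegral_mono fun ω => ?_
  obtain ⟨R, hR1, hRρ, hRign, hRused⟩ := exists_le_rho (w := w) (ω := ω) hT0
  have hR0 : 0 ≤ R := zero_le_one.trans hR1
  have hpt : Φ ω ≤ √(100 * (β₁ * Real.log T) * R * T) + 100 * (β₂ + β₃ * L * Real.log T) * R := by
    classical
    have h1 : (someIgnored T w).indicator (fun _ => (L : ℝ) * T) ω ≤ L * R := by
      refine Set.indicator_apply_le' (fun hω => ?_) fun _ => by positivity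
      obtain ⟨t, ht⟩ := Set.mem_iUnion.1 hω
      exact mul_le_mul_of_nonneg_left (hRign ⟨t, t.2, ht⟩) hL0
    have h2 : ∑ j : Slot T, (used j).indicator (fun _ => usedCoeff T β₁ K j) ω ≤
        5 * (√β₁ * √T * √R) + 4 * K * R := by
      simp_rw [Set.indicator_apply]
      exact sum_usedCoeff_le T β₁ hK0 hR0 _ (fun j => ω ∈ used j) fun j hj => hRused j hj
    have h3 : 5 * (√β₁ * √T * √R) ≤ √(100 * (β₁ * Real.log T) * R * T) := by
      refine Real.le_sqrt_of_sq_le ?_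
      have e1 : (5 * (√β₁ * √T * √R)) ^ 2 = 25 * (√β₁ ^ 2 * √T ^ 2 * √R ^ 2) := by ring
      rw [e1, Real.sq_sqrt hβ1', Real.sq_sqrt (Nat.cast_nonneg _), Real.sq_sqrt hR0]
      -- The comparison reduces to `25 ≤ 100 log T`, which holds as `log T ≥ 1 / 2`.
      have h4 : 0 ≤ β₁ * T * R := by positivity
      nlinarith
    have h4 : L * R + 4 * K * R + 20 * (L * Real.log T) ≤
        100 * (β₂ + β₃ * L * Real.log T) * R := by
      -- The constant term is absorbed using `R ≥ 1`. The coefficients total at most `5 β₂ + 84 β₃ L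
      -- log T`, by `L ≤ β₂` and `β₃ ≥ 1`.
      have h5 : 20 * (L * Real.log T) ≤ 20 * (L * Real.log T) * R :=
        le_mul_of_one_le_right (by positivity) hR1
      have h6 : (L + 4 * K + 20 * (L * Real.log T)) * R ≤
          100 * (β₂ + β₃ * L * Real.log T) * R := by
        refine mul_le_mul_of_nonneg_right ?_ hR0
        rw [hK]
        linarith
      linarith
    change _ + _ + _ ≤ _
    linarith
  refine (ENNReal.ofReal_le_ofReal hpt).trans (ENNReal.ofReal_add_le.trans (add_le_add ?_ ?_))
  · rw [Real.sqrt_eq_rpow, ← ENNReal.ofReal_rpow_of_nonneg (by positivity) (by norm_num),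
      ENNReal.ofReal_mul (by positivity), ENNReal.ofReal_mul (by positivity), ENNReal.ofReal_natCast]
    gcongr
  · rw [ENNReal.ofReal_mul (by positivity)]
    gcongr

end regret

end Stabilise

end

theorem mainTheorem2 :
    ∃ c : ℝ, 0 < c ∧
      ∀ (adv : Adversary) (L : ℕ) (S : Fin (L + 1) → Type u) (A : Type u)
        [∀ k, Fintype (S k)] [∀ k, Nonempty (S k)]
        [Subsingleton (S 0)] [Subsingleton (S (Fin.last L))]
        [Fintype A] [Nonempty A]
        (T : ℕ) (_hT : 2 ≤ T) (base : ℝ → MDPAlgorithm S A) (β₁ β₂ β₃ : ℝ),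
        CorruptionRobust adv T base β₁ β₂ β₃ →
        ∃ β₁' β₂' β₃' : ℝ,
          β₁' ≤ c * (β₁ * Real.log T) ∧
          β₂' ≤ c * (β₂ + β₃ * L * Real.log T) ∧
          β₃' ≤ c * (β₃ * Real.log T) ∧
          ∀ (fallback : Kernel (Stabilise.Memory S A T × unitInterval) (LayeredMDP.Policy S A))
            [IsMarkovKernel fallback],
            HalfStable adv T (Stabilise.learner T base fallback) β₁' β₂' β₃' := by
  refine ⟨100, by norm_num, ?_⟩
  intro adv L S A _ _ _ _ _ _ T hT base β₁ β₂ β₃ hrob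
  exact ⟨_, _, _, le_rfl, le_rfl, le_rfl, fun fallback _ => Stabilise.halfStable hrob hT⟩
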